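/- Let $d\ge 2$ and let $\mathbb B^d$ be the set of non-oriented nearest-neighbour bonds $\{x,y\}$ of $\mathbb Z^d$ ($x,y\in\mathbb Z^d$, $|x-y|=1$). For $\omega:\mathbb B^d\to(0,\infty)$ write $\omega(x,y)=\omega(\{x,y\})$ if $\{x,y\}\in\mathbb B^d$ and $\omega(x,y)=0$ otherwise, and for $u:\mathbb Z^d\to\mathbb R$ set $$(\mathcal L^\omega u)(x)=\sum_{y\in\mathbb Z^d}\omega(x,y)\,(u(y)-u(x)).$$ For $y\in\mathbb Z^d$ and real $r\ge 0$ let $B(y,r)=y+([-r,r]\cap\mathbb Z)^d$. For a finite non-empty set $S\subset\mathbb Z^d$ let $\operatorname{osc}(u,S)=\max_S u-\min_S u$, let $S_{\mathbb B}$ be the set of bonds with both end-points in $S$ and, if $S_{\mathbb B}\neq\emptyset$, for $F:\mathbb B^d\to\mathbb R$ let $$\|F\|_{\underline L^p(S)}=\Big(\frac1{|S_{\mathbb B}|}\sum_{e\in S_{\mathbb B}}|F(e)|^p\Big)^{1/p}\quad(1\le p<\infty),\qquad \|F\|_{\underline L^\infty(S)}=\sup_{e\in S_{\mathbb B}}|F(e)|.$$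 If $d=2$, put $p=q=1$; if $d\ge3$, let $p,q\in(1,\infty]$ satisfy $\frac1p+\frac1q<\frac2{d-1}$. Then there is a continuous, monotonically increasing function $\theta_{\rm E}:[1,\infty)\to(0,1)$, depending only on $d,p,q$, such that the following holds for every $\omega:\mathbb B^d\to(0,\infty)$, every $x_0\in\mathbb Z^d$, every real $n\ge\frac14$ and every $u:\mathbb Z^d\to\mathbb R$ with $\mathcal L^\omega u=0$ in $B(x_0,4n)$: the number $\Lambda=\|\omega\|_{\underline L^p(B(x_0,4n))}\,\|\omega^{-1}\|_{\underline L^q(B(x_0,4n))}$ satisfies $\Lambda\ge1$, and $$\operatorname{osc}(u,B(x_0,n))\le\theta_{\rm E}(\Lambda)\,\operatorname{osc}(u,B(x_0,4n)).$$ -/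

import Mathlib

open scoped ENNReal

noncomputable section

/-- The nearest-neighbour graph of `ℤ^d`: `x` and `y` are adjacent iff their Euclidean distance
is `1`. -/
def latticeGraph (d : ℕ) : SimpleGraph (Fin d → ℤ) where
  Adj x y := ∑ i, (x i - y i) ^ 2 = 1
  symm := ⟨fun x y h => by
    rw [← h]
    exact Finset.sum_congr rfl fun i _ => by ring⟩
  loopless := ⟨fun x h => by simp at h⟩

/-- The set of non-oriented nearest-neighbour bonds of `ℤ^d`. -/
abbrev Bond (d : ℕ) : Type := (latticeGraph d).edgeSet

open Classical in
/-- `ω(x, y)`: the conductance of the bond `{x, y}`, and `0` if `{x, y}` is not a bond. -/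
def conductance {d : ℕ} (ω : Bond d → ℝ) (x y : Fin d → ℤ) : ℝ :=
  if h : s(x, y) ∈ (latticeGraph d).edgeSet then ω ⟨s(x, y), h⟩ else 0

/-- The operator `(L^ω u)(x) = ∑_y ω(x, y) (u(y) - u(x))`. Only finitely many terms are
non-zero, see `generator_support_finite`. -/
def generator {d : ℕ} (ω : Bond d → ℝ) (u : (Fin d → ℤ) → ℝ) (x : Fin d → ℤ) : ℝ :=
  ∑ᶠ y, conductance ω x y * (u y - u x)

/-- The box `B(y, r) = y + ([-r, r] ∩ ℤ)^d`, see `mem_latticeBall`. -/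
def latticeBall {d : ℕ} (y : Fin d → ℤ) (r : ℝ) : Finset (Fin d → ℤ) :=
  Finset.Icc (fun i => y i - ⌊r⌋) (fun i => y i + ⌊r⌋)

theorem mem_latticeBall {d : ℕ} {x y : Fin d → ℤ} {r : ℝ} :
    x ∈ latticeBall y r ↔ ∀ i, |(x i : ℝ) - y i| ≤ r := by
  simp only [latticeBall, Finset.mem_Icc, Pi.le_def, ← forall_and]
  refine forall_congr' fun i => ?_
  have h : |(x i : ℝ) - y i| ≤ r ↔ |x i - y i| ≤ ⌊r⌋ := by
    rw [Int.le_floor]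
    push_cast
    rfl
  rw [h, abs_le]
  constructor <;> rintro ⟨h1, h2⟩ <;> constructor <;> linarith

theorem generator_support_finite {d : ℕ} (ω : Bond d → ℝ) (u : (Fin d → ℤ) → ℝ)
    (x : Fin d → ℤ) :
    (Function.support fun y => conductance ω x y * (u y - u x)).Finite := by
  refine (latticeBall x 1).finite_toSet.subset fun y hy => ?_
  have hxy : (latticeGraph d).Adj x y := by
    by_contra h
    apply hy
    simp [conductance, SimpleGraph.mem_edgeSet, h]
  rw [Finset.mem_coe, mem_latticeBall]
  intro i
  have h1 : (x i - y i) ^ 2 ≤ 1 := by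
    have h2 : ∑ i, (x i - y i) ^ 2 = 1 := hxy
    rw [← h2]
    exact Finset.single_le_sum (f := fun i => (x i - y i) ^ 2) (fun j _ => sq_nonneg _)
      (Finset.mem_univ i)
  have h3 : |y i - x i| ≤ 1 := by
    rw [abs_sub_comm]
    exact (sq_le_one_iff_abs_le_one _).1 h1
  exact_mod_cast h3

open Classical in
/-- The bonds both of whose end-points lie in `S`. -/
def bondsIn {d : ℕ} (S : Finset (Fin d → ℤ)) : Finset (Bond d) :=
  S.sym2.subtype (fun e => e ∈ (latticeGraph d).edgeSet)

theorem mem_bondsIn {d : ℕ} {S : Finset (Fin d → ℤ)} {e : Bond d} :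
    e ∈ bondsIn S ↔ ∀ x ∈ e.1, x ∈ S := by
  simp [bondsIn, Finset.mem_sym2_iff]

/-- The normalized norm `(|S_𝔹|⁻¹ ∑_{e ∈ S_𝔹} |F e| ^ p) ^ (1 / p)` over the bonds of `S`, which
for `p = ∞` is `sup_{e ∈ S_𝔹} |F e|`. -/
def avgNorm {d : ℕ} (p : ℝ≥0∞) (S : Finset (Fin d → ℤ)) (F : Bond d → ℝ) : ℝ :=
  if p = ∞ then sSup ((fun e => |F e|) '' (bondsIn S : Set (Bond d)))
  else (((bondsIn S).card : ℝ)⁻¹ * ∑ e ∈ bondsIn S, |F e| ^ p.toReal) ^ (1 / p.toReal)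

/-- The oscillation `max_S u - min_S u` on a (non-empty) finite set `S`. -/
def osc {d : ℕ} (u : (Fin d → ℤ) → ℝ) (S : Finset (Fin d → ℤ)) : ℝ :=
  sSup (u '' (S : Set (Fin d → ℤ))) - sInf (u '' (S : Set (Fin d → ℤ)))

end

/-! After an affine normalisation the solution takes values in (0,1) on the large box. Either it or
one minus it, call it `z`, is at least 1/2 on half of the points of the box of radius 2N, where N =
⌊n⌋ ≥ 1. If such a `z` is at least δ on the box of radius N, the oscillation contracts by 1 - δ. So
everything rests on an upper bound for v = -log(2z), with a constant times a power of Λ on the right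
(`LogBound`).

Testing the equation with η²/z bounds the weighted Dirichlet energy of log z by the mean conductance
(`log_caccioppoli`). Hölder's inequality against the moments of ω⁻¹ removes the weight at the price
of an exponent s < 2 with q = s/(2 - s). Since the positive part of v vanishes on half of the box, a
Poincaré inequality turns this into a W^{1,s} bound (`exists_log_sobolevPow_le`). As log is concave,
v is a subsolution, and it remains to pass from the W^{1,s} norm to the supremum.

For d ≥ 3 this is a De Giorgi iteration. What yields the threshold 2/(d-1) instead of 2/d is the
choice of the cutoff: it is radial in the maximum norm and decreases only across radii where both
the p-th moment of ω and the W^{1,s} norm of the truncated function, restricted to the faces of the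
cube, are comparable to their averages (`exists_profile`). The error term of the Caccioppoli
inequality then lives on faces, so Sobolev's inequality is needed in dimension D = d - 1 only
(`exists_sum_slice_le`). The step is superlinear exactly when χ = t(1 - 1/p)/2 > 1, where 1/s = 1/t
+ 1/D, that is, when 1/p + 1/q < 2/D.

For d = 2 the faces are segments, on which W^{1,1} embeds into L^∞. One good square has v bounded on
its boundary, and the maximum principle carries the bound inside (`logBound_two`). -/

namespace RandomConductance

/-! ### Boxes and forward differences -/

/-- The box `([-R, R] ∩ ℤ)^d`. -/
noncomputable def box (d : ℕ) (R : ℤ) : Finset (Fin d → ℤ) := Fintype.piFinset fun _ => Finset.Icc (-R) R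

theorem mem_box {d : ℕ} {R : ℤ} {x : Fin d → ℤ} : x ∈ box d R ↔ ∀ i, -R ≤ x i ∧ x i ≤ R := by
  simp [box, Fintype.mem_piFinset]

theorem box_mono {d : ℕ} {R S : ℤ} (h : R ≤ S) : box d R ⊆ box d S := by
  intro x hx
  rw [mem_box] at hx ⊢
  intro i
  have := hx i
  constructor <;> omega

theorem zero_mem_box {d : ℕ} {R : ℤ} (h : 0 ≤ R) : (0 : Fin d → ℤ) ∈ box d R :=
  mem_box.2 fun _ => ⟨by simpa using h, by simpa using h⟩

theorem card_Icc_symm {R : ℤ} (h : 0 ≤ R) : ((Finset.Icc (-R) R).card : ℝ) = 2 * R + 1 := by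
  rw [Int.card_Icc]
  have h1 : ((R + 1 - -R).toNat : ℤ) = 2 * R + 1 := by omega
  exact_mod_cast h1

theorem card_box (d : ℕ) {R : ℤ} (h : 0 ≤ R) : ((box d R).card : ℝ) = (2 * R + 1) ^ d := by
  simp [box, Fintype.card_piFinset, ← card_Icc_symm h]

theorem update_mem_box {d : ℕ} {R : ℤ} {x : Fin d → ℤ} (hx : x ∈ box d R) (i : Fin d) {t : ℤ}
    (ht : t ∈ Finset.Icc (-R) R) : Function.update x i t ∈ box d R := by
  rw [mem_box] at hx ⊢
  intro j
  by_cases hj : j = i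
  · subst hj
    simpa using ht
  · simpa [hj] using hx j

/-- The forward difference of `f` in direction `i`. -/
noncomputable def fdiff {d : ℕ} (i : Fin d) (f : (Fin d → ℤ) → ℝ) (x : Fin d → ℤ) : ℝ :=
  f (x + Pi.single i 1) - f x

theorem update_add_single {d : ℕ} (x : Fin d → ℤ) (i : Fin d) (t : ℤ) :
    Function.update x i t + Pi.single i 1 = Function.update x i (t + 1) := by
  ext j
  by_cases hj : j = i
  · subst hj
    simp
  · simp [hj]

/-- The map (x, t) ↦ (x with i-th coordinate t, xᵢ) is an involution of box × interval. -/
theorem sum_box_sum_update {d : ℕ} (i : Fin d) {R : ℤ} (hR : 0 ≤ R)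
    (F : (Fin d → ℤ) → ℝ) :
    ∑ x ∈ box d R, ∑ t ∈ Finset.Icc (-R) R, F (Function.update x i t) =
      (2 * R + 1) * ∑ x ∈ box d R, F x := by
  have key : ∑ z ∈ box d R ×ˢ Finset.Icc (-R) R, F (Function.update z.1 i z.2) =
      ∑ z ∈ box d R ×ˢ Finset.Icc (-R) R, F z.1 := by
    refine Finset.sum_nbij' (fun z => (Function.update z.1 i z.2, z.1 i))
      (fun z => (Function.update z.1 i z.2, z.1 i)) ?_ ?_ ?_ ?_ ?_
    · rintro ⟨x, t⟩ hz
      rw [Finset.mem_product] at hz ⊢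
      exact ⟨update_mem_box hz.1 i hz.2, Finset.mem_Icc.2 (mem_box.1 hz.1 i)⟩
    · rintro ⟨x, t⟩ hz
      rw [Finset.mem_product] at hz ⊢
      exact ⟨update_mem_box hz.1 i hz.2, Finset.mem_Icc.2 (mem_box.1 hz.1 i)⟩
    · rintro ⟨x, t⟩ -
      simp
    · rintro ⟨x, t⟩ -
      simp
    · rintro ⟨x, t⟩ -
      rfl
  rw [Finset.sum_product, Finset.sum_product] at key
  rw [key]
  simp only [Finset.sum_const, nsmul_eq_mul, ← Finset.mul_sum, card_Icc_symm hR]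

/-! ### Variation along lines and Poincaré inequalities -/

/-- The total variation of `f` along the line of `box d R` through `x` in direction `i`. -/
noncomputable def lineVar {d : ℕ} (i : Fin d) (R : ℤ) (f : (Fin d → ℤ) → ℝ) (x : Fin d → ℤ) : ℝ :=
  ∑ t ∈ Finset.Icc (-R) R, if t < R then |fdiff i f (Function.update x i t)| else 0

theorem abs_sub_le_sum_Ico (g : ℤ → ℝ) {a b : ℤ} (hab : a ≤ b) :
    |g b - g a| ≤ ∑ t ∈ Finset.Ico a b, |g (t + 1) - g t| := by
  induction b, hab using Int.leInduction with
  | base => simp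
  | succ b hb ih =>
    have : Finset.Ico a (b + 1) = insert b (Finset.Ico a b) := by
      ext t
      simp only [Finset.mem_Ico, Finset.mem_insert]
      omega
    rw [this, Finset.sum_insert (by simp)]
    calc |g (b + 1) - g a| = |(g (b + 1) - g b) + (g b - g a)| := by ring_nf
      _ ≤ _ := (abs_add_le _ _).trans (by gcongr)

theorem abs_sub_update_le_lineVar {d : ℕ} (i : Fin d) {R : ℤ} (f : (Fin d → ℤ) → ℝ)
    {x : Fin d → ℤ} (hx : x ∈ box d R) {t : ℤ} (ht : t ∈ Finset.Icc (-R) R) :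
    |f x - f (Function.update x i t)| ≤ lineVar i R f x := by
  have aux : ∀ a b : ℤ, -R ≤ a → a ≤ b → b ≤ R →
      |f (Function.update x i b) - f (Function.update x i a)| ≤ lineVar i R f x := by
    intro a b ha hab hb
    refine (abs_sub_le_sum_Ico (fun t => f (Function.update x i t)) hab).trans ?_
    rw [lineVar, ← Finset.sum_filter]
    have : ∀ t, fdiff i f (Function.update x i t) =
        f (Function.update x i (t + 1)) - f (Function.update x i t) := fun t => by
      rw [fdiff, update_add_single]
    simp only [this]
    refine Finset.sum_le_sum_of_subset_of_nonneg (fun t ht => ?_) fun _ _ _ => abs_nonneg _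
    rw [Finset.mem_Ico] at ht
    rw [Finset.mem_filter, Finset.mem_Icc]
    omega
  have hx' := mem_box.1 hx i
  rw [Finset.mem_Icc] at ht
  rcases le_total t (x i) with h | h
  · have := aux t (x i) ht.1 h hx'.2
    rwa [Function.update_eq_self] at this
  · have := aux (x i) t hx'.1 h ht.2
    rwa [Function.update_eq_self, abs_sub_comm] at this

/-- The sum of `|∂ᵢ f| ^ s` over the bonds of `box d R` that point in direction `i`. -/
noncomputable def dirPow {d : ℕ} (s : ℝ) (i : Fin d) (R : ℤ) (f : (Fin d → ℤ) → ℝ) : ℝ :=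
  ∑ x ∈ box d R, if x i < R then |fdiff i f x| ^ s else 0

theorem dirPow_nonneg {d : ℕ} (s : ℝ) (i : Fin d) (R : ℤ) (f : (Fin d → ℤ) → ℝ) :
    0 ≤ dirPow s i R f :=
  Finset.sum_nonneg fun t _ => by split_ifs <;> positivity

/-- Hölder on a line of 2R+1 points costs (2R+1)^(s-1). The last factor 2R+1 arises because every
point of a line carries the variation of that whole line. -/
theorem sum_lineVar_rpow_le {d : ℕ} {s : ℝ} (hs : 1 ≤ s) (i : Fin d) {R : ℤ} (hR : 0 ≤ R)
    (f : (Fin d → ℤ) → ℝ) :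
    ∑ x ∈ box d R, lineVar i R f x ^ s ≤ (2 * R + 1 : ℝ) ^ s * dirPow s i R f := by
  have hL : (0 : ℝ) < 2 * R + 1 := by
    have : (0 : ℝ) ≤ R := by exact_mod_cast hR
    linarith
  calc ∑ x ∈ box d R, lineVar i R f x ^ s
      ≤ ∑ x ∈ box d R, (2 * R + 1 : ℝ) ^ (s - 1) * ∑ t ∈ Finset.Icc (-R) R,
          (if t < R then |fdiff i f (Function.update x i t)| ^ s else 0) := by
        refine Finset.sum_le_sum fun x _ => ?_
        have := Real.rpow_sum_le_const_mul_sum_rpow_of_nonneg (s := Finset.Icc (-R) R)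
          (f := fun t => if t < R then |fdiff i f (Function.update x i t)| else 0) hs
          (fun t _ => by split_ifs <;> positivity)
        rw [card_Icc_symm hR] at this
        refine this.trans_eq ?_
        congr 1
        refine Finset.sum_congr rfl fun t _ => ?_
        split_ifs
        · rfl
        · exact Real.zero_rpow (by linarith)
    _ = (2 * R + 1 : ℝ) ^ (s - 1) * ((2 * R + 1) * dirPow s i R f) := by
        rw [← Finset.mul_sum, dirPow, ← sum_box_sum_update i hR]
        congr 1
        refine Finset.sum_congr rfl fun x _ => Finset.sum_congr rfl fun t _ => ?_
        simp
    _ = _ := by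
        rw [← mul_assoc]
        congr 1
        nth_rewrite 2 [← Real.rpow_one (2 * R + 1 : ℝ)]
        rw [← Real.rpow_add hL]
        ring_nf

theorem add_rpow_le {a b s : ℝ} (ha : 0 ≤ a) (hb : 0 ≤ b) (hs : 0 ≤ s) :
    (a + b) ^ s ≤ 2 ^ s * (a ^ s + b ^ s) := by
  wlog h : a ≤ b generalizing a b
  · rw [add_comm a b, add_comm (a ^ s)]
    exact this hb ha (le_of_not_ge h)
  calc (a + b) ^ s ≤ (2 * b) ^ s := Real.rpow_le_rpow (by positivity) (by linarith) hs
    _ = 2 ^ s * b ^ s := Real.mul_rpow (by norm_num) hb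
    _ ≤ _ := by
      gcongr
      exact le_add_of_nonneg_left (by positivity)

/-- Going from x to y one coordinate at a time, each move stays on a line and is controlled by the
variation along it. The case T = univ bounds the double sum of |f x - f y|^s. -/
theorem exists_sum_sum_piecewise_le {d : ℕ} {s : ℝ} (hs : 1 ≤ s) (T : Finset (Fin d)) :
    ∃ C : ℝ, 0 ≤ C ∧ ∀ (R : ℤ), 0 ≤ R → ∀ f : (Fin d → ℤ) → ℝ,
      ∑ x ∈ box d R, ∑ y ∈ box d R, |f x - f (T.piecewise y x)| ^ s ≤
        C * (box d R).card * (2 * R + 1 : ℝ) ^ s * ∑ i, dirPow s i R f := by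
  induction T using Finset.induction_on with
  | empty =>
    refine ⟨0, le_rfl, fun R _ f => ?_⟩
    simp [Real.zero_rpow (by linarith : s ≠ 0)]
  | insert i T hi ih =>
    obtain ⟨C, hC, h⟩ := ih
    refine ⟨2 ^ s * (C + 1), by positivity, fun R hR f => ?_⟩
    have hL : (0 : ℝ) < 2 * R + 1 := by
      have : (0 : ℝ) ≤ R := by exact_mod_cast hR
      linarith
    have h1 : ∀ x y : Fin d → ℤ, |f x - f ((insert i T).piecewise y x)| ^ s ≤
        2 ^ s * (|f x - f (T.piecewise y x)| ^ s +
          |f (T.piecewise y x) - f (Function.update (T.piecewise y x) i (y i))| ^ s) := by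
      intro x y
      rw [Finset.piecewise_insert]
      refine le_trans ?_ (add_rpow_le (abs_nonneg _) (abs_nonneg _) (by linarith))
      exact Real.rpow_le_rpow (abs_nonneg _) (abs_sub_le _ _ _) (by linarith)
    have h2 : ∑ x ∈ box d R, ∑ y ∈ box d R,
        |f (T.piecewise y x) - f (Function.update (T.piecewise y x) i (y i))| ^ s =
        ∑ x ∈ box d R, ∑ y ∈ box d R, |f x - f (Function.update x i (y i))| ^ s := by
      rw [← Finset.sum_product', ← Finset.sum_product']
      have mem : ∀ x y : Fin d → ℤ, x ∈ box d R → y ∈ box d R → T.piecewise x y ∈ box d R := by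
        intro x y hx hy
        rw [mem_box] at *
        intro j
        by_cases hj : j ∈ T
        · simpa [hj] using hx j
        · simpa [hj] using hy j
      -- Exchanging the coordinates in `T` between x and y is an involution. It turns the
      -- intermediate point into a free variable and leaves `y i` alone because i ∉ T.
      refine Finset.sum_nbij' (fun z => (T.piecewise z.2 z.1, T.piecewise z.1 z.2))
        (fun z => (T.piecewise z.2 z.1, T.piecewise z.1 z.2)) ?_ ?_ ?_ ?_ ?_
      · rintro ⟨x, y⟩ hz
        rw [Finset.mem_product] at hz ⊢
        exact ⟨mem _ _ hz.2 hz.1, mem _ _ hz.1 hz.2⟩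
      · rintro ⟨x, y⟩ hz
        rw [Finset.mem_product] at hz ⊢
        exact ⟨mem _ _ hz.2 hz.1, mem _ _ hz.1 hz.2⟩
      · rintro ⟨x, y⟩ -
        ext j <;> by_cases hj : j ∈ T <;> simp [hj]
      · rintro ⟨x, y⟩ -
        ext j <;> by_cases hj : j ∈ T <;> simp [hj]
      · rintro ⟨x, y⟩ -
        simp [hi]
    have h3 : ∑ x ∈ box d R, ∑ y ∈ box d R, |f x - f (Function.update x i (y i))| ^ s ≤
        (box d R).card * ((2 * R + 1 : ℝ) ^ s * dirPow s i R f) := by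
      calc _ ≤ ∑ x ∈ box d R, ∑ y ∈ box d R, lineVar i R f x ^ s := by
            refine Finset.sum_le_sum fun x hx => Finset.sum_le_sum fun y hy => ?_
            exact Real.rpow_le_rpow (abs_nonneg _) (abs_sub_update_le_lineVar i f hx
              (Finset.mem_Icc.2 (mem_box.1 hy i))) (by linarith)
        _ = (box d R).card * ∑ x ∈ box d R, lineVar i R f x ^ s := by
            simp [Finset.mul_sum]
        _ ≤ _ := by
            gcongr
            exact sum_lineVar_rpow_le hs i hR f
    calc _ ≤ ∑ x ∈ box d R, ∑ y ∈ box d R, 2 ^ s * (|f x - f (T.piecewise y x)| ^ s +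
          |f (T.piecewise y x) - f (Function.update (T.piecewise y x) i (y i))| ^ s) :=
          Finset.sum_le_sum fun x _ => Finset.sum_le_sum fun y _ => h1 x y
      _ = 2 ^ s * (∑ x ∈ box d R, ∑ y ∈ box d R, |f x - f (T.piecewise y x)| ^ s +
          ∑ x ∈ box d R, ∑ y ∈ box d R, |f x - f (Function.update x i (y i))| ^ s) := by
          rw [← h2]
          simp only [← Finset.mul_sum, Finset.sum_add_distrib]
      _ ≤ 2 ^ s * (C * (box d R).card * (2 * R + 1 : ℝ) ^ s * ∑ i, dirPow s i R f +
          (box d R).card * ((2 * R + 1 : ℝ) ^ s * ∑ i, dirPow s i R f)) := by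
          gcongr
          · exact h R hR f
          · refine h3.trans ?_
            gcongr
            exact Finset.single_le_sum (f := fun i => dirPow s i R f)
              (fun j _ => dirPow_nonneg s j R f) (Finset.mem_univ i)
      _ = _ := by ring

/-- Restricting y to the zero set in the double sum of |f x - f y|^s leaves at least half of the box
times the sum of |f x|^s, so no mean has to be subtracted. -/
theorem exists_poincare_of_half_zero (d : ℕ) {s : ℝ} (hs : 1 ≤ s) :
    ∃ C : ℝ, 0 ≤ C ∧ ∀ (R : ℤ), 0 ≤ R → ∀ f : (Fin d → ℤ) → ℝ,
      (box d R).card ≤ 2 * ((box d R).filter fun x => f x = 0).card →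
      ∑ x ∈ box d R, |f x| ^ s ≤ C * (2 * R + 1 : ℝ) ^ s * ∑ i, dirPow s i R f := by
  obtain ⟨C, hC, h⟩ := exists_sum_sum_piecewise_le hs (Finset.univ : Finset (Fin d))
  refine ⟨2 * C, by positivity, fun R hR f hf => ?_⟩
  have h1 := h R hR f
  simp only [Finset.piecewise_univ] at h1
  have hcard : (0 : ℝ) < (box d R).card := by
    exact_mod_cast Finset.card_pos.2 ⟨0, zero_mem_box hR⟩
  have h2 : (((box d R).filter fun x => f x = 0).card : ℝ) * ∑ x ∈ box d R, |f x| ^ s ≤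
      ∑ x ∈ box d R, ∑ y ∈ box d R, |f x - f y| ^ s := by
    rw [Finset.mul_sum]
    refine Finset.sum_le_sum fun x _ => ?_
    rw [← nsmul_eq_mul, ← Finset.sum_const]
    refine (Finset.sum_le_sum fun y hy => ?_).trans (Finset.sum_le_sum_of_subset_of_nonneg
      (Finset.filter_subset _ _) fun y _ _ => by positivity)
    rw [(Finset.mem_filter.1 hy).2, sub_zero]
  have h3 : ((box d R).card : ℝ) ≤ 2 * ((box d R).filter fun x => f x = 0).card := by
    exact_mod_cast hf
  have h4 : 0 ≤ ∑ x ∈ box d R, |f x| ^ s := Finset.sum_nonneg fun x _ => by positivity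
  refine le_of_mul_le_mul_left ?_ hcard
  calc _ ≤ 2 * ((((box d R).filter fun x => f x = 0).card : ℝ) * ∑ x ∈ box d R, |f x| ^ s) := by
        rw [← mul_assoc]
        gcongr
    _ ≤ 2 * (C * (box d R).card * (2 * R + 1 : ℝ) ^ s * ∑ i, dirPow s i R f) := by
        exact mul_le_mul_of_nonneg_left (h2.trans h1) zero_le_two
    _ = _ := by ring

/-- Every line in direction i starts at a zero of f, so |f x| is at most the variation along its
line. -/
theorem sum_rpow_le_dirPow_of_zero {d : ℕ} {s : ℝ} (hs : 1 ≤ s) (i : Fin d) {R : ℤ} (hR : 0 ≤ R)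
    (f : (Fin d → ℤ) → ℝ) (hf : ∀ x, x i = -R → f x = 0) :
    ∑ x ∈ box d R, |f x| ^ s ≤ (2 * R + 1 : ℝ) ^ s * dirPow s i R f := by
  refine (Finset.sum_le_sum fun x hx => ?_).trans (sum_lineVar_rpow_le hs i hR f)
  refine Real.rpow_le_rpow (abs_nonneg _) ?_ (by linarith)
  have := abs_sub_update_le_lineVar i f hx (t := -R) (Finset.mem_Icc.2 ⟨le_rfl, by omega⟩)
  rwa [hf (Function.update x i (-R)) (by simp), sub_zero] at this

/-! ### Loomis–Whitney and Sobolev inequalities on a box -/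

open MeasureTheory in
/-- The discrete Loomis--Whitney inequality in grid-lines form. -/
theorem sum_prod_sum_update_rpow_le {α : Type*} [Fintype α] {D : ℕ} (hD : 2 ≤ D)
    (F : (Fin D → α) → ℝ) (hF : ∀ x, 0 ≤ F x) :
    ∑ x : Fin D → α, ∏ i, (∑ t, F (Function.update x i t)) ^ (1 / ((D : ℝ) - 1)) ≤
      (∑ x, F x) ^ ((D : ℝ) / (D - 1)) := by
  classical
  let _ : MeasurableSpace α := ⊤
  have _ : MeasurableSingletonClass α := ⟨fun _ => trivial⟩
  have hD1 : (1 : ℝ) < D := by exact_mod_cast hD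
  have hp : Real.HolderConjugate (Fintype.card (Fin D) : ℝ) ((D : ℝ) / (D - 1)) := by
    rw [Fintype.card_fin, Real.holderConjugate_iff]
    refine ⟨hD1, ?_⟩
    have : (D : ℝ) - 1 ≠ 0 := by linarith
    field_simp
    ring
  -- The grid-lines inequality behind the Gagliardo–Nirenberg–Sobolev inequality, taken for counting
  -- measure.
  have key := lintegral_prod_lintegral_pow_le (fun _ : Fin D => (Measure.count : Measure α)) hp
    (f := fun x => ENNReal.ofReal (F x)) (measurable_of_countable _)
  simp only [lintegral_fintype, Measure.pi_singleton, Measure.count_singleton,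
    Finset.prod_const_one, mul_one, Fintype.card_fin] at key
  have e : (0 : ℝ) ≤ 1 / ((D : ℝ) - 1) := by
    have : 0 < (D : ℝ) - 1 := by linarith
    positivity
  have e' : (0 : ℝ) ≤ (D : ℝ) / ((D : ℝ) - 1) := by
    have : 0 < (D : ℝ) - 1 := by linarith
    positivity
  have hs : ∀ x i, 0 ≤ ∑ t, F (Function.update x i t) := fun x i =>
    Finset.sum_nonneg fun _ _ => hF _
  rw [← ENNReal.ofReal_sum_of_nonneg (fun _ _ => hF _),
    ENNReal.ofReal_rpow_of_nonneg (Finset.sum_nonneg fun _ _ => hF _) e'] at key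
  have h2 : ∀ x : Fin D → α, ∏ i, (∑ t, ENNReal.ofReal (F (Function.update x i t))) ^
      (1 / ((D : ℝ) - 1)) =
      ENNReal.ofReal (∏ i, (∑ t, F (Function.update x i t)) ^ (1 / ((D : ℝ) - 1))) := by
    intro x
    rw [ENNReal.ofReal_prod_of_nonneg fun i _ => Real.rpow_nonneg (hs x i) _]
    refine Finset.prod_congr rfl fun i _ => ?_
    rw [← ENNReal.ofReal_sum_of_nonneg (fun _ _ => hF _), ENNReal.ofReal_rpow_of_nonneg (hs x i) e]
  simp only [h2] at key
  rw [← ENNReal.ofReal_sum_of_nonneg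
    fun x _ => Finset.prod_nonneg fun i _ => Real.rpow_nonneg (hs x i) _] at key
  exact (ENNReal.ofReal_le_ofReal_iff
    (Real.rpow_nonneg (Finset.sum_nonneg fun _ _ => hF _) _)).1 key

theorem sum_box_eq_sum_subtype {d : ℕ} {R : ℤ} (F : (Fin d → ℤ) → ℝ) :
    ∑ x ∈ box d R, F x = ∑ x : Fin d → Finset.Icc (-R) R, F (fun i => x i) := by
  symm
  refine Finset.sum_bij (fun x _ => fun i => (x i : ℤ)) ?_ ?_ ?_ ?_
  · intro x _
    exact Fintype.mem_piFinset.2 fun i => (x i).2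
  · intro x _ y _ h
    ext i
    exact congrFun h i
  · intro x hx
    exact ⟨fun i => ⟨x i, Fintype.mem_piFinset.1 hx i⟩, Finset.mem_univ _, rfl⟩
  · intro x _
    rfl

theorem sum_box_prod_le {D : ℕ} (hD : 2 ≤ D) (R : ℤ) (F : (Fin D → ℤ) → ℝ) (hF : ∀ x, 0 ≤ F x) :
    ∑ x ∈ box D R, ∏ i, (∑ t ∈ Finset.Icc (-R) R, F (Function.update x i t)) ^
      (1 / ((D : ℝ) - 1)) ≤ (∑ x ∈ box D R, F x) ^ ((D : ℝ) / (D - 1)) := by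
  rw [sum_box_eq_sum_subtype, sum_box_eq_sum_subtype]
  refine le_trans (le_of_eq ?_) (sum_prod_sum_update_rpow_le hD
    (fun x : Fin D → Finset.Icc (-R) R => F (fun i => x i)) fun _ => hF _)
  refine Finset.sum_congr rfl fun x _ => Finset.prod_congr rfl fun i _ => ?_
  rw [← Finset.sum_coe_sort]
  congr 1
  refine Finset.sum_congr rfl fun t _ => ?_
  congr 1
  ext j
  by_cases hj : j = i
  · subst hj
    simp
  · simp [hj]

/-- Gagliardo's argument: on every line through x, |h x| is at most the mean of |h| plus the
variation. Multiplying the D bounds, each to the power 1/(D-1), gives the integrand of the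
grid-lines inequality. The mean replaces the zero boundary values of the classical proof. -/
theorem sum_rpow_le_of_gradient {D : ℕ} (hD : 2 ≤ D) {R : ℤ} (hR : 0 ≤ R)
    (h : (Fin D → ℤ) → ℝ) :
    ∑ x ∈ box D R, |h x| ^ ((D : ℝ) / (D - 1)) ≤
      (∑ x ∈ box D R, (|h x| / (2 * R + 1) +
        ∑ j, if x j < R then |fdiff j h x| else 0)) ^ ((D : ℝ) / (D - 1)) := by
  have hL : (0 : ℝ) < 2 * R + 1 := by
    have : (0 : ℝ) ≤ R := by exact_mod_cast hR
    linarith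
  have hD1 : (0 : ℝ) < (D : ℝ) - 1 := by
    have : (2 : ℝ) ≤ D := by exact_mod_cast hD
    linarith
  set F : (Fin D → ℤ) → ℝ := fun x => |h x| / (2 * R + 1) +
        ∑ j, if x j < R then |fdiff j h x| else 0 with hFdef
  have hF0 : ∀ x (j : Fin D), 0 ≤ if x j < R then |fdiff j h x| else 0 := fun x j => by
    split_ifs <;> positivity
  have hF : ∀ x, 0 ≤ F x := fun x =>
    add_nonneg (by positivity) (Finset.sum_nonneg fun j _ => hF0 x j)
  refine le_trans (Finset.sum_le_sum fun x hx => ?_) (sum_box_prod_le hD R F hF)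
  have key : ∀ i, |h x| ≤ ∑ t ∈ Finset.Icc (-R) R, F (Function.update x i t) := by
    intro i
    have h1 : ∀ t ∈ Finset.Icc (-R) R, |h x| ≤ |h (Function.update x i t)| + lineVar i R h x := by
      intro t ht
      have := abs_sub_update_le_lineVar i h hx ht
      have h2 := abs_sub_abs_le_abs_sub (h x) (h (Function.update x i t))
      linarith
    have h2 := Finset.sum_le_sum h1
    rw [Finset.sum_const, nsmul_eq_mul, card_Icc_symm hR, Finset.sum_add_distrib, Finset.sum_const,
      nsmul_eq_mul, card_Icc_symm hR] at h2
    have h3 : |h x| ≤ (∑ t ∈ Finset.Icc (-R) R, |h (Function.update x i t)|) / (2 * R + 1) +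
        lineVar i R h x := by
      rw [← mul_le_mul_iff_right₀ hL]
      refine h2.trans_eq ?_
      field_simp
    refine h3.trans ?_
    rw [Finset.sum_div, lineVar, ← Finset.sum_add_distrib]
    refine Finset.sum_le_sum fun t _ => ?_
    rw [hFdef]
    refine add_le_add le_rfl ?_
    refine le_trans (le_of_eq ?_)
      (Finset.single_le_sum (fun j _ => hF0 (Function.update x i t) j) (Finset.mem_univ i))
    simp
  calc |h x| ^ ((D : ℝ) / (D - 1)) = ∏ _i : Fin D, |h x| ^ (1 / ((D : ℝ) - 1)) := by
        rw [Finset.prod_const, Finset.card_univ, Fintype.card_fin, ← Real.rpow_natCast,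
          ← Real.rpow_mul (abs_nonneg _)]
        congr 1
        field_simp
    _ ≤ _ := Finset.prod_le_prod (fun i _ => by positivity)
        fun i _ => Real.rpow_le_rpow (abs_nonneg _) (key i) (by positivity)

theorem weighted_holder {ι : Type*} (S : Finset ι) {f g : ι → ℝ} {p q c : ℝ} (hc : 0 ≤ c)
    (hpq : p.HolderConjugate q) (hf : ∀ i ∈ S, 0 ≤ f i) (hg : ∀ i ∈ S, 0 ≤ g i) :
    c * ∑ i ∈ S, f i * g i ≤
      (c * ∑ i ∈ S, f i ^ p) ^ (1 / p) * (c * ∑ i ∈ S, g i ^ q) ^ (1 / q) := by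
  have h := Real.inner_le_Lp_mul_Lq_of_nonneg S hpq hf hg
  have hf' : 0 ≤ ∑ i ∈ S, f i ^ p := Finset.sum_nonneg fun i hi => Real.rpow_nonneg (hf i hi) _
  have hg' : 0 ≤ ∑ i ∈ S, g i ^ q := Finset.sum_nonneg fun i hi => Real.rpow_nonneg (hg i hi) _
  have hcc : c = c ^ (1 / p) * c ^ (1 / q) := by
    rw [← Real.rpow_add_of_nonneg hc (one_div_nonneg.2 hpq.nonneg)
      (one_div_nonneg.2 hpq.symm.nonneg), one_div, one_div, hpq.inv_add_inv_eq_one, Real.rpow_one]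
  rw [Real.mul_rpow hc hf', Real.mul_rpow hc hg']
  calc _ ≤ c * _ := mul_le_mul_of_nonneg_left h hc
    _ = _ := by
      nth_rewrite 1 [hcc]
      ring

/-- The chain rule for powers, obtained from Bernoulli's inequality at b/a. -/
theorem abs_rpow_sub_rpow_le {a b γ : ℝ} (ha : 0 ≤ a) (hb : 0 ≤ b) (hγ : 1 ≤ γ) :
    |a ^ γ - b ^ γ| ≤ γ * (a ^ (γ - 1) + b ^ (γ - 1)) * |a - b| := by
  wlog h : b ≤ a generalizing a b
  · rw [abs_sub_comm, abs_sub_comm a, add_comm (a ^ (γ - 1))]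
    exact this hb ha (le_of_not_ge h)
  rcases eq_or_lt_of_le ha with h0 | h0
  · have : b = 0 := by linarith
    subst this
    simp [← h0]
  have h1 := one_add_mul_self_le_rpow_one_add (s := b / a - 1) (by
    have : 0 ≤ b / a := by positivity
    linarith) hγ
  rw [add_sub_cancel, Real.div_rpow hb ha, le_div_iff₀ (by positivity)] at h1
  have h2 : a ^ γ = a ^ (γ - 1) * a := by
    nth_rewrite 3 [← Real.rpow_one a]
    rw [← Real.rpow_add h0]
    ring_nf
  have h3 : a ^ γ - b ^ γ ≤ γ * a ^ (γ - 1) * (a - b) := by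
    have : (1 + γ * (b / a - 1)) * a ^ γ = a ^ γ - γ * a ^ (γ - 1) * (a - b) := by
      rw [h2]
      field_simp
      ring
    linarith
  rw [abs_of_nonneg (sub_nonneg.2 (Real.rpow_le_rpow hb h (by linarith))),
    abs_of_nonneg (sub_nonneg.2 h)]
  refine h3.trans ?_
  have : 0 ≤ b ^ (γ - 1) := by positivity
  gcongr
  linarith

theorem sum_shift_le {d : ℕ} {R : ℤ} (j : Fin d) (F : (Fin d → ℤ) → ℝ) (hF : ∀ x, 0 ≤ F x) :
    ∑ x ∈ box d R, (if x j < R then F (x + Pi.single j 1) else 0) ≤ ∑ x ∈ box d R, F x := by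
  rw [← Finset.sum_filter]
  refine le_trans (le_of_eq (Finset.sum_image (g := fun x => x + Pi.single j 1) (f := F)
    fun x _ y _ h => by simpa using h).symm) ?_
  refine Finset.sum_le_sum_of_subset_of_nonneg ?_ fun x _ _ => hF x
  intro y hy
  obtain ⟨x, hx, rfl⟩ := Finset.mem_image.1 hy
  rw [Finset.mem_filter, mem_box] at hx
  rw [mem_box]
  intro i
  have := hx.1 i
  by_cases hi : i = j
  · subst hi
    simp only [Pi.add_apply, Pi.single_eq_same]
    omega
  · simpa [hi] using this

/-- The normalized `s`-th power of the `W^{1,s}` norm of `f` on `box d R`, at scale `N`. -/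
noncomputable def sobolevPow {d : ℕ} (s N : ℝ) (R : ℤ) (f : (Fin d → ℤ) → ℝ) : ℝ :=
  (N ^ d)⁻¹ * (∑ x ∈ box d R, |f x| ^ s + N ^ s * ∑ i, dirPow s i R f)

/-- The L¹ inequality is applied to f^γ. By Hölder its right side is at most a multiple of Z^(1/s')
Y^(1/s), with Z the normalised sum of f^t and Y the Sobolev power; a power of Z then cancels. -/
theorem exists_sobolev {D : ℕ} (hD : 2 ≤ D) {s t : ℝ} (ht : 2 < t)
    (hst : 1 / s = 1 / t + 1 / D) :
    ∃ C : ℝ, 0 ≤ C ∧ ∀ (N : ℝ) (R : ℤ), 0 < N → N ≤ R → ∀ f : (Fin D → ℤ) → ℝ, (∀ x, 0 ≤ f x) →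
      (N ^ D)⁻¹ * ∑ x ∈ box D R, f x ^ t ≤ C * sobolevPow s N R f ^ (t / s) := by
  have hD2 : (2 : ℝ) ≤ D := by exact_mod_cast hD
  have hs0 : 0 < s := by
    rw [← one_div_pos, hst]
    positivity
  have hs1 : 1 < s := by
    have h1 : 1 / s < 1 := by
      rw [hst]
      have : 1 / t < 1 / 2 := one_div_lt_one_div_of_lt (by norm_num) ht
      have : 1 / (D : ℝ) ≤ 1 / 2 := one_div_le_one_div_of_le (by norm_num) hD2
      linarith
    rwa [div_lt_one hs0] at h1
  set γ : ℝ := t * (D - 1) / D with hγdef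
  have hγ : 1 ≤ γ := by
    rw [hγdef, le_div_iff₀ (by linarith)]
    nlinarith
  set s' : ℝ := s / (s - 1) with hs'def
  have hconj : s'.HolderConjugate s := by
    refine (Real.HolderConjugate.symm ?_)
    rw [Real.holderConjugate_iff]
    refine ⟨hs1, ?_⟩
    rw [hs'def]
    have : s - 1 ≠ 0 := by linarith
    field_simp
    ring
  have hs'inv : 1 / s' = 1 - 1 / t - 1 / D := by
    have := hconj.inv_add_inv_eq_one
    rw [one_div] at *
    linarith [one_div s]
  have hs'0 : 0 < s' := hconj.pos
  have hγs' : (γ - 1) * s' = t := by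
    have : (γ - 1) = t * (1 / s') := by
      rw [hs'inv, hγdef]
      have : t ≠ 0 := by linarith
      field_simp
      ring
    rw [this]
    field_simp
  have hγD : γ * ((D : ℝ) / (D - 1)) = t := by
    rw [hγdef]
    have : (D : ℝ) - 1 ≠ 0 := by linarith
    field_simp
  refine ⟨(1 + 2 * D * γ) ^ t, by positivity, fun N R hN hR f hf => ?_⟩
  have hR0 : 0 ≤ R := by
    have : (0 : ℝ) ≤ R := by linarith
    exact_mod_cast this
  set c : ℝ := (N ^ D)⁻¹ with hcdef
  have hc : 0 < c := by positivity
  set Z : ℝ := c * ∑ x ∈ box D R, f x ^ t with hZdef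
  set Y : ℝ := sobolevPow s N R f with hYdef
  have hsum : 0 ≤ ∑ x ∈ box D R, |f x| ^ s := Finset.sum_nonneg fun x _ => by positivity
  have hdir : 0 ≤ ∑ i, dirPow s i R f := Finset.sum_nonneg fun i _ => dirPow_nonneg s i R f
  have hY0 : 0 ≤ Y := by
    rw [hYdef, sobolevPow]
    positivity
  have hZ0 : 0 ≤ Z := mul_nonneg hc.le (Finset.sum_nonneg fun x _ => Real.rpow_nonneg (hf x) _)
  -- Positivity of Z is needed for the final cancellation.
  rcases eq_or_lt_of_le hZ0 with hZ | hZ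
  · rw [← hZ]
    positivity
  have hYf : c * ∑ x ∈ box D R, f x ^ s ≤ Y := by
    rw [hYdef, sobolevPow]
    refine mul_le_mul_of_nonneg_left ?_ hc.le
    have : ∑ x ∈ box D R, f x ^ s = ∑ x ∈ box D R, |f x| ^ s :=
      Finset.sum_congr rfl fun x _ => by rw [abs_of_nonneg (hf x)]
    rw [this]
    have : 0 ≤ N ^ s * ∑ i, dirPow s i R f := by positivity
    linarith
  have hYd : ∀ j, c * ∑ x ∈ box D R, (if x j < R then N * |fdiff j f x| else 0) ^ s ≤ Y := by
    intro j
    rw [hYdef, sobolevPow]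
    refine mul_le_mul_of_nonneg_left ?_ hc.le
    have h1 : ∑ x ∈ box D R, (if x j < R then N * |fdiff j f x| else 0) ^ s =
        N ^ s * dirPow s j R f := by
      rw [dirPow, Finset.mul_sum]
      refine Finset.sum_congr rfl fun x _ => ?_
      split_ifs
      · rw [Real.mul_rpow hN.le (abs_nonneg _)]
      · rw [mul_zero, Real.zero_rpow hs0.ne']
    rw [h1]
    have h2 : N ^ s * dirPow s j R f ≤ N ^ s * ∑ i, dirPow s i R f := by
      gcongr
      exact Finset.single_le_sum (f := fun i => dirPow s i R f)
        (fun i _ => dirPow_nonneg s i R f) (Finset.mem_univ j)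
    linarith
  have hpow : ∀ x, (f x ^ (γ - 1)) ^ s' = f x ^ t := fun x => by
    rw [← Real.rpow_mul (hf x), hγs']
  set W : ℝ := Z ^ (1 / s') * Y ^ (1 / s) with hWdef
  have b1 : c * ∑ x ∈ box D R, f x ^ (γ - 1) * f x ≤ W := by
    refine (weighted_holder (box D R) hc.le hconj (fun x _ => Real.rpow_nonneg (hf x) _)
      (fun x _ => hf x)).trans ?_
    simp only [hpow]
    rw [← hZdef, hWdef]
    have : 0 ≤ c * ∑ x ∈ box D R, f x ^ s :=
      mul_nonneg hc.le (Finset.sum_nonneg fun x _ => Real.rpow_nonneg (hf x) _)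
    gcongr
  have b2 : ∀ j, c * ∑ x ∈ box D R, f x ^ (γ - 1) *
      (if x j < R then N * |fdiff j f x| else 0) ≤ W := by
    intro j
    refine (weighted_holder (box D R) hc.le hconj (fun x _ => Real.rpow_nonneg (hf x) _)
      (fun x _ => by split_ifs <;> positivity)).trans ?_
    simp only [hpow]
    rw [← hZdef, hWdef]
    have : 0 ≤ c * ∑ x ∈ box D R, (if x j < R then N * |fdiff j f x| else 0) ^ s :=
      mul_nonneg hc.le (Finset.sum_nonneg fun x _ => Real.rpow_nonneg
        (by split_ifs <;> positivity) _)
    gcongr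
    exact hYd j
  have b3 : ∀ j, c * ∑ x ∈ box D R, (if x j < R then f (x + Pi.single j 1) ^ (γ - 1) else 0) *
      (if x j < R then N * |fdiff j f x| else 0) ≤ W := by
    intro j
    refine (weighted_holder (box D R) hc.le hconj
      (fun x _ => by split_ifs; exacts [Real.rpow_nonneg (hf _) _, le_rfl])
      (fun x _ => by split_ifs <;> positivity)).trans ?_
    have h1 : c * ∑ x ∈ box D R,
        (if x j < R then f (x + Pi.single j 1) ^ (γ - 1) else 0) ^ s' ≤ Z := by
      rw [hZdef]
      refine mul_le_mul_of_nonneg_left ?_ hc.le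
      refine le_trans (le_of_eq ?_)
        (sum_shift_le j (fun x => f x ^ t) fun x => Real.rpow_nonneg (hf x) _)
      refine Finset.sum_congr rfl fun x _ => ?_
      split_ifs
      · exact hpow _
      · exact Real.zero_rpow hs'0.ne'
    have h2 : 0 ≤ c * ∑ x ∈ box D R, (if x j < R then N * |fdiff j f x| else 0) ^ s :=
      mul_nonneg hc.le (Finset.sum_nonneg fun x _ => Real.rpow_nonneg
        (by split_ifs <;> positivity) _)
    have h3 : 0 ≤ c * ∑ x ∈ box D R,
        (if x j < R then f (x + Pi.single j 1) ^ (γ - 1) else 0) ^ s' :=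
      mul_nonneg hc.le (Finset.sum_nonneg fun x _ => Real.rpow_nonneg
        (by split_ifs; exacts [Real.rpow_nonneg (hf _) _, le_rfl]) _)
    rw [hWdef]
    gcongr
    exact hYd j
  have hW0 : 0 ≤ W := by positivity
  have main : Z ≤ ((1 + 2 * D * γ) * W) ^ ((D : ℝ) / (D - 1)) := by
    have h1 := sum_rpow_le_of_gradient hD hR0 (fun x => f x ^ γ)
    have hleft : ∑ x ∈ box D R, |f x ^ γ| ^ ((D : ℝ) / (D - 1)) = ∑ x ∈ box D R, f x ^ t := by
      refine Finset.sum_congr rfl fun x _ => ?_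
      rw [abs_of_nonneg (Real.rpow_nonneg (hf x) _), ← Real.rpow_mul (hf x), hγD]
    rw [hleft] at h1
    -- The scaling of the inequality: taking N^(-(D-1)) inside the power D/(D-1) produces N^(-D).
    have hcc : c = ((N ^ (D - 1))⁻¹) ^ ((D : ℝ) / (D - 1)) := by
      rw [hcdef, ← Real.rpow_natCast, ← Real.rpow_natCast, ← Real.rpow_neg hN.le,
        ← Real.rpow_neg hN.le, ← Real.rpow_mul hN.le]
      congr 1
      rw [Nat.cast_sub (by omega)]
      have : (D : ℝ) - 1 ≠ 0 := by linarith
      push_cast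
      field_simp
    have hnn : 0 ≤ ∑ x ∈ box D R, (|f x ^ γ| / (2 * R + 1) +
        ∑ j, if x j < R then |fdiff j (fun x => f x ^ γ) x| else 0) := by
      have hR0' : (0 : ℝ) ≤ R := by exact_mod_cast hR0
      refine Finset.sum_nonneg fun x _ => add_nonneg (by positivity)
        (Finset.sum_nonneg fun j _ => by split_ifs <;> positivity)
    calc Z ≤ c * _ := mul_le_mul_of_nonneg_left h1 hc.le
      _ = ((N ^ (D - 1))⁻¹ * ∑ x ∈ box D R, (|f x ^ γ| / (2 * R + 1) +
        ∑ j, if x j < R then |fdiff j (fun x => f x ^ γ) x| else 0)) ^ ((D : ℝ) / (D - 1)) := by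
          rw [Real.mul_rpow (by positivity) hnn, ← hcc]
      _ ≤ _ := by
          refine Real.rpow_le_rpow (mul_nonneg (by positivity) hnn) ?_
            (div_nonneg (by linarith) (by linarith))
          have hcN : (N ^ (D - 1))⁻¹ = c * N := by
            rw [hcdef]
            have : N ^ D = N ^ (D - 1) * N := by
              rw [← pow_succ]
              congr 1
              omega
            rw [this]
            field_simp
          have point : ∀ x ∈ box D R, N * (|f x ^ γ| / (2 * R + 1) +
              ∑ j, if x j < R then |fdiff j (fun x => f x ^ γ) x| else 0) ≤
              f x ^ (γ - 1) * f x + ∑ j, γ * (f x ^ (γ - 1) *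
                (if x j < R then N * |fdiff j f x| else 0) +
                (if x j < R then f (x + Pi.single j 1) ^ (γ - 1) else 0) *
                (if x j < R then N * |fdiff j f x| else 0)) := by
            intro x _
            rw [mul_add, Finset.mul_sum]
            refine add_le_add ?_ (Finset.sum_le_sum fun j _ => ?_)
            · have h2 : f x ^ (γ - 1) * f x = f x ^ γ := by
                rcases eq_or_lt_of_le (hf x) with h0 | h0
                · rw [← h0, mul_zero, Real.zero_rpow (by linarith)]
                · nth_rewrite 2 [← Real.rpow_one (f x)]
                  rw [← Real.rpow_add h0]
                  ring_nf
              rw [h2, abs_of_nonneg (Real.rpow_nonneg (hf x) _), mul_div_assoc', div_le_iff₀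
                (by linarith), mul_comm]
              refine mul_le_mul_of_nonneg_left (by linarith) (Real.rpow_nonneg (hf x) _)
            · split_ifs with hj
              · have := abs_rpow_sub_rpow_le (hf (x + Pi.single j 1)) (hf x) hγ
                rw [fdiff, fdiff]
                calc _ ≤ N * (γ * (f (x + Pi.single j 1) ^ (γ - 1) + f x ^ (γ - 1)) *
                      |f (x + Pi.single j 1) - f x|) := mul_le_mul_of_nonneg_left this hN.le
                  _ = _ := by ring
              · simp
          rw [hcN, mul_assoc, Finset.mul_sum]
          calc _ ≤ c * ∑ x ∈ box D R, (f x ^ (γ - 1) * f x + ∑ j, γ * (f x ^ (γ - 1) *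
                (if x j < R then N * |fdiff j f x| else 0) +
                (if x j < R then f (x + Pi.single j 1) ^ (γ - 1) else 0) *
                (if x j < R then N * |fdiff j f x| else 0))) :=
                mul_le_mul_of_nonneg_left (Finset.sum_le_sum point) hc.le
            _ = c * ∑ x ∈ box D R, f x ^ (γ - 1) * f x + ∑ j, γ * (c * ∑ x ∈ box D R,
                f x ^ (γ - 1) * (if x j < R then N * |fdiff j f x| else 0) +
                c * ∑ x ∈ box D R, (if x j < R then f (x + Pi.single j 1) ^ (γ - 1) else 0) *
                (if x j < R then N * |fdiff j f x| else 0)) := by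
                rw [Finset.sum_add_distrib, mul_add, Finset.sum_comm]
                congr 1
                rw [Finset.mul_sum]
                refine Finset.sum_congr rfl fun j _ => ?_
                rw [← Finset.mul_sum, Finset.sum_add_distrib]
                ring
            _ ≤ W + ∑ _j : Fin D, γ * (W + W) := by
                refine add_le_add b1 (Finset.sum_le_sum fun j _ => ?_)
                exact mul_le_mul_of_nonneg_left (add_le_add (b2 j) (b3 j)) (by linarith)
            _ = _ := by
                rw [Finset.sum_const, Finset.card_univ, Fintype.card_fin, nsmul_eq_mul]
                ring
  have hK : (0 : ℝ) ≤ 1 + 2 * D * γ := by positivity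
  have h5 : Z ^ (((D : ℝ) - 1) / D) ≤ (1 + 2 * D * γ) * W := by
    have := Real.rpow_le_rpow hZ.le main (z := ((D : ℝ) - 1) / D)
      (div_nonneg (by linarith) (by linarith))
    rwa [← Real.rpow_mul (by positivity), div_mul_div_cancel₀ (by linarith),
      div_self (by linarith), Real.rpow_one] at this
  have h6 : Z ^ (1 / t) ≤ (1 + 2 * D * γ) * Y ^ (1 / s) := by
    have hsplit : Z ^ (((D : ℝ) - 1) / D) = Z ^ (1 / s') * Z ^ (1 / t) := by
      rw [← Real.rpow_add hZ]
      congr 1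
      rw [hs'inv]
      field_simp
      ring
    rw [hsplit, hWdef] at h5
    have hpos : 0 < Z ^ (1 / s') := by positivity
    refine le_of_mul_le_mul_left ?_ hpos
    linarith
  have h7 := Real.rpow_le_rpow (by positivity) h6 (z := t) (by linarith)
  rw [← Real.rpow_mul hZ.le, one_div_mul_cancel (by linarith), Real.rpow_one,
    Real.mul_rpow hK (by positivity), ← Real.rpow_mul hY0] at h7
  rwa [show t / s = 1 / s * t by ring]

/-! ### Summation by parts and energy estimates -/

/-- The operator `∑ᵢ (aᵢ(x) (u(x + eᵢ) - u(x)) + aᵢ(x - eᵢ) (u(x - eᵢ) - u(x)))`, where `aᵢ(x)` is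
the conductance of the bond `{x, x + eᵢ}`. -/
noncomputable def lap {d : ℕ} (a : Fin d → (Fin d → ℤ) → ℝ) (u : (Fin d → ℤ) → ℝ)
    (x : Fin d → ℤ) : ℝ :=
  ∑ i, (a i x * (u (x + Pi.single i 1) - u x) +
    a i (x - Pi.single i 1) * (u (x - Pi.single i 1) - u x))

theorem sum_mul_shift {d : ℕ} (S : Finset (Fin d → ℤ)) (e : Fin d → ℤ) (g f : (Fin d → ℤ) → ℝ)
    (hf : ∀ x, f x ≠ 0 → x ∈ S ∧ x - e ∈ S) :
    ∑ x ∈ S, g x * f (x + e) = ∑ x ∈ S, g (x - e) * f x := by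
  refine Finset.sum_bij_ne_zero (fun x _ _ => x + e) ?_ ?_ ?_ ?_
  · intro x _ h
    exact (hf _ (right_ne_zero_of_mul h)).1
  · intro x _ _ y _ _ h
    exact add_right_cancel h
  · intro x _ h
    have := hf _ (right_ne_zero_of_mul h)
    exact ⟨x - e, this.2, by simpa using h, by simp⟩
  · intro x _ _
    simp

/-- Summation by parts without boundary terms: the support of f and its backward neighbours lie in
S. -/
theorem sum_fdiff_mul_fdiff {d : ℕ} (a : Fin d → (Fin d → ℤ) → ℝ) (w f : (Fin d → ℤ) → ℝ)
    (S : Finset (Fin d → ℤ)) (hf : ∀ x, f x ≠ 0 → x ∈ S ∧ ∀ i, x - Pi.single i 1 ∈ S) :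
    ∑ i, ∑ x ∈ S, a i x * (fdiff i w x * fdiff i f x) = -∑ x ∈ S, f x * lap a w x := by
  simp only [lap, Finset.mul_sum]
  rw [Finset.sum_comm (s := S), ← Finset.sum_neg_distrib]
  refine Finset.sum_congr rfl fun i _ => ?_
  have h := sum_mul_shift S (Pi.single i 1) (fun x => a i x * fdiff i w x) f
    fun x hx => ⟨(hf x hx).1, (hf x hx).2 i⟩
  calc ∑ x ∈ S, a i x * (fdiff i w x * fdiff i f x)
      = ∑ x ∈ S, a i x * fdiff i w x * f (x + Pi.single i 1) -
        ∑ x ∈ S, a i x * fdiff i w x * f x := by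
        rw [← Finset.sum_sub_distrib]
        refine Finset.sum_congr rfl fun x _ => ?_
        simp only [fdiff]
        ring
    _ = _ := by
        rw [h, ← Finset.sum_sub_distrib, ← Finset.sum_neg_distrib]
        refine Finset.sum_congr rfl fun x _ => ?_
        simp only [fdiff, sub_add_cancel]
        ring

theorem sub_single_mem_box {d : ℕ} {R : ℤ} {x : Fin d → ℤ} (hx : x ∈ box d (R - 1)) (i : Fin d) :
    x - Pi.single i 1 ∈ box d R := by
  rw [mem_box] at *
  intro j
  have := hx j
  by_cases hj : j = i
  · subst hj
    simp only [Pi.sub_apply, Pi.single_eq_same]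
    omega
  · simp only [Pi.sub_apply, Pi.single_eq_of_ne hj]
    omega

theorem add_single_mem_box {d : ℕ} {R : ℤ} {x : Fin d → ℤ} (hx : x ∈ box d R) (i : Fin d) :
    x + Pi.single i 1 ∈ box d (R + 1) := by
  rw [mem_box] at *
  intro j
  have := hx j
  by_cases hj : j = i
  · subst hj
    simp only [Pi.add_apply, Pi.single_eq_same]
    omega
  · simp only [Pi.add_apply, Pi.single_eq_of_ne hj]
    omega

/-- The test function η²w satisfies the exact identity ∂w ∂(η²w) = (∂(ηw))² - w(x) w(x+eᵢ)(∂η)². The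
equation is used only where ηw is non-zero, so w may be a truncation. -/
theorem caccioppoli {d : ℕ} (a : Fin d → (Fin d → ℤ) → ℝ) (w η : (Fin d → ℤ) → ℝ) (R : ℤ)
    (hη : ∀ x, η x ≠ 0 → x ∈ box d (R - 1))
    (hw : ∀ x, 0 ≤ w x) (hsub : ∀ x, η x ≠ 0 → w x ≠ 0 → 0 ≤ lap a w x) :
    ∑ i, ∑ x ∈ box d R, a i x * fdiff i (fun x => η x * w x) x ^ 2 ≤
      ∑ i, ∑ x ∈ box d R, a i x * (w x * w (x + Pi.single i 1) * fdiff i η x ^ 2) := by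
  have h := sum_fdiff_mul_fdiff a w (fun x => η x ^ 2 * w x) (box d R) (by
    intro x hx
    have h1 : η x ≠ 0 := fun h0 => hx (by simp [h0])
    exact ⟨box_mono (by omega) (hη x h1), fun i => sub_single_mem_box (hη x h1) i⟩)
  have h2 : 0 ≤ ∑ x ∈ box d R, η x ^ 2 * w x * lap a w x := by
    refine Finset.sum_nonneg fun x _ => ?_
    by_cases h1 : η x = 0
    · simp [h1]
    by_cases h2 : w x = 0
    · simp [h2]
    · exact mul_nonneg (mul_nonneg (sq_nonneg _) (hw x)) (hsub x h1 h2)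
  have h3 : ∑ i, ∑ x ∈ box d R, a i x * (fdiff i w x * fdiff i (fun x => η x ^ 2 * w x) x) =
      ∑ i, ∑ x ∈ box d R, a i x * fdiff i (fun x => η x * w x) x ^ 2 -
      ∑ i, ∑ x ∈ box d R, a i x * (w x * w (x + Pi.single i 1) * fdiff i η x ^ 2) := by
    rw [← Finset.sum_sub_distrib]
    refine Finset.sum_congr rfl fun i _ => ?_
    rw [← Finset.sum_sub_distrib]
    refine Finset.sum_congr rfl fun x _ => ?_
    simp only [fdiff]
    ring
  linarith

theorem sq_le_exp_sub_exp_sq (t : ℝ) : t ^ 2 ≤ (Real.exp (t / 2) - Real.exp (-(t / 2))) ^ 2 := by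
  have h : (Real.exp (t / 2) - Real.exp (-(t / 2))) = 2 * Real.sinh (t / 2) := by
    rw [Real.sinh_eq]
    ring
  rw [h]
  have key : ∀ y : ℝ, 0 ≤ y → y ^ 2 ≤ Real.sinh y ^ 2 := fun y hy =>
    pow_le_pow_left₀ hy (Real.self_le_sinh_iff.2 hy) 2
  have : (t / 2) ^ 2 ≤ Real.sinh (t / 2) ^ 2 := by
    rcases le_total 0 (t / 2) with h0 | h0
    · exact key _ h0
    · have := key (-(t / 2)) (by linarith)
      rwa [Real.sinh_neg, neg_sq, neg_sq] at this
  nlinarith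

/-- The test function is η²/u. Where η = 1 at both ends of a bond, its contribution is -4 sinh²(t/2)
≤ -t², with t the increment of log u; on every other bond the square can be dropped. -/
theorem log_caccioppoli {d : ℕ} (a : Fin d → (Fin d → ℤ) → ℝ) (ha : ∀ i x, 0 ≤ a i x)
    (u η : (Fin d → ℤ) → ℝ) (R : ℤ) (hη : ∀ x, η x ≠ 0 → x ∈ box d (R - 1))
    (hu : ∀ x ∈ box d (R + 1), 0 < u x) (hsol : ∀ x, η x ≠ 0 → lap a u x = 0) :
    ∑ i, ∑ x ∈ box d R, (if η x = 1 ∧ η (x + Pi.single i 1) = 1 then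
        a i x * fdiff i (fun x => Real.log (u x)) x ^ 2 else 0) ≤
      ∑ i, ∑ x ∈ box d R, a i x * fdiff i η x ^ 2 := by
  have h := sum_fdiff_mul_fdiff a u (fun x => η x ^ 2 / u x) (box d R) (by
    intro x hx
    have h1 : η x ≠ 0 := fun h0 => hx (by simp [h0])
    exact ⟨box_mono (by omega) (hη x h1), fun i => sub_single_mem_box (hη x h1) i⟩)
  have h2 : ∑ x ∈ box d R, η x ^ 2 / u x * lap a u x = 0 := by
    refine Finset.sum_eq_zero fun x _ => ?_
    by_cases h1 : η x = 0
    · simp [h1]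
    · simp [hsol x h1]
  rw [h2, neg_zero] at h
  rw [← sub_nonneg, ← Finset.sum_sub_distrib]
  refine le_trans (le_of_eq h.symm) ?_
  refine Finset.sum_le_sum fun i _ => ?_
  rw [← Finset.sum_sub_distrib]
  refine Finset.sum_le_sum fun x hx => ?_
  have hux : 0 < u x := hu x (box_mono (by omega) hx)
  have huy : 0 < u (x + Pi.single i 1) := hu _ (add_single_mem_box hx i)
  simp only [fdiff]
  set b := u x
  set c := u (x + Pi.single i 1)
  set r := η x
  set q := η (x + Pi.single i 1)
  set t := Real.log c - Real.log b with ht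
  have e1 : Real.exp (t / 2) ^ 2 = c / b := by
    rw [← Real.exp_nat_mul, ht]
    have : ((2 : ℕ) : ℝ) * ((Real.log c - Real.log b) / 2) = Real.log c - Real.log b := by
      push_cast
      ring
    rw [this, Real.exp_sub, Real.exp_log huy, Real.exp_log hux]
  have e2 : Real.exp (-(t / 2)) ^ 2 = b / c := by
    rw [Real.exp_neg, inv_pow, e1, inv_div]
  have e3 : Real.exp (t / 2) * Real.exp (-(t / 2)) = 1 := by
    rw [← Real.exp_add, add_neg_cancel, Real.exp_zero]
  -- With c/b = exp t this completes the square; the cross term is 2rq since the two exponentials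
  -- are inverse to each other.
  have e4 : (c - b) * (q ^ 2 / c - r ^ 2 / b) =
      (q - r) ^ 2 - (r * Real.exp (t / 2) - q * Real.exp (-(t / 2))) ^ 2 := by
    have : (r * Real.exp (t / 2) - q * Real.exp (-(t / 2))) ^ 2 =
        r ^ 2 * Real.exp (t / 2) ^ 2 + q ^ 2 * Real.exp (-(t / 2)) ^ 2 -
        2 * r * q * (Real.exp (t / 2) * Real.exp (-(t / 2))) := by ring
    rw [this, e1, e2, e3]
    field_simp
    ring
  rw [e4]
  split_ifs with h1
  · rw [h1.1, h1.2, one_mul, one_mul]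
    have := sq_le_exp_sub_exp_sq t
    nlinarith [ha i x]
  · nlinarith [mul_nonneg (ha i x) (sq_nonneg (r * Real.exp (t / 2) - q * Real.exp (-(t / 2))))]

/-! ### Cutoffs and the energy of the logarithm -/

/-- The cutoff function `∏ᵢ h(|xᵢ|)`. -/
noncomputable def cutoff (d : ℕ) (h : ℕ → ℝ) (x : Fin d → ℤ) : ℝ := ∏ i, h (x i).natAbs

/-- Only the i-th factor of the product changes, and the others lie in [0,1]. The bound depends on
the i-th coordinate alone, which later makes it constant on slices. -/
theorem abs_fdiff_cutoff_le {d : ℕ} {h : ℕ → ℝ} (h0 : ∀ r, 0 ≤ h r) (h1 : ∀ r, h r ≤ 1)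
    (i : Fin d) (x : Fin d → ℤ) :
    |fdiff i (cutoff d h) x| ≤ |h (x i + 1).natAbs - h (x i).natAbs| := by
  have e1 : ∀ y : Fin d → ℤ, cutoff d h y =
      h (y i).natAbs * ∏ j ∈ Finset.univ.erase i, h (y j).natAbs := fun y =>
    (Finset.mul_prod_erase _ (fun j => h (y j).natAbs) (Finset.mem_univ i)).symm
  have e2 : ∏ j ∈ Finset.univ.erase i, h ((x + Pi.single i 1 : Fin d → ℤ) j).natAbs =
      ∏ j ∈ Finset.univ.erase i, h (x j).natAbs :=
    Finset.prod_congr rfl fun j hj => by simp [Finset.ne_of_mem_erase hj]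
  rw [fdiff, e1, e1 x, e2, ← sub_mul, abs_mul]
  simp only [Pi.add_apply, Pi.single_eq_same]
  refine mul_le_of_le_one_right (abs_nonneg _) ?_
  rw [abs_of_nonneg (Finset.prod_nonneg fun _ _ => h0 _)]
  exact Finset.prod_le_one (fun _ _ => h0 _) fun _ _ => h1 _

theorem mem_box_of_cutoff_ne_zero {d : ℕ} {h : ℕ → ℝ} {ρ : ℕ} (hρ : ∀ r, ρ ≤ r → h r = 0)
    {x : Fin d → ℤ} (hx : cutoff d h x ≠ 0) : x ∈ box d (ρ - 1) := by
  rw [mem_box]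
  intro j
  have h1 : h (x j).natAbs ≠ 0 := fun h0 => hx (Finset.prod_eq_zero (Finset.mem_univ j) h0)
  have h2 : (x j).natAbs < ρ := by
    by_contra h3
    exact h1 (hρ _ (not_lt.1 h3))
  omega

theorem cutoff_eq_one {d : ℕ} {h : ℕ → ℝ} {σ : ℕ} (hσ : ∀ r, r ≤ σ → h r = 1)
    {x : Fin d → ℤ} (hx : x ∈ box d σ) : cutoff d h x = 1 := by
  rw [mem_box] at hx
  refine Finset.prod_eq_one fun j _ => hσ _ ?_
  have := hx j
  omega

theorem mem_box_add_single {d : ℕ} {R : ℤ} {x : Fin d → ℤ} {i : Fin d} (hx : x ∈ box d R)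
    (hi : x i < R) : x + Pi.single i 1 ∈ box d R := by
  rw [mem_box] at *
  intro j
  have := hx j
  by_cases hj : j = i
  · subst hj
    simp only [Pi.add_apply, Pi.single_eq_same]
    omega
  · simpa [hj] using this

theorem sum_log_energy_le {d : ℕ} (a : Fin d → (Fin d → ℤ) → ℝ) (ha : ∀ i x, 0 ≤ a i x)
    (u : (Fin d → ℤ) → ℝ) {N : ℕ} (hN : 1 ≤ N)
    (hu : ∀ x ∈ box d (3 * N + 1), 0 < u x) (hsol : ∀ x ∈ box d (3 * N - 1), lap a u x = 0) :
    ∑ i, ∑ x ∈ box d (2 * N), (if x i < 2 * N then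
        a i x * fdiff i (fun x => Real.log (u x)) x ^ 2 else 0) ≤
      ((N : ℝ) ^ 2)⁻¹ * ∑ i, ∑ x ∈ box d (3 * N), a i x := by
  have hN' : (0 : ℝ) < N := by exact_mod_cast hN
  -- The linear cutoff: 1 up to radius 2N, 0 from 3N on, with slope 1/N.
  set h : ℕ → ℝ := fun r => min 1 (max 0 ((3 * N - r) / N)) with hdef
  have h0 : ∀ r, 0 ≤ h r := fun r => le_min zero_le_one (le_max_left _ _)
  have h1 : ∀ r, h r ≤ 1 := fun r => min_le_left _ _
  have hout : ∀ r, 3 * N ≤ r → h r = 0 := by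
    intro r hr
    have : (3 * N - r : ℝ) / N ≤ 0 := by
      refine div_nonpos_of_nonpos_of_nonneg ?_ hN'.le
      have : (3 * N : ℝ) ≤ r := by exact_mod_cast hr
      linarith
    simp [hdef, this]
  have hin : ∀ r, r ≤ 2 * N → h r = 1 := by
    intro r hr
    have h2 : (1 : ℝ) ≤ (3 * N - r : ℝ) / N := by
      rw [le_div_iff₀ hN']
      have : (r : ℝ) ≤ 2 * N := by exact_mod_cast hr
      linarith
    simp only [hdef]
    rw [max_eq_right (by linarith), min_eq_left h2]
  have hlip : ∀ r r' : ℕ, |(r : ℝ) - r'| ≤ 1 → |h r - h r'| ≤ (N : ℝ)⁻¹ := by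
    intro r r' hr
    calc |h r - h r'| ≤ |max 0 ((3 * N - r : ℝ) / N) - max 0 ((3 * N - r' : ℝ) / N)| := by
          simp only [hdef]
          refine (abs_min_sub_min_le_max _ _ _ _).trans ?_
          simp
      _ ≤ |(3 * N - r : ℝ) / N - (3 * N - r' : ℝ) / N| := by
          refine (abs_max_sub_max_le_max _ _ _ _).trans ?_
          simp
      _ = |(r : ℝ) - r'| * (N : ℝ)⁻¹ := by
          rw [← sub_div, abs_div, abs_of_pos hN', div_eq_mul_inv, abs_sub_comm]
          congr 2
          ring
      _ ≤ _ := mul_le_of_le_one_left (by positivity) hr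
  have hout' : ∀ x, cutoff d h x ≠ 0 → x ∈ box d (3 * N - 1) := fun x hx => by
    have := mem_box_of_cutoff_ne_zero hout hx
    push_cast at this
    exact this
  have key := log_caccioppoli a ha u (cutoff d h) (3 * N) hout' hu fun x hx => hsol x (hout' x hx)
  calc _ ≤ _ := ?_
    _ ≤ _ := key
    _ ≤ _ := ?_
  · refine Finset.sum_le_sum fun i _ => ?_
    refine le_trans ?_ (Finset.sum_le_sum_of_subset_of_nonneg (box_mono (by omega :
      (2 * N : ℤ) ≤ 3 * N)) fun x _ _ => ?_)
    · refine Finset.sum_le_sum fun x hx => ?_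
      by_cases hi : x i < 2 * N
      · rw [if_pos hi, if_pos ⟨cutoff_eq_one hin (by exact_mod_cast hx),
          cutoff_eq_one hin (by exact_mod_cast mem_box_add_single hx hi)⟩]
      · rw [if_neg hi]
        split_ifs
        · exact mul_nonneg (ha i x) (sq_nonneg _)
        · exact le_rfl
    · split_ifs
      · exact mul_nonneg (ha i x) (sq_nonneg _)
      · exact le_rfl
  · rw [Finset.mul_sum]
    refine Finset.sum_le_sum fun i _ => ?_
    rw [Finset.mul_sum]
    refine Finset.sum_le_sum fun x _ => ?_
    rw [mul_comm]
    refine mul_le_mul_of_nonneg_right ?_ (ha i x)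
    rw [← sq_abs, ← inv_pow]
    refine pow_le_pow_left₀ (abs_nonneg _) ((abs_fdiff_cutoff_le h0 h1 i x).trans (hlip _ _ ?_)) 2
    have h3 : ((x i + 1).natAbs : ℝ) = |((x i + 1 : ℤ) : ℝ)| := by
      rw [Nat.cast_natAbs, Int.cast_abs]
    have h4 : ((x i).natAbs : ℝ) = |((x i : ℤ) : ℝ)| := by
      rw [Nat.cast_natAbs, Int.cast_abs]
    rw [h3, h4]
    refine (abs_abs_sub_abs_le_abs_sub _ _).trans ?_
    push_cast
    simp

/-- Hölder with exponents 2/s and 2/(2-s) applied to f^s = (a f²)^(s/2) a^(-s/2). -/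
theorem sum_rpow_le_energy {ι : Type*} (S : Finset ι) {a f : ι → ℝ} {s c : ℝ} (hc : 0 ≤ c)
    (hs : 0 < s) (hs2 : s < 2) (ha : ∀ i ∈ S, 0 < a i) (hf : ∀ i ∈ S, 0 ≤ f i) :
    c * ∑ i ∈ S, f i ^ s ≤ (c * ∑ i ∈ S, a i * f i ^ 2) ^ (s / 2) *
      (c * ∑ i ∈ S, (a i)⁻¹ ^ (s / (2 - s))) ^ (1 - s / 2) := by
  have hconj : (2 / s).HolderConjugate (2 / (2 - s)) := by
    rw [Real.holderConjugate_iff]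
    refine ⟨by rwa [lt_div_iff₀ hs, one_mul], ?_⟩
    have : 2 - s ≠ 0 := by linarith
    field_simp
    ring
  have h := weighted_holder S hc hconj (f := fun i => (a i * f i ^ 2) ^ (s / 2))
    (g := fun i => (a i)⁻¹ ^ (s / 2))
    (fun i hi => Real.rpow_nonneg (mul_nonneg (ha i hi).le (sq_nonneg _)) _)
    (fun i hi => Real.rpow_nonneg (inv_nonneg.2 (ha i hi).le) _)
  rw [one_div_div, one_div_div] at h
  have e1 : ∑ i ∈ S, (a i * f i ^ 2) ^ (s / 2) * (a i)⁻¹ ^ (s / 2) = ∑ i ∈ S, f i ^ s := by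
    refine Finset.sum_congr rfl fun i hi => ?_
    have hai := ha i hi
    rw [← Real.mul_rpow (mul_nonneg hai.le (sq_nonneg _)) (inv_nonneg.2 hai.le)]
    have : a i * f i ^ 2 * (a i)⁻¹ = f i ^ (2 : ℝ) := by
      rw [Real.rpow_two]
      field_simp
    rw [this, ← Real.rpow_mul (hf i hi)]
    congr 1
    ring
  have e2 : ∑ i ∈ S, ((a i * f i ^ 2) ^ (s / 2)) ^ (2 / s) = ∑ i ∈ S, a i * f i ^ 2 := by
    refine Finset.sum_congr rfl fun i hi => ?_
    rw [← Real.rpow_mul (mul_nonneg (ha i hi).le (sq_nonneg _))]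
    rw [show s / 2 * (2 / s) = 1 by field_simp, Real.rpow_one]
  have e3 : ∑ i ∈ S, ((a i)⁻¹ ^ (s / 2)) ^ (2 / (2 - s)) =
      ∑ i ∈ S, (a i)⁻¹ ^ (s / (2 - s)) := by
    refine Finset.sum_congr rfl fun i hi => ?_
    rw [← Real.rpow_mul (inv_nonneg.2 (ha i hi).le)]
    congr 1
    have : 2 - s ≠ 0 := by linarith
    field_simp
  rw [e1, e2, e3] at h
  rwa [show (1 - s / 2) = (2 - s) / 2 by ring]

theorem sum_dirPow_le_energy {d : ℕ} {a : Fin d → (Fin d → ℤ) → ℝ} (ha : ∀ i x, 0 < a i x)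
    {s c N : ℝ} (hc : 0 ≤ c) (hN : 0 ≤ N) (hs : 0 < s) (hs2 : s < 2) (R : ℤ)
    (f : (Fin d → ℤ) → ℝ) :
    c * (N ^ s * ∑ i, dirPow s i R f) ≤
      (c * (N ^ 2 * ∑ i, ∑ x ∈ box d R, if x i < R then a i x * fdiff i f x ^ 2 else 0)) ^ (s / 2) *
      (c * ∑ i, ∑ x ∈ box d R, (a i x)⁻¹ ^ (s / (2 - s))) ^ (1 - s / 2) := by
  have h := sum_rpow_le_energy (Finset.univ ×ˢ box d R) (a := fun z => a z.1 z.2)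
    (f := fun z => if z.2 z.1 < R then N * |fdiff z.1 f z.2| else 0) hc hs hs2
    (fun _ _ => ha _ _) (fun _ _ => by split_ifs <;> positivity)
  rw [Finset.sum_product, Finset.sum_product, Finset.sum_product] at h
  convert h using 2
  · rw [Finset.mul_sum]
    refine Finset.sum_congr rfl fun i _ => ?_
    rw [dirPow, Finset.mul_sum]
    refine Finset.sum_congr rfl fun x _ => ?_
    dsimp only
    split_ifs
    · rw [Real.mul_rpow hN (abs_nonneg _)]
    · rw [mul_zero, Real.zero_rpow hs.ne']
  · congr 2
    rw [Finset.mul_sum]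
    refine Finset.sum_congr rfl fun i _ => ?_
    rw [Finset.mul_sum]
    refine Finset.sum_congr rfl fun x _ => ?_
    dsimp only
    split_ifs
    · rw [mul_pow, sq_abs]
      ring
    · simp

/-- Jensen's inequality for a normalisation whose total mass is only bounded by K. -/
theorem mean_le_of_mean_rpow_le {ι : Type*} (S : Finset ι) {a : ι → ℝ} {c p K A : ℝ} (hc : 0 ≤ c)
    (hp : 1 ≤ p) (hK : 1 ≤ K) (hA : 0 ≤ A) (hcard : c * S.card ≤ K) (ha : ∀ i ∈ S, 0 ≤ a i)
    (h : c * ∑ i ∈ S, a i ^ p ≤ A ^ p) : c * ∑ i ∈ S, a i ≤ K * A := by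
  have h0 : 0 ≤ ∑ i ∈ S, a i := Finset.sum_nonneg ha
  have hp0 : 0 ≤ ∑ i ∈ S, a i ^ p := Finset.sum_nonneg fun i hi => Real.rpow_nonneg (ha i hi) _
  have h1 := Real.rpow_sum_le_const_mul_sum_rpow_of_nonneg S hp ha
  have hcp : c ^ p ≤ c * c ^ (p - 1) := by
    rcases eq_or_lt_of_le hc with h | h
    · rw [← h, Real.zero_rpow (by linarith), zero_mul]
    · nth_rewrite 2 [← Real.rpow_one c]
      rw [← Real.rpow_add h]
      ring_nf
      rfl
  have h2 : (c * ∑ i ∈ S, a i) ^ p ≤ (K * A) ^ p := by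
    rw [Real.mul_rpow hc h0, Real.mul_rpow (by linarith) hA]
    calc c ^ p * (∑ i ∈ S, a i) ^ p
        ≤ (c * c ^ (p - 1)) * ((S.card : ℝ) ^ (p - 1) * ∑ i ∈ S, a i ^ p) := by gcongr
      _ = (c * S.card) ^ (p - 1) * (c * ∑ i ∈ S, a i ^ p) := by
        rw [Real.mul_rpow hc (Nat.cast_nonneg _)]
        ring
      _ ≤ K ^ (p - 1) * A ^ p := by
        have : 0 ≤ p - 1 := by linarith
        gcongr
      _ ≤ K ^ p * A ^ p := by
        refine mul_le_mul_of_nonneg_right (Real.rpow_le_rpow_of_exponent_le hK (by linarith))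
          (Real.rpow_nonneg hA _)
  exact (Real.rpow_le_rpow_iff (mul_nonneg hc h0) (mul_nonneg (by linarith) hA)
    (by linarith)).1 h2

/-- The normalized `p`-th moment of the family `a` on the box of radius `3 N`. -/
noncomputable def moment {d : ℕ} (N : ℕ) (p : ℝ) (a : Fin d → (Fin d → ℤ) → ℝ) : ℝ :=
  ((N : ℝ) ^ d)⁻¹ * ∑ i, ∑ x ∈ box d (3 * N), a i x ^ p

theorem inv_mul_card_box_le {d N : ℕ} (hN : 1 ≤ N) {m k : ℕ} (hmk : 2 * m + 1 ≤ k) :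
    ((N : ℝ) ^ d)⁻¹ * (box d (m * N)).card ≤ (k : ℝ) ^ d := by
  have hN' : (1 : ℝ) ≤ N := by exact_mod_cast hN
  rw [card_box d (by positivity), inv_mul_le_iff₀ (by positivity), ← mul_pow]
  refine pow_le_pow_left₀ (by positivity) ?_ d
  have : (2 * m + 1 : ℝ) ≤ k := by exact_mod_cast hmk
  push_cast
  nlinarith

theorem rpow_moment_exponent {s B : ℝ} (hs2 : s < 2) (hB : 0 ≤ B) :
    (B ^ (s / (2 - s))) ^ (1 - s / 2) = B ^ (s / 2) := by
  rw [← Real.rpow_mul hB]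
  congr 1
  have : 2 - s ≠ 0 := by linarith
  field_simp

theorem sum_inv_rpow_le {d : ℕ} {N : ℕ} {a : Fin d → (Fin d → ℤ) → ℝ} (ha : ∀ i x, 0 < a i x)
    {s B : ℝ} (hs2 : s < 2) (hB : 0 ≤ B)
    (hmom : moment N (s / (2 - s)) (fun i x => (a i x)⁻¹) ≤ B ^ (s / (2 - s))) {R : ℤ}
    (hR : R ≤ 3 * N) :
    (((N : ℝ) ^ d)⁻¹ * ∑ i, ∑ x ∈ box d R, (a i x)⁻¹ ^ (s / (2 - s))) ^ (1 - s / 2) ≤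
      B ^ (s / 2) := by
  rw [← rpow_moment_exponent hs2 hB]
  have hnn : ∀ i x, 0 ≤ (a i x)⁻¹ ^ (s / (2 - s)) := fun i x =>
    Real.rpow_nonneg (inv_nonneg.2 (ha i x).le) _
  refine Real.rpow_le_rpow (mul_nonneg (by positivity)
    (Finset.sum_nonneg fun i _ => Finset.sum_nonneg fun x _ => hnn i x)) ?_ (by linarith)
  refine le_trans (mul_le_mul_of_nonneg_left ?_ (by positivity)) hmom
  exact Finset.sum_le_sum fun i _ => Finset.sum_le_sum_of_subset_of_nonneg (box_mono hR)
    fun x _ _ => hnn i x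

/-- The positive part of -log(2u) vanishes where u ≥ 1/2, so the Poincaré inequality controls it by
its gradient, and the gradient is controlled by the energy of log u. This is the starting point of
the iteration. -/
theorem exists_log_sobolevPow_le {d : ℕ} (hd : 1 ≤ d) {p s : ℝ} (hp : 1 ≤ p) (hs : 1 ≤ s)
    (hs2 : s < 2) :
    ∃ C : ℝ, 0 ≤ C ∧ ∀ (N : ℕ), 1 ≤ N → ∀ a : Fin d → (Fin d → ℤ) → ℝ, (∀ i x, 0 < a i x) →
      ∀ A B : ℝ, 0 ≤ A → 0 ≤ B → moment N p a ≤ A ^ p →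
      moment N (s / (2 - s)) (fun i x => (a i x)⁻¹) ≤ B ^ (s / (2 - s)) →
      ∀ u : (Fin d → ℤ) → ℝ, (∀ x ∈ box d (3 * N + 1), 0 < u x) →
      (∀ x ∈ box d (3 * N - 1), lap a u x = 0) →
      (box d (2 * N)).card ≤ 2 * ((box d (2 * N)).filter fun x => 1 / 2 ≤ u x).card →
      sobolevPow s N (2 * N) (fun x => max (-Real.log (2 * u x)) 0) ≤ C * (A * B) ^ (s / 2) := by
  obtain ⟨C, hC, hpoin⟩ := exists_poincare_of_half_zero d hs
  -- The d directions times (6N+1)^d ≤ (7N)^d points of the box of radius 3N.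
  set K : ℝ := d * 7 ^ d with hK
  have hK1 : 1 ≤ K := by
    have h1 : (1 : ℝ) ≤ d := by exact_mod_cast hd
    have h2 : (1 : ℝ) ≤ 7 ^ d := one_le_pow₀ (by norm_num)
    nlinarith
  refine ⟨(1 + C * 5 ^ s) * K ^ (s / 2), by positivity,
    fun N hN a ha A B hA hB hmA hmB u hu hsol hhalf => ?_⟩
  have hN1 : (1 : ℝ) ≤ N := by exact_mod_cast hN
  set f : (Fin d → ℤ) → ℝ := fun x => max (-Real.log (2 * u x)) 0 with hf
  set c : ℝ := ((N : ℝ) ^ d)⁻¹ with hc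
  have hc0 : 0 ≤ c := by positivity
  -- The positive part is 1-Lipschitz, and the constant log 2 disappears from differences.
  have hgrad : ∀ i, ∀ x ∈ box d (2 * N), x i < 2 * N →
      fdiff i f x ^ 2 ≤ fdiff i (fun x => Real.log (u x)) x ^ 2 := by
    intro i x hx hi
    have hux := hu x (box_mono (by omega) hx)
    have huy := hu _ (box_mono (by omega) (mem_box_add_single hx hi))
    rw [← sq_abs, ← sq_abs (fdiff i (fun x => Real.log (u x)) x)]
    refine pow_le_pow_left₀ (abs_nonneg _) ?_ 2
    simp only [fdiff, hf]
    refine (abs_max_sub_max_le_max _ _ _ _).trans ?_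
    rw [Real.log_mul two_ne_zero huy.ne', Real.log_mul two_ne_zero hux.ne', sub_self, abs_zero,
      max_eq_left (abs_nonneg _), abs_sub_comm]
    apply le_of_eq
    congr 1
    ring
  have henergy : c * ((N : ℝ) ^ 2 * ∑ i, ∑ x ∈ box d (2 * N),
      if x i < 2 * N then a i x * fdiff i f x ^ 2 else 0) ≤ K * A := by
    have h1 := sum_log_energy_le a (fun i x => (ha i x).le) u hN hu hsol
    have h2 : ∑ i, ∑ x ∈ box d (2 * N), (if x i < 2 * N then a i x * fdiff i f x ^ 2 else 0) ≤
        ∑ i, ∑ x ∈ box d (2 * N), (if x i < 2 * N then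
          a i x * fdiff i (fun x => Real.log (u x)) x ^ 2 else 0) := by
      refine Finset.sum_le_sum fun i _ => Finset.sum_le_sum fun x hx => ?_
      split_ifs with hi
      · exact mul_le_mul_of_nonneg_left (hgrad i x hx hi) (ha i x).le
      · exact le_rfl
    have h3 := mean_le_of_mean_rpow_le (Finset.univ ×ˢ box d (3 * N)) (a := fun z => a z.1 z.2)
      hc0 hp hK1 hA (by
        rw [Finset.card_product, Finset.card_univ, Fintype.card_fin, Nat.cast_mul, hK]
        have := inv_mul_card_box_le (d := d) hN (m := 3) (k := 7) (by norm_num)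
        push_cast at this
        rw [mul_left_comm]
        gcongr) (fun _ _ => (ha _ _).le) (by
        rw [Finset.sum_product]
        exact hmA)
    rw [Finset.sum_product] at h3
    refine le_trans (mul_le_mul_of_nonneg_left ?_ hc0) h3
    rw [← le_inv_mul_iff₀ (by positivity)]
    exact h2.trans h1
  have hgradpow : c * ((N : ℝ) ^ s * ∑ i, dirPow s i (2 * N) f) ≤
      (K * A) ^ (s / 2) * B ^ (s / 2) := by
    refine (sum_dirPow_le_energy ha hc0 (by positivity) (by linarith) hs2 (2 * N) f).trans ?_
    refine mul_le_mul (Real.rpow_le_rpow ?_ henergy (by linarith))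
      (sum_inv_rpow_le ha hs2 hB hmB (by omega)) ?_ (by positivity)
    · refine mul_nonneg hc0 (mul_nonneg (by positivity) (Finset.sum_nonneg fun i _ =>
        Finset.sum_nonneg fun x _ => ?_))
      split_ifs
      · exact mul_nonneg (ha i x).le (sq_nonneg _)
      · exact le_rfl
    · exact Real.rpow_nonneg (mul_nonneg hc0 (Finset.sum_nonneg fun i _ =>
        Finset.sum_nonneg fun x _ => Real.rpow_nonneg (inv_nonneg.2 (ha i x).le) _)) _
  have hdir : 0 ≤ ∑ i, dirPow s i (2 * N) f := Finset.sum_nonneg fun i _ => dirPow_nonneg _ _ _ _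
  have hP := hpoin (2 * N) (by omega) f (by
    refine hhalf.trans (Nat.mul_le_mul_left 2 (Finset.card_le_card fun x hx => ?_))
    rw [Finset.mem_filter] at hx ⊢
    refine ⟨hx.1, ?_⟩
    simp only [hf]
    refine max_eq_right (neg_nonpos.2 (Real.log_nonneg ?_))
    linarith [hx.2])
  have hP2 : ∑ x ∈ box d (2 * N), |f x| ^ s ≤ C * 5 ^ s * (N ^ s * ∑ i, dirPow s i (2 * N) f) := by
    refine hP.trans ?_
    rw [← mul_assoc (C * 5 ^ s), mul_assoc C (5 ^ s), ← Real.mul_rpow (by norm_num) (by positivity)]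
    gcongr
    push_cast
    linarith
  calc sobolevPow s N (2 * N) f ≤ c * (C * 5 ^ s * (N ^ s * ∑ i, dirPow s i (2 * N) f) +
        N ^ s * ∑ i, dirPow s i (2 * N) f) := by
        rw [sobolevPow]
        gcongr
    _ = (1 + C * 5 ^ s) * (c * (N ^ s * ∑ i, dirPow s i (2 * N) f)) := by ring
    _ ≤ (1 + C * 5 ^ s) * ((K * A) ^ (s / 2) * B ^ (s / 2)) := by gcongr
    _ = _ := by
      rw [Real.mul_rpow (by linarith) hA, Real.mul_rpow hA hB]
      ring

/-! ### Choice of the cutoff profile -/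

/-- Markov's inequality: at most a quarter of the terms exceed four times the average. The case M =
0 is separate because M is cancelled. -/
theorem card_filter_mul_lt_le {A : ℕ → ℝ} (hA : ∀ r, 0 ≤ A r) (S : Finset ℕ) {M : ℝ}
    (hM : ∑ r ∈ S, A r ≤ M) :
    4 * (S.filter fun r => 4 * M < A r * S.card).card ≤ S.card := by
  rcases (Finset.sum_nonneg fun r _ => hA r).trans hM |>.eq_or_lt with h0 | h0
  · have : S.filter (fun r => 4 * M < A r * S.card) = ∅ := by
      refine Finset.filter_eq_empty_iff.2 fun r hr => ?_
      have : A r ≤ 0 := h0 ▸ (Finset.single_le_sum (fun r _ => hA r) hr).trans hM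
      rw [← h0, not_lt]
      nlinarith [Nat.cast_nonneg (α := ℝ) S.card]
    simp [this]
  · set T := S.filter fun r => 4 * M < A r * S.card with hT
    have h1 : ∑ r ∈ T, 4 * M ≤ ∑ r ∈ T, A r * S.card :=
      Finset.sum_le_sum fun r hr => (Finset.mem_filter.1 hr).2.le
    have h2 : ∑ r ∈ T, A r ≤ M := (Finset.sum_le_sum_of_subset_of_nonneg
      (Finset.filter_subset _ _) fun r _ _ => hA r).trans hM
    rw [Finset.sum_const, nsmul_eq_mul, ← Finset.sum_mul] at h1
    have h3 : (4 * T.card : ℝ) * M ≤ S.card * M := by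
      nlinarith [Nat.cast_nonneg (α := ℝ) S.card]
    exact_mod_cast le_of_mul_le_mul_right h3 h0

/-- Given two non-negative sequences, there is a decreasing profile from `1` at `σ` to `0` at `ρ`
that decreases only where both sequences are at most four times their average. -/
theorem exists_profile {σ ρ : ℕ} (hσρ : σ < ρ) {A B : ℕ → ℝ} (hA : ∀ r, 0 ≤ A r)
    (hB : ∀ r, 0 ≤ B r) {M M' : ℝ} (hM : ∑ r ∈ Finset.Ico σ ρ, A r ≤ M)
    (hM' : ∑ r ∈ Finset.Ico σ ρ, B r ≤ M') :
    ∃ h : ℕ → ℝ, (∀ r, 0 ≤ h r) ∧ (∀ r, h r ≤ 1) ∧ (∀ r, r ≤ σ → h r = 1) ∧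
      (∀ r, ρ ≤ r → h r = 0) ∧ (∀ r, |h (r + 1) - h r| ≤ 2 / ((ρ : ℝ) - σ)) ∧
      ∀ r, h (r + 1) ≠ h r → r ∈ Finset.Ico σ ρ ∧ A r * ((ρ : ℝ) - σ) ≤ 4 * M ∧
        B r * ((ρ : ℝ) - σ) ≤ 4 * M' := by
  set S := Finset.Ico σ ρ with hS
  have hcard : (S.card : ℝ) = (ρ : ℝ) - σ := by
    rw [hS, Nat.card_Ico, Nat.cast_sub hσρ.le]
  rw [← hcard]
  have hS0 : 0 < S.card := by
    rw [hS, Nat.card_Ico]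
    omega
  -- The good radii: each of the two sequences excludes at most a quarter of the radii, so at least
  -- half remain.
  set G := S.filter fun r => A r * S.card ≤ 4 * M ∧ B r * S.card ≤ 4 * M' with hG
  have hGcard : S.card ≤ 2 * G.card := by
    have h1 := card_filter_mul_lt_le hA S hM
    have h2 := card_filter_mul_lt_le hB S hM'
    have h3 : S ⊆ G ∪ (S.filter (fun r => 4 * M < A r * S.card) ∪
        S.filter fun r => 4 * M' < B r * S.card) := by
      intro r hr
      simp only [hG, Finset.mem_union, Finset.mem_filter, hr, true_and]
      by_cases h4 : A r * S.card ≤ 4 * M <;> by_cases h5 : B r * S.card ≤ 4 * M'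
      · exact Or.inl ⟨h4, h5⟩
      · exact Or.inr (Or.inr (not_le.1 h5))
      · exact Or.inr (Or.inl (not_le.1 h4))
      · exact Or.inr (Or.inl (not_le.1 h4))
    have h4 := (Finset.card_le_card h3).trans ((Finset.card_union_le _ _).trans
      (Nat.add_le_add_left (Finset.card_union_le _ _) _))
    omega
  have hG0 : 0 < G.card := by omega
  have hG0' : (0 : ℝ) < G.card := by exact_mod_cast hG0
  have hstep : ∀ r, ((G.filter (r ≤ ·)).card : ℝ) =
      (G.filter (r + 1 ≤ ·)).card + if r ∈ G then 1 else 0 := by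
    intro r
    have : G.filter (r ≤ ·) = G.filter (r + 1 ≤ ·) ∪ G.filter (r = ·) := by
      ext q
      simp only [Finset.mem_filter, Finset.mem_union]
      constructor
      · rintro ⟨h1, h2⟩
        rcases h2.eq_or_lt with h3 | h3
        · exact Or.inr ⟨h1, h3⟩
        · exact Or.inl ⟨h1, h3⟩
      · rintro (⟨h1, h2⟩ | ⟨h1, h2⟩)
        · exact ⟨h1, by omega⟩
        · exact ⟨h1, h2.le⟩
    rw [this, Finset.card_union_of_disjoint, Finset.filter_eq]
    · split_ifs <;> simp
    · refine Finset.disjoint_filter.2 fun q _ h1 h2 => ?_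
      omega
  have hdiff : ∀ r, ((G.filter (r + 1 ≤ ·)).card : ℝ) / G.card - (G.filter (r ≤ ·)).card / G.card
      = -((if r ∈ G then 1 else 0) / G.card) := by
    intro r
    rw [hstep r]
    ring
  -- The profile is the proportion of good radii that are at least r. It drops by 1/|G| ≤ 2/(ρ-σ) at
  -- each good radius and is constant elsewhere.
  refine ⟨fun r => (G.filter (r ≤ ·)).card / G.card, fun r =>
    div_nonneg (Nat.cast_nonneg _) hG0'.le, fun r => ?_,
    fun r hr => ?_, fun r hr => ?_, fun r => ?_, fun r hr => ?_⟩
  · rw [div_le_one hG0']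
    exact_mod_cast Finset.card_le_card (Finset.filter_subset _ _)
  · have : G.filter (r ≤ ·) = G := by
      refine Finset.filter_true_of_mem fun q hq => ?_
      have := (Finset.mem_Ico.1 (Finset.mem_filter.1 hq).1).1
      omega
    dsimp only
    rw [this, div_self hG0'.ne']
  · have : G.filter (r ≤ ·) = ∅ := by
      refine Finset.filter_false_of_mem fun q hq => ?_
      have := (Finset.mem_Ico.1 (Finset.mem_filter.1 hq).1).2
      omega
    dsimp only
    rw [this]
    simp
  · dsimp only
    rw [hdiff, abs_neg, abs_of_nonneg (div_nonneg (by split_ifs <;> norm_num) hG0'.le)]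
    have hS0' : (0 : ℝ) < S.card := by exact_mod_cast hS0
    have hGS : (S.card : ℝ) ≤ 2 * G.card := by exact_mod_cast hGcard
    rw [div_le_div_iff₀ hG0' hS0']
    split_ifs
    · linarith
    · linarith
  · have hrG : r ∈ G := by
      by_contra h
      apply hr
      have := hdiff r
      rw [if_neg h, zero_div, neg_zero, sub_eq_zero] at this
      exact this
    exact ⟨(Finset.mem_filter.1 hrG).1, (Finset.mem_filter.1 hrG).2⟩

/-! ### Slices of a box and the Sobolev inequality on them -/

/-- The point with `i`-th coordinate `t` and the other coordinates given by `y`. -/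
def ins {D : ℕ} (i : Fin (D + 1)) (t : ℤ) (y : Fin D → ℤ) : Fin (D + 1) → ℤ :=
  Fin.insertNth (α := fun _ => ℤ) i t y

@[simp] theorem ins_same {D : ℕ} (i : Fin (D + 1)) (t : ℤ) (y : Fin D → ℤ) : ins i t y i = t := by
  simp [ins]

@[simp] theorem ins_succAbove {D : ℕ} (i : Fin (D + 1)) (t : ℤ) (y : Fin D → ℤ) (j : Fin D) :
    ins i t y (i.succAbove j) = y j := by
  simp [ins]

theorem ins_mem_box {D : ℕ} {R : ℤ} (i : Fin (D + 1)) {t : ℤ} {y : Fin D → ℤ} :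
    ins i t y ∈ box (D + 1) R ↔ t ∈ Finset.Icc (-R) R ∧ y ∈ box D R := by
  rw [mem_box, mem_box, Fin.forall_iff_succAbove i, Finset.mem_Icc]
  simp

theorem ins_add_single_same {D : ℕ} (i : Fin (D + 1)) (t : ℤ) (y : Fin D → ℤ) :
    ins i t y + Pi.single i 1 = ins i (t + 1) y := by
  funext k
  induction k using Fin.succAboveCases i with
  | x => simp
  | p j => simp

theorem ins_add_single_succAbove {D : ℕ} (i : Fin (D + 1)) (t : ℤ) (y : Fin D → ℤ) (j : Fin D) :
    ins i t y + Pi.single (i.succAbove j) 1 = ins i t (y + Pi.single j 1) := by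
  funext k
  induction k using Fin.succAboveCases i with
  | x => simp
  | p l =>
    by_cases h : l = j
    · subst h
      simp
    · simp [h]

theorem sum_box_succ {D : ℕ} (i : Fin (D + 1)) (R : ℤ) (F : (Fin (D + 1) → ℤ) → ℝ) :
    ∑ x ∈ box (D + 1) R, F x = ∑ t ∈ Finset.Icc (-R) R, ∑ y ∈ box D R, F (ins i t y) := by
  rw [← Finset.sum_product']
  have hinv : ∀ x : Fin (D + 1) → ℤ, ins i (x i) (fun j => x (i.succAbove j)) = x := fun x => by
    funext k
    induction k using Fin.succAboveCases i with
    | x => simp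
    | p j => simp
  refine Finset.sum_nbij' (fun x => (x i, fun j => x (i.succAbove j))) (fun z => ins i z.1 z.2)
    ?_ ?_ ?_ ?_ ?_
  · intro x hx
    rw [← hinv x, ins_mem_box] at hx
    exact Finset.mem_product.2 hx
  · rintro ⟨t, y⟩ hz
    exact (ins_mem_box i).2 (Finset.mem_product.1 hz)
  · intro x _
    exact hinv x
  · rintro ⟨t, y⟩ _
    simp
  · intro x _
    rw [hinv]

theorem sobolevPow_nonneg {d : ℕ} (s : ℝ) {N : ℝ} (hN : 0 ≤ N) (R : ℤ) (f : (Fin d → ℤ) → ℝ) :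
    0 ≤ sobolevPow s N R f := by
  have h1 : 0 ≤ ∑ i, dirPow s i R f := Finset.sum_nonneg fun i _ => dirPow_nonneg s i R f
  have h2 : 0 ≤ ∑ x ∈ box d R, |f x| ^ s := Finset.sum_nonneg fun _ _ => by positivity
  rw [sobolevPow]
  positivity

/-- Fubini, discarding the derivative across the slices. The factor N is the ratio of the
normalisations in dimensions D and D+1. -/
theorem sum_sobolevPow_slice_le {D : ℕ} {s N : ℝ} (hN : 0 < N) (i : Fin (D + 1)) (R : ℤ)
    (f : (Fin (D + 1) → ℤ) → ℝ) :
    ∑ t ∈ Finset.Icc (-R) R, sobolevPow s N R (fun y => f (ins i t y)) ≤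
      N * sobolevPow s N R f := by
  have h1 : ∀ j : Fin D, ∑ t ∈ Finset.Icc (-R) R, dirPow s j R (fun y => f (ins i t y)) =
      dirPow s (i.succAbove j) R f := by
    intro j
    rw [dirPow, sum_box_succ i]
    refine Finset.sum_congr rfl fun t _ => ?_
    rw [dirPow]
    simp only [fdiff, ins_add_single_succAbove, ins_succAbove]
  have h2 : ∑ t ∈ Finset.Icc (-R) R, ∑ j : Fin D, dirPow s j R (fun y => f (ins i t y)) ≤
      ∑ k, dirPow s k R f := by
    rw [Finset.sum_comm, Finset.sum_congr rfl fun j _ => h1 j, Fin.sum_univ_succAbove _ i]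
    exact le_add_of_nonneg_left (dirPow_nonneg _ _ _ _)
  simp only [sobolevPow]
  rw [← Finset.mul_sum, Finset.sum_add_distrib, ← Finset.mul_sum, sum_box_succ i R]
  have h3 : (N ^ D)⁻¹ = N * (N ^ (D + 1))⁻¹ := by
    rw [pow_succ]
    field_simp
  rw [h3, mul_assoc]
  gcongr

/-- After Hölder with p and p', the product is needed in L^{p'}, while Sobolev offers the larger
exponent t > 2p'. On the support of w one has f ≥ κ, so the surplus exponent is paid for by a
negative power of κ; this makes the estimate superlinear. Two pairs (w, f) occur because a bond
across slices joins two adjacent ones. -/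
theorem exists_sum_slice_le {D : ℕ} (hD : 2 ≤ D) {p s t : ℝ} (hp : 1 < p) (ht : 2 < t)
    (hst : 1 / s = 1 / t + 1 / D) (hpt : 1 < t * (1 - 1 / p) / 2) :
    ∃ C : ℝ, 0 ≤ C ∧ ∀ (N : ℝ) (R : ℤ), 0 < N → N ≤ R → ∀ b w₁ w₂ f₁ f₂ : (Fin D → ℤ) → ℝ,
      (∀ x, 0 ≤ b x) → (∀ x, 0 ≤ w₁ x) → (∀ x, 0 ≤ w₂ x) → (∀ x, 0 ≤ f₁ x) → (∀ x, 0 ≤ f₂ x) →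
      ∀ κ : ℝ, 0 < κ → (∀ x, w₁ x ≤ f₁ x) → (∀ x, w₂ x ≤ f₂ x) →
      (∀ x, w₁ x ≠ 0 → κ ≤ f₁ x) → (∀ x, w₂ x ≠ 0 → κ ≤ f₂ x) → ∀ A Y : ℝ,
      (N ^ D)⁻¹ * ∑ x ∈ box D R, b x ^ p ≤ A → sobolevPow s N R f₁ ≤ Y → sobolevPow s N R f₂ ≤ Y →
      (N ^ D)⁻¹ * ∑ x ∈ box D R, b x * (w₁ x * w₂ x) ≤
        C * A ^ (1 / p) * κ ^ (-(2 * (t * (1 - 1 / p) / 2 - 1))) *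
          Y ^ (2 * (t * (1 - 1 / p) / 2) / s) := by
  obtain ⟨C, hC, hsob⟩ := exists_sobolev hD ht hst
  have hP : 0 < 1 - 1 / p := by
    have : 1 / p < 1 := by
      rw [div_lt_one (by linarith)]
      exact hp
    linarith
  set P := 1 - 1 / p with hPdef
  set p' : ℝ := 1 / P with hp'
  have hp'0 : 0 < p' := by positivity
  have hconj : p.HolderConjugate p' := by
    rw [Real.holderConjugate_iff]
    refine ⟨hp, ?_⟩
    rw [hp', hPdef]
    simp
  have ht2 : 2 * p' < t := by
    rw [hp', mul_one_div, div_lt_iff₀ hP]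
    linarith
  have hs0 : 0 < s := by
    rw [← one_div_pos, hst]
    positivity
  refine ⟨(2 * C) ^ P, by positivity, fun N R hN hR b w₁ w₂ f₁ f₂ hb hw₁ hw₂ hf₁ hf₂ κ hκ hwf₁ hwf₂
    hκ₁ hκ₂ A Y hA hY₁ hY₂ => ?_⟩
  set c : ℝ := (N ^ D)⁻¹ with hc
  have hc0 : 0 < c := by positivity
  have hY0 : 0 ≤ Y := (sobolevPow_nonneg s hN.le R f₁).trans hY₁
  have hA0 : 0 ≤ A :=
    (mul_nonneg hc0.le (Finset.sum_nonneg fun x _ => Real.rpow_nonneg (hb x) _)).trans hA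
  -- Here 2p' - t < 0, so the corresponding power of f is largest at f = κ.
  have point : ∀ w f : ℝ, 0 ≤ w → w ≤ f → (w ≠ 0 → κ ≤ f) →
      w ^ (2 * p') ≤ κ ^ (2 * p' - t) * f ^ t := by
    intro w f hw hwf hκf
    rcases eq_or_ne w 0 with h | h
    · rw [h, Real.zero_rpow (by positivity)]
      have := hw.trans hwf
      positivity
    · have hf : 0 < f := hκ.trans_le (hκf h)
      calc w ^ (2 * p') ≤ f ^ (2 * p') := Real.rpow_le_rpow hw hwf (by positivity)
        _ = f ^ (2 * p' - t) * f ^ t := by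
          rw [← Real.rpow_add hf]
          ring_nf
        _ ≤ _ := by
          refine mul_le_mul_of_nonneg_right ?_ (by positivity)
          exact Real.rpow_le_rpow_of_nonpos hκ (hκf h) (by linarith)
  have bound : ∀ w f : (Fin D → ℤ) → ℝ, (∀ x, 0 ≤ w x) → (∀ x, 0 ≤ f x) → (∀ x, w x ≤ f x) →
      (∀ x, w x ≠ 0 → κ ≤ f x) → sobolevPow s N R f ≤ Y →
      c * ∑ x ∈ box D R, w x ^ (2 * p') ≤ κ ^ (2 * p' - t) * (C * Y ^ (t / s)) := by
    intro w f hw hf hwf hκf hY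
    have h1 := hsob N R hN hR f hf
    have h0 := sobolevPow_nonneg s hN.le R f
    calc _ ≤ c * ∑ x ∈ box D R, κ ^ (2 * p' - t) * f x ^ t := by
          gcongr with x _
          exact point _ _ (hw x) (hwf x) (hκf x)
      _ = κ ^ (2 * p' - t) * (c * ∑ x ∈ box D R, f x ^ t) := by
          rw [← Finset.mul_sum]
          ring
      _ ≤ κ ^ (2 * p' - t) * (C * sobolevPow s N R f ^ (t / s)) := by gcongr
      _ ≤ _ := by gcongr
  have hprod : c * ∑ x ∈ box D R, (w₁ x * w₂ x) ^ p' ≤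
      2 * C * (κ ^ (2 * p' - t) * Y ^ (t / s)) := by
    have h1 : ∀ x, (w₁ x * w₂ x) ^ p' ≤ w₁ x ^ (2 * p') + w₂ x ^ (2 * p') := by
      intro x
      have h2 : ∀ a : ℝ, 0 ≤ a → a ^ (2 * p') = (a * a) ^ p' := fun a ha => by
        rw [Real.rpow_mul ha, Real.rpow_two, pow_two]
      rw [h2 _ (hw₁ x), h2 _ (hw₂ x)]
      have h3 : 0 ≤ (w₁ x * w₁ x) ^ p' := Real.rpow_nonneg (mul_self_nonneg _) _
      have h4 : 0 ≤ (w₂ x * w₂ x) ^ p' := Real.rpow_nonneg (mul_self_nonneg _) _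
      rcases le_total (w₁ x) (w₂ x) with h | h
      · have := Real.rpow_le_rpow (mul_nonneg (hw₁ x) (hw₂ x))
          (mul_le_mul_of_nonneg_right h (hw₂ x)) hp'0.le
        linarith
      · have := Real.rpow_le_rpow (mul_nonneg (hw₁ x) (hw₂ x))
          (mul_le_mul_of_nonneg_left h (hw₁ x)) hp'0.le
        linarith
    calc _ ≤ c * ∑ x ∈ box D R, (w₁ x ^ (2 * p') + w₂ x ^ (2 * p')) := by
          gcongr with x _
          exact h1 x
      _ = c * ∑ x ∈ box D R, w₁ x ^ (2 * p') + c * ∑ x ∈ box D R, w₂ x ^ (2 * p') := by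
          rw [Finset.sum_add_distrib, mul_add]
      _ ≤ _ := add_le_add (bound w₁ f₁ hw₁ hf₁ hwf₁ hκ₁ hY₁) (bound w₂ f₂ hw₂ hf₂ hwf₂ hκ₂ hY₂)
      _ = _ := by ring
  refine (weighted_holder (box D R) hc0.le hconj (fun x _ => hb x)
    (fun x _ => mul_nonneg (hw₁ x) (hw₂ x))).trans ?_
  have e1 : 1 / p' = P := by rw [hp', one_div_one_div]
  have hprod0 : 0 ≤ c * ∑ x ∈ box D R, (w₁ x * w₂ x) ^ p' :=
    mul_nonneg hc0.le (Finset.sum_nonneg fun x _ =>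
      Real.rpow_nonneg (mul_nonneg (hw₁ x) (hw₂ x)) _)
  have hb0 : 0 ≤ c * ∑ x ∈ box D R, b x ^ p :=
    mul_nonneg hc0.le (Finset.sum_nonneg fun x _ => Real.rpow_nonneg (hb x) _)
  calc _ ≤ A ^ (1 / p) * (2 * C * (κ ^ (2 * p' - t) * Y ^ (t / s))) ^ P := by
        rw [e1]
        have : 0 ≤ 1 / p := by positivity
        gcongr
    _ = _ := by
      rw [Real.mul_rpow (x := 2 * C) (by positivity) (by positivity),
        Real.mul_rpow (x := κ ^ (2 * p' - t)) (by positivity) (by positivity), ← Real.rpow_mul hκ.le, ← Real.rpow_mul hY0]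
      have e2 : (2 * p' - t) * P = -(2 * (t * P / 2 - 1)) := by
        rw [hp']
        field_simp
        ring
      have e3 : t / s * P = 2 * (t * P / 2) / s := by ring
      rw [e2, e3]
      ring

/-! ### The De Giorgi step -/

/-- The radius of a bond in direction `i` that starts at a point with `i`-th coordinate `t`. -/
def rad (t : ℤ) : ℕ := min t.natAbs (t + 1).natAbs

/-- The endpoints t and t+1 have absolute values `rad t` and `rad t + 1` in some order, on either
side of the origin. -/
theorem abs_profile_sub (h : ℕ → ℝ) (t : ℤ) :
    |h (t + 1).natAbs - h t.natAbs| = |h (rad t + 1) - h (rad t)| := by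
  rcases le_or_gt 0 t with ht | ht
  · have h1 : (t + 1).natAbs = t.natAbs + 1 := by omega
    have h2 : rad t = t.natAbs := by
      rw [rad]
      omega
    rw [h1, h2]
  · have h1 : t.natAbs = (t + 1).natAbs + 1 := by omega
    have h2 : rad t = (t + 1).natAbs := by
      rw [rad]
      omega
    rw [h2, ← h1, abs_sub_comm]

theorem sum_fiber_rad_le {σ ρ : ℕ} {S : Finset ℤ} (F : ℤ → ℝ) (hF : ∀ t, 0 ≤ F t) :
    ∑ r ∈ Finset.Ico σ ρ, ∑ t ∈ S with rad t = r, F t ≤ ∑ t ∈ S, F t := by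
  rw [← Finset.sum_biUnion]
  · exact Finset.sum_le_sum_of_subset_of_nonneg
      (Finset.biUnion_subset.2 fun r _ => Finset.filter_subset _ _) fun t _ _ => hF t
  · intro r _ r' _ hrr
    refine Finset.disjoint_filter.2 fun t _ h1 h2 => hrr (h1.symm.trans h2)

/-- At a point where the truncation is positive it equals v - l, and at the neighbours it is at
least v - l. -/
theorem lap_max_sub_nonneg {d : ℕ} {a : Fin d → (Fin d → ℤ) → ℝ} (ha : ∀ i x, 0 ≤ a i x)
    {v : (Fin d → ℤ) → ℝ} {l : ℝ} {x : Fin d → ℤ} (hx : max (v x - l) 0 ≠ 0)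
    (hv : 0 ≤ lap a v x) : 0 ≤ lap a (fun x => max (v x - l) 0) x := by
  have hx' : max (v x - l) 0 = v x - l := by
    rcases max_choice (v x - l) 0 with h | h
    · exact h
    · exact absurd h hx
  refine hv.trans ?_
  refine Finset.sum_le_sum fun i _ => ?_
  dsimp only
  rw [hx']
  refine add_le_add (mul_le_mul_of_nonneg_left ?_ (ha _ _)) (mul_le_mul_of_nonneg_left ?_ (ha _ _))
  · linarith [le_max_left (v (x + Pi.single i 1) - l) 0]
  · linarith [le_max_left (v (x - Pi.single i 1) - l) 0]

/-- The function ηw agrees with w on the smaller box and vanishes on a face of the larger one, so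
its gradient controls its sum as well. The factor 5^s comes from 2ρ+1 ≤ 5N. -/
theorem sobolevPow_le_energy {d : ℕ} (hd : 1 ≤ d) {s : ℝ} (hs : 1 ≤ s) (hs2 : s < 2) {N : ℕ}
    (hN : 1 ≤ N) {a : Fin d → (Fin d → ℤ) → ℝ} (ha : ∀ i x, 0 < a i x) {B : ℝ} (hB : 0 ≤ B)
    (hmB : moment N (s / (2 - s)) (fun i x => (a i x)⁻¹) ≤ B ^ (s / (2 - s))) {σ ρ : ℕ}
    (hσρ : σ ≤ ρ) (hρ : ρ ≤ 2 * N) {w η : (Fin d → ℤ) → ℝ} (hη1 : ∀ x ∈ box d σ, η x = 1)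
    (hη0 : ∀ x, η x ≠ 0 → x ∈ box d (ρ - 1)) :
    sobolevPow s N σ w ≤ (1 + 5 ^ s) * (((N : ℝ) ^ d)⁻¹ * ((N : ℝ) ^ 2 *
      ∑ i, ∑ x ∈ box d ρ, a i x * fdiff i (fun x => η x * w x) x ^ 2)) ^ (s / 2) * B ^ (s / 2) := by
  have hN1 : (1 : ℝ) ≤ N := by exact_mod_cast hN
  set g : (Fin d → ℤ) → ℝ := fun x => η x * w x with hg
  set c : ℝ := ((N : ℝ) ^ d)⁻¹ with hc
  have hc0 : 0 ≤ c := by positivity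
  have hsub : box d (σ : ℤ) ⊆ box d ρ := box_mono (by omega)
  have hdir : ∀ i, dirPow s i σ w ≤ dirPow s i ρ g := by
    intro i
    refine le_trans (Finset.sum_le_sum fun x hx => ?_) (Finset.sum_le_sum_of_subset_of_nonneg hsub
      fun x _ _ => by split_ifs <;> positivity)
    split_ifs with h1 h2
    · simp only [fdiff, hg]
      rw [hη1 x hx, hη1 _ (mem_box_add_single hx h1), one_mul, one_mul]
    · omega
    · positivity
    · exact le_rfl
  have hfun : ∑ x ∈ box d σ, |w x| ^ s ≤ 5 ^ s * ((N : ℝ) ^ s * ∑ i, dirPow s i ρ g) := by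
    have h1 : ∑ x ∈ box d σ, |w x| ^ s ≤ ∑ x ∈ box d ρ, |g x| ^ s := by
      refine le_trans (Finset.sum_le_sum fun x hx => ?_)
        (Finset.sum_le_sum_of_subset_of_nonneg hsub fun x _ _ => by positivity)
      simp only [hg]
      rw [hη1 x hx, one_mul]
    have h2 := sum_rpow_le_dirPow_of_zero hs ⟨0, hd⟩ (R := ρ) (by omega) g (by
      intro x hx
      have : η x = 0 := by
        by_contra h
        have := (mem_box.1 (hη0 x h) ⟨0, hd⟩).1
        omega
      simp [hg, this])
    rw [← mul_assoc, ← Real.mul_rpow (by norm_num) (by positivity)]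
    refine h1.trans (h2.trans ?_)
    have hρ' : (ρ : ℝ) ≤ 2 * N := by exact_mod_cast hρ
    have hρ0 : (0 : ℝ) ≤ ρ := Nat.cast_nonneg _
    push_cast
    refine mul_le_mul (Real.rpow_le_rpow (by positivity) (by linarith) (by linarith))
      (Finset.single_le_sum (f := fun i => dirPow s i ρ g) (fun i _ => dirPow_nonneg _ _ _ _)
        (Finset.mem_univ _)) (dirPow_nonneg _ _ _ _) (by positivity)
  have hen := sum_dirPow_le_energy ha hc0 (Nat.cast_nonneg N) (by linarith) hs2 ρ g
  have hnn : ∀ i x, 0 ≤ a i x * fdiff i g x ^ 2 := fun i x => mul_nonneg (ha i x).le (sq_nonneg _)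
  have hE : c * ((N : ℝ) ^ 2 * ∑ i, ∑ x ∈ box d ρ,
      (if x i < (ρ : ℤ) then a i x * fdiff i g x ^ 2 else 0)) ≤
      c * ((N : ℝ) ^ 2 * ∑ i, ∑ x ∈ box d ρ, a i x * fdiff i g x ^ 2) := by
    gcongr with i _ x _
    split_ifs
    · exact le_rfl
    · exact hnn i x
  have hE0 : 0 ≤ c * ((N : ℝ) ^ 2 * ∑ i, ∑ x ∈ box d ρ,
      (if x i < (ρ : ℤ) then a i x * fdiff i g x ^ 2 else 0)) := by
    refine mul_nonneg hc0 (mul_nonneg (by positivity) (Finset.sum_nonneg fun i _ =>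
      Finset.sum_nonneg fun x _ => ?_))
    split_ifs
    · exact hnn i x
    · exact le_rfl
  calc sobolevPow s N σ w
      ≤ c * (5 ^ s * ((N : ℝ) ^ s * ∑ i, dirPow s i ρ g) + (N : ℝ) ^ s * ∑ i, dirPow s i ρ g) := by
        rw [sobolevPow]
        gcongr with i _
        exact hdir i
    _ = (1 + 5 ^ s) * (c * ((N : ℝ) ^ s * ∑ i, dirPow s i ρ g)) := by ring
    _ ≤ (1 + 5 ^ s) * ((c * ((N : ℝ) ^ 2 * ∑ i, ∑ x ∈ box d ρ,
          a i x * fdiff i g x ^ 2)) ^ (s / 2) * B ^ (s / 2)) := by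
        refine mul_le_mul_of_nonneg_left (hen.trans ?_) (by positivity)
        refine mul_le_mul (Real.rpow_le_rpow hE0 hE (by linarith))
          (sum_inv_rpow_le ha hs2 hB hmB (by omega)) ?_ ?_
        · exact Real.rpow_nonneg (mul_nonneg hc0 (Finset.sum_nonneg fun i _ =>
            Finset.sum_nonneg fun x _ => Real.rpow_nonneg (inv_nonneg.2 (ha i x).le) _)) _
        · exact Real.rpow_nonneg (hE0.trans hE) _
    _ = _ := by ring

/-- Only slices on which the profile changes contribute to the Caccioppoli error, and on those Φ
applies. The constant collects D+1 directions, at most 5N slices each, and the squared slope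
4/(ρ-σ)². -/
theorem energy_cutoff_le {D : ℕ} {N : ℕ} (hN : 1 ≤ N) {a : Fin (D + 1) → (Fin (D + 1) → ℤ) → ℝ}
    (ha : ∀ i x, 0 ≤ a i x) {σ ρ : ℕ} (hσρ : σ < ρ) (hρ : ρ ≤ 2 * N)
    {w : (Fin (D + 1) → ℤ) → ℝ} (hw : ∀ x, 0 ≤ w x)
    (hsub : ∀ x ∈ box (D + 1) (ρ - 1), w x ≠ 0 → 0 ≤ lap a w x)
    {h : ℕ → ℝ} (h0 : ∀ r, 0 ≤ h r) (h1 : ∀ r, h r ≤ 1) (hout : ∀ r, ρ ≤ r → h r = 0)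
    (hlip : ∀ r, |h (r + 1) - h r| ≤ 2 / ((ρ : ℝ) - σ)) {Φ : ℝ} (hΦ0 : 0 ≤ Φ)
    (hΦ : ∀ i, ∀ t : ℤ, h (rad t + 1) ≠ h (rad t) → ((N : ℝ) ^ D)⁻¹ *
      ∑ y ∈ box D ρ, a i (ins i t y) * (w (ins i t y) * w (ins i (t + 1) y)) ≤ Φ) :
    ((N : ℝ) ^ (D + 1))⁻¹ * ((N : ℝ) ^ 2 * ∑ i, ∑ x ∈ box (D + 1) ρ,
      a i x * fdiff i (fun x => cutoff (D + 1) h x * w x) x ^ 2) ≤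
      20 * (D + 1) * ((N : ℝ) / (ρ - σ)) ^ 2 * Φ := by
  have hN1 : (1 : ℝ) ≤ N := by exact_mod_cast hN
  have hT : (0 : ℝ) < (ρ : ℝ) - σ := by
    have : (σ : ℝ) < ρ := by exact_mod_cast hσρ
    linarith
  have hsupp : ∀ x, cutoff (D + 1) h x ≠ 0 → x ∈ box (D + 1) (ρ - 1) := fun x hx =>
    mem_box_of_cutoff_ne_zero hout hx
  have hcac := caccioppoli a w (cutoff (D + 1) h) ρ hsupp hw fun x hx hwx => hsub x (hsupp x hx) hwx
  have hslice : ∀ i, ∀ t ∈ Finset.Icc (-(ρ : ℤ)) ρ, ∑ y ∈ box D ρ, a i (ins i t y) *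
      (w (ins i t y) * w (ins i t y + Pi.single i 1) * fdiff i (cutoff (D + 1) h) (ins i t y) ^ 2) ≤
      (2 / ((ρ : ℝ) - σ)) ^ 2 * ((N : ℝ) ^ D * Φ) := by
    intro i t _
    have hle : ∀ y, fdiff i (cutoff (D + 1) h) (ins i t y) ^ 2 ≤
        |h (rad t + 1) - h (rad t)| ^ 2 := fun y => by
      rw [← sq_abs]
      refine pow_le_pow_left₀ (abs_nonneg _) ?_ 2
      have := abs_fdiff_cutoff_le h0 h1 i (ins i t y)
      rwa [ins_same, abs_profile_sub] at this
    have hnn : ∀ y, 0 ≤ w (ins i t y) * w (ins i (t + 1) y) := fun y => mul_nonneg (hw _) (hw _)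
    have hsum : ∑ y ∈ box D ρ, a i (ins i t y) *
      (w (ins i t y) * w (ins i t y + Pi.single i 1) * fdiff i (cutoff (D + 1) h) (ins i t y) ^ 2) ≤
      |h (rad t + 1) - h (rad t)| ^ 2 *
        ∑ y ∈ box D ρ, a i (ins i t y) * (w (ins i t y) * w (ins i (t + 1) y)) := by
      rw [Finset.mul_sum]
      refine Finset.sum_le_sum fun y _ => ?_
      rw [ins_add_single_same]
      calc _ ≤ a i (ins i t y) * (w (ins i t y) * w (ins i (t + 1) y) *
            |h (rad t + 1) - h (rad t)| ^ 2) :=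
            mul_le_mul_of_nonneg_left (mul_le_mul_of_nonneg_left (hle y) (hnn y)) (ha _ _)
        _ = _ := by ring
    refine hsum.trans ?_
    by_cases hh : h (rad t + 1) = h (rad t)
    · rw [hh, sub_self, abs_zero, zero_pow two_ne_zero, zero_mul]
      positivity
    · have h2 := hΦ i t hh
      rw [inv_mul_le_iff₀ (by positivity)] at h2
      refine mul_le_mul (pow_le_pow_left₀ (abs_nonneg _) (hlip _) 2) h2 ?_ (by positivity)
      exact Finset.sum_nonneg fun y _ => mul_nonneg (ha _ _) (hnn y)
  have htot : ∑ i, ∑ x ∈ box (D + 1) ρ, a i x *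
      (w x * w (x + Pi.single i 1) * fdiff i (cutoff (D + 1) h) x ^ 2) ≤
      (D + 1) * (5 * N * ((2 / ((ρ : ℝ) - σ)) ^ 2 * ((N : ℝ) ^ D * Φ))) := by
    have h2 : ∀ i ∈ (Finset.univ : Finset (Fin (D + 1))), ∑ x ∈ box (D + 1) ρ, a i x *
        (w x * w (x + Pi.single i 1) * fdiff i (cutoff (D + 1) h) x ^ 2) ≤
        5 * N * ((2 / ((ρ : ℝ) - σ)) ^ 2 * ((N : ℝ) ^ D * Φ)) := by
      intro i _
      rw [sum_box_succ i]
      refine (Finset.sum_le_sum (hslice i)).trans ?_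
      rw [Finset.sum_const, nsmul_eq_mul, card_Icc_symm (by omega)]
      have : (ρ : ℝ) ≤ 2 * N := by exact_mod_cast hρ
      push_cast
      refine mul_le_mul_of_nonneg_right (by linarith) (by positivity)
    refine (Finset.sum_le_sum h2).trans (le_of_eq ?_)
    rw [Finset.sum_const, nsmul_eq_mul, Finset.card_univ, Fintype.card_fin]
    push_cast
    ring
  rw [inv_mul_le_iff₀ (by positivity)]
  calc _ ≤ (N : ℝ) ^ 2 * ((D + 1) * (5 * N * ((2 / ((ρ : ℝ) - σ)) ^ 2 * ((N : ℝ) ^ D * Φ)))) :=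
        mul_le_mul_of_nonneg_left (hcac.trans htot) (by positivity)
    _ = _ := by
      rw [pow_succ (N : ℝ) D]
      field_simp
      ring

/-- The profile is chosen for two sequences of radii: the p-th moments of the conductances on the
faces, and the Sobolev powers of the lower truncation on the two faces joined by a bond. On good
radii both are at most a multiple of N/(ρ-σ) times their averages, so the slice estimate applies and
the Caccioppoli inequality returns to dimension D+1. -/
theorem exists_deGiorgi_step {D : ℕ} (hD : 2 ≤ D) {p s t : ℝ} (hp : 1 < p) (ht : 2 < t)
    (hst : 1 / s = 1 / t + 1 / D) (hs : 1 ≤ s) (hs2 : s < 2) {χ : ℝ}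
    (hχdef : χ = t * (1 - 1 / p) / 2) (hχ : 1 < χ) :
    ∃ C b : ℝ, 0 ≤ C ∧ 0 ≤ b ∧ ∀ (N : ℕ), 1 ≤ N → ∀ a : Fin (D + 1) → (Fin (D + 1) → ℤ) → ℝ,
      (∀ i x, 0 < a i x) → ∀ A B : ℝ, 0 ≤ A → 0 ≤ B → moment N p a ≤ A ^ p →
      moment N (s / (2 - s)) (fun i x => (a i x)⁻¹) ≤ B ^ (s / (2 - s)) →
      ∀ v : (Fin (D + 1) → ℤ) → ℝ, (∀ x ∈ box (D + 1) (2 * N), 0 ≤ lap a v x) →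
      ∀ σ ρ : ℕ, N ≤ σ → σ < ρ → ρ ≤ 2 * N → ∀ k κ : ℝ, 0 < κ →
      sobolevPow s N σ (fun x => max (v x - (k + κ)) 0) ≤
        C * (A * B) ^ (s / 2) * ((N : ℝ) / (ρ - σ)) ^ b * κ ^ (-(s * (χ - 1))) *
          sobolevPow s N ρ (fun x => max (v x - k) 0) ^ χ := by
  obtain ⟨C, hC, hslice⟩ := exists_sum_slice_le hD hp ht hst (hχdef ▸ hχ)
  rw [← hχdef] at hslice
  have hs0 : 0 < s := by linarith
  have hp0 : 0 < p := by linarith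
  refine ⟨(1 + 5 ^ s) * (20 * (D + 1) * C * 4 ^ (1 / p) * (8 * (D + 1)) ^ (2 * χ / s)) ^ (s / 2),
    (2 + 1 / p + 2 * χ / s) * (s / 2), by positivity, by positivity,
    fun N hN a ha A B hA hB hmA hmB v hv σ ρ hNσ hσρ hρ k κ hκ => ?_⟩
  have hN1 : (1 : ℝ) ≤ N := by exact_mod_cast hN
  have hN0 : (0 : ℝ) < N := by linarith
  have hT : (0 : ℝ) < (ρ : ℝ) - σ := by
    have : (σ : ℝ) < ρ := by exact_mod_cast hσρ
    linarith
  set w : (Fin (D + 1) → ℤ) → ℝ := fun x => max (v x - (k + κ)) 0 with hw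
  set f : (Fin (D + 1) → ℤ) → ℝ := fun x => max (v x - k) 0 with hf
  set G : ℝ := sobolevPow s N ρ f with hG
  have hG0 : 0 ≤ G := sobolevPow_nonneg s hN0.le _ _
  set X : ℝ := (N : ℝ) / (ρ - σ) with hX
  have hX0 : 0 < X := by positivity
  have hw0 : ∀ x, 0 ≤ w x := fun x => le_max_right _ _
  have hf0 : ∀ x, 0 ≤ f x := fun x => le_max_right _ _
  have hwf : ∀ x, w x ≤ f x := fun x => max_le_max (by linarith) le_rfl
  have hwκ : ∀ x, w x ≠ 0 → κ ≤ f x := by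
    intro x hx
    have : 0 < v x - (k + κ) := by
      by_contra h
      exact hx (max_eq_right (not_lt.1 h))
    exact le_trans (by linarith) (le_max_left _ _)
  have hap : ∀ i x, 0 ≤ a i x ^ p := fun i x => Real.rpow_nonneg (ha i x).le _
  set α : Fin (D + 1) → ℤ → ℝ := fun i t => ∑ y ∈ box D ρ, a i (ins i t y) ^ p with hα
  set Y : Fin (D + 1) → ℤ → ℝ := fun i t => sobolevPow s N ρ (fun y => f (ins i t y)) with hY
  have hα0 : ∀ i t, 0 ≤ α i t := fun i t => Finset.sum_nonneg fun y _ => hap _ _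
  have hY0 : ∀ i t, 0 ≤ Y i t := fun i t => sobolevPow_nonneg s hN0.le _ _
  -- The starting coordinates of bonds inside the box; t = ρ is excluded since t + 1 would leave it.
  -- These are exactly the t with `rad t < ρ`.
  set S : Finset ℤ := Finset.Ico (-(ρ : ℤ)) ρ with hS
  set 𝒜 : ℕ → ℝ := fun r => ∑ i, ∑ t ∈ S with rad t = r, α i t with h𝒜
  set ℬ : ℕ → ℝ := fun r => ∑ i, ∑ t ∈ S with rad t = r, (Y i t + Y i (t + 1)) with hℬ
  have h𝒜0 : ∀ r, 0 ≤ 𝒜 r := fun r =>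
    Finset.sum_nonneg fun i _ => Finset.sum_nonneg fun t _ => hα0 i t
  have hℬ0 : ∀ r, 0 ≤ ℬ r := fun r =>
    Finset.sum_nonneg fun i _ => Finset.sum_nonneg fun t _ => add_nonneg (hY0 _ _) (hY0 _ _)
  have hSsub : S ⊆ Finset.Icc (-(ρ : ℤ)) ρ := fun t ht => by
    rw [hS, Finset.mem_Ico] at ht
    rw [Finset.mem_Icc]
    omega
  have h𝒜sum : ∑ r ∈ Finset.Ico σ ρ, 𝒜 r ≤ (N : ℝ) ^ (D + 1) * A ^ p := by
    rw [h𝒜, Finset.sum_comm]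
    rw [moment, inv_mul_le_iff₀ (by positivity)] at hmA
    refine le_trans (Finset.sum_le_sum fun i _ => ?_) hmA
    refine (sum_fiber_rad_le (α i) (hα0 i)).trans ?_
    refine (Finset.sum_le_sum_of_subset_of_nonneg hSsub fun t _ _ => hα0 i t).trans ?_
    rw [hα, ← sum_box_succ i ρ (fun x => a i x ^ p)]
    exact Finset.sum_le_sum_of_subset_of_nonneg (box_mono (by omega)) fun x _ _ => hap i x
  -- The factor 2 counts each slice as left and as right end of a bond, and D+1 counts the
  -- directions.
  have hℬsum : ∑ r ∈ Finset.Ico σ ρ, ℬ r ≤ 2 * (D + 1) * N * G := by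
    rw [hℬ, Finset.sum_comm]
    have h1 : ∀ i ∈ (Finset.univ : Finset (Fin (D + 1))),
        ∑ r ∈ Finset.Ico σ ρ, ∑ t ∈ S with rad t = r, (Y i t + Y i (t + 1)) ≤ 2 * (N * G) := by
      intro i _
      have h2 := sum_sobolevPow_slice_le (s := s) hN0 i ρ f
      refine (sum_fiber_rad_le (fun t => Y i t + Y i (t + 1))
        (fun t => add_nonneg (hY0 _ _) (hY0 _ _))).trans ?_
      rw [Finset.sum_add_distrib]
      have h3 : ∑ t ∈ S, Y i t ≤ N * G :=
        (Finset.sum_le_sum_of_subset_of_nonneg hSsub fun t _ _ => hY0 i t).trans h2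
      have h4 : ∑ t ∈ S, Y i (t + 1) ≤ N * G := by
        refine le_trans (le_of_eq (Finset.sum_image (g := fun t : ℤ => t + 1) (f := Y i)
          fun x _ y _ h => by simpa using h).symm) ?_
        refine (Finset.sum_le_sum_of_subset_of_nonneg ?_ fun t _ _ => hY0 i t).trans h2
        intro t ht
        obtain ⟨r, hr, rfl⟩ := Finset.mem_image.1 ht
        rw [hS, Finset.mem_Ico] at hr
        rw [Finset.mem_Icc]
        omega
      linarith
    refine (Finset.sum_le_sum h1).trans (le_of_eq ?_)
    rw [Finset.sum_const, nsmul_eq_mul, Finset.card_univ, Fintype.card_fin]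
    push_cast
    ring
  obtain ⟨h, h0, h1, hin, hout, hlip, hgood⟩ := exists_profile hσρ h𝒜0 hℬ0 h𝒜sum hℬsum
  set Φ : ℝ := C * (4 * X * A ^ p) ^ (1 / p) * κ ^ (-(2 * (χ - 1))) *
    (8 * (D + 1) * X * G) ^ (2 * χ / s) with hΦ
  have hΦ0 : 0 ≤ Φ := by positivity
  have hΦle : ∀ i, ∀ t : ℤ, h (rad t + 1) ≠ h (rad t) → ((N : ℝ) ^ D)⁻¹ *
      ∑ y ∈ box D ρ, a i (ins i t y) * (w (ins i t y) * w (ins i (t + 1) y)) ≤ Φ := by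
    intro i t hh
    obtain ⟨hr, hA1, hB1⟩ := hgood _ hh
    have htS : t ∈ S := by
      rw [Finset.mem_Ico, rad] at hr
      rw [hS, Finset.mem_Ico]
      omega
    have hα1 : α i t ≤ 𝒜 (rad t) := by
      refine le_trans ?_ (Finset.single_le_sum (f := fun i => ∑ t' ∈ S with rad t' = rad t, α i t')
        (fun i _ => Finset.sum_nonneg fun t _ => hα0 i t) (Finset.mem_univ i))
      exact Finset.single_le_sum (f := fun t' => α i t') (fun t _ => hα0 i t)
        (Finset.mem_filter.2 ⟨htS, rfl⟩)
    have hY1 : Y i t + Y i (t + 1) ≤ ℬ (rad t) := by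
      refine le_trans ?_ (Finset.single_le_sum (f := fun i => ∑ t' ∈ S with rad t' = rad t,
        (Y i t' + Y i (t' + 1)))
        (fun i _ => Finset.sum_nonneg fun t _ => add_nonneg (hY0 _ _) (hY0 _ _))
        (Finset.mem_univ i))
      exact Finset.single_le_sum (f := fun t' => Y i t' + Y i (t' + 1))
        (fun t _ => add_nonneg (hY0 _ _) (hY0 _ _)) (Finset.mem_filter.2 ⟨htS, rfl⟩)
    have hY2 : Y i t + Y i (t + 1) ≤ 8 * (D + 1) * X * G := by
      refine hY1.trans ?_
      rw [← le_div_iff₀ hT] at hB1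
      refine hB1.trans (le_of_eq ?_)
      rw [hX]
      ring
    refine hslice N ρ hN0 ?_ (fun y => a i (ins i t y)) (fun y => w (ins i t y))
      (fun y => w (ins i (t + 1) y)) (fun y => f (ins i t y)) (fun y => f (ins i (t + 1) y))
      (fun _ => (ha _ _).le) (fun _ => hw0 _) (fun _ => hw0 _) (fun _ => hf0 _) (fun _ => hf0 _)
      κ hκ (fun _ => hwf _) (fun _ => hwf _) (fun _ => hwκ _) (fun _ => hwκ _) _ _ ?_
      (le_trans (le_add_of_nonneg_right (hY0 _ _)) hY2)
      (le_trans (le_add_of_nonneg_left (hY0 _ _)) hY2)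
    · have : N ≤ ρ := by omega
      exact_mod_cast this
    · rw [inv_mul_le_iff₀ (by positivity)]
      refine hα1.trans ?_
      rw [← le_div_iff₀ hT] at hA1
      refine hA1.trans (le_of_eq ?_)
      rw [hX, pow_succ]
      ring
  have hlapw : ∀ x ∈ box (D + 1) ((ρ : ℤ) - 1), w x ≠ 0 → 0 ≤ lap a w x := fun x hx hwx =>
    lap_max_sub_nonneg (fun i x => (ha i x).le) hwx (hv x (box_mono (by omega) hx))
  have hE := energy_cutoff_le hN (fun i x => (ha i x).le) hσρ hρ hw0 hlapw h0 h1 hout hlip hΦ0 hΦle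
  have hfin := sobolevPow_le_energy (by omega) hs hs2 hN ha hB hmB hσρ.le hρ (w := w)
    (η := cutoff (D + 1) h) (fun x hx => cutoff_eq_one hin hx)
    (fun x hx => mem_box_of_cutoff_ne_zero hout hx)
  have hE0 : 0 ≤ ((N : ℝ) ^ (D + 1))⁻¹ * ((N : ℝ) ^ 2 * ∑ i, ∑ x ∈ box (D + 1) ρ,
      a i x * fdiff i (fun x => cutoff (D + 1) h x * w x) x ^ 2) :=
    mul_nonneg (by positivity) (mul_nonneg (by positivity) (Finset.sum_nonneg fun i _ =>
      Finset.sum_nonneg fun x _ => mul_nonneg (ha i x).le (sq_nonneg _)))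
  have hid : 20 * (D + 1) * X ^ 2 * Φ =
      (20 * (D + 1) * C * 4 ^ (1 / p) * (8 * (D + 1)) ^ (2 * χ / s)) * A *
        X ^ (2 + 1 / p + 2 * χ / s) * κ ^ (-(2 * (χ - 1))) * G ^ (2 * χ / s) := by
    have e1 : (4 * X * A ^ p) ^ (1 / p) = 4 ^ (1 / p) * X ^ (1 / p) * A := by
      rw [Real.mul_rpow (by positivity) (by positivity), Real.mul_rpow (by norm_num) hX0.le,
        ← Real.rpow_mul hA, mul_one_div_cancel hp0.ne', Real.rpow_one]
    have e2 : (8 * (D + 1) * X * G : ℝ) ^ (2 * χ / s) =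
        (8 * (D + 1)) ^ (2 * χ / s) * X ^ (2 * χ / s) * G ^ (2 * χ / s) := by
      rw [Real.mul_rpow (by positivity) hG0, Real.mul_rpow (by positivity) hX0.le]
    rw [hΦ, e1, e2, Real.rpow_add hX0, Real.rpow_add hX0, Real.rpow_two]
    ring
  calc _ ≤ _ := hfin
    _ ≤ (1 + 5 ^ s) * ((20 * (D + 1) * C * 4 ^ (1 / p) * (8 * (D + 1)) ^ (2 * χ / s)) * A *
        X ^ (2 + 1 / p + 2 * χ / s) * κ ^ (-(2 * (χ - 1))) * G ^ (2 * χ / s)) ^ (s / 2) *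
        B ^ (s / 2) := by
        rw [← hid]
        gcongr
    _ = _ := by
      rw [Real.mul_rpow (by positivity) (by positivity),
        Real.mul_rpow (y := κ ^ (-(2 * (χ - 1)))) (by positivity) (by positivity),
        Real.mul_rpow (y := X ^ (2 + 1 / p + 2 * χ / s)) (by positivity) (by positivity),
        Real.mul_rpow (y := A) (by positivity) hA, ← Real.rpow_mul hX0.le, ← Real.rpow_mul hκ.le,
        ← Real.rpow_mul hG0, Real.mul_rpow hA hB]
      have e3 : 2 * χ / s * (s / 2) = χ := by field_simp
      have e4 : -(2 * (χ - 1)) * (s / 2) = -(s * (χ - 1)) := by ring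
      rw [e3, e4]
      ring

/-! ### De Giorgi iteration and the bound for d ≥ 3 -/

/-- The tangent-line inequality log y ≤ y - 1 at y = u(y)/u(x), summed with the conductances as
weights. -/
theorem lap_neg_log_nonneg {d : ℕ} {a : Fin d → (Fin d → ℤ) → ℝ} (ha : ∀ i x, 0 ≤ a i x)
    {u : (Fin d → ℤ) → ℝ} {x : Fin d → ℤ} (hx : 0 < u x)
    (hadd : ∀ i, 0 < u (x + Pi.single i 1)) (hsub : ∀ i, 0 < u (x - Pi.single i 1))
    (hu : lap a u x = 0) : 0 ≤ lap a (fun x => -Real.log (2 * u x)) x := by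
  have key : ∀ y : Fin d → ℤ, 0 < u y →
      -((u x)⁻¹ * (u y - u x)) ≤ -Real.log (2 * u y) - -Real.log (2 * u x) := by
    intro y hy
    have h1 := Real.log_le_sub_one_of_pos (div_pos hy hx)
    rw [Real.log_div hy.ne' hx.ne'] at h1
    rw [Real.log_mul two_ne_zero hy.ne', Real.log_mul two_ne_zero hx.ne']
    have h2 : (u x)⁻¹ * (u y - u x) = u y / u x - 1 := by
      field_simp
    linarith
  have h1 : -((u x)⁻¹ * lap a u x) ≤ lap a (fun x => -Real.log (2 * u x)) x := by
    rw [lap, lap, Finset.mul_sum, ← Finset.sum_neg_distrib]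
    refine Finset.sum_le_sum fun i _ => ?_
    have e1 := mul_le_mul_of_nonneg_left (key _ (hadd i)) (ha i x)
    have e2 := mul_le_mul_of_nonneg_left (key _ (hsub i)) (ha i (x - Pi.single i 1))
    linarith
  rwa [hu, mul_zero, neg_zero] at h1

/-- Geometric decay reproduces itself: 2^(j(b+γ)) is absorbed by 2^(-mj(χ-1)), and the powers of Θ
combine as Θ · Θ^(-χ) · Θ^χ = Θ, which dictates the factor Θ^(χ/γ) in the height of the levels. Any
prescribed rate m is available if it is large enough. -/
theorem exists_iteration {C C₀ b γ χ : ℝ} (hC : 0 ≤ C) (hC₀ : 0 < C₀)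
    (hγ : 0 < γ) (hχ : 1 < χ) {m : ℕ} (hm : b + γ ≤ m * (χ - 1)) :
    ∃ K : ℝ, 0 < K ∧ ∀ Θ : ℝ, 1 ≤ Θ → ∀ (J : ℕ) (y : ℕ → ℝ), (∀ j, 0 ≤ y j) → y 0 ≤ C₀ * Θ →
      (∀ j < J, y (j + 1) ≤ C * Θ * ((2 : ℝ) ^ (j + 2)) ^ b *
        (K * Θ ^ (χ / γ) * ((2 : ℝ) ^ (j + 1))⁻¹) ^ (-γ) * y j ^ χ) →
      ∀ j ≤ J, y j ≤ C₀ * Θ * ((2 : ℝ) ^ (m * j))⁻¹ := by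
  -- The constant that makes the induction step close; K^γ = M. Using C + 1 keeps it positive.
  set M : ℝ := (C + 1) * 2 ^ (2 * b + γ + m) * C₀ ^ (χ - 1) with hM
  have hM0 : 0 < M := by positivity
  refine ⟨M ^ (1 / γ), by positivity, fun Θ hΘ J y hy h0 hstep j => ?_⟩
  have hΘ0 : 0 < Θ := by linarith
  induction j with
  | zero =>
    intro _
    simpa using h0
  | succ j ih =>
    intro hj
    have ihj := ih (by omega)
    refine (hstep j (by omega)).trans ?_
    have e1 : ((2 : ℝ) ^ (j + 2)) ^ b = 2 ^ ((j + 2) * b) := by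
      rw [← Real.rpow_natCast, ← Real.rpow_mul (by norm_num)]
      push_cast
      rfl
    have e2 : (M ^ (1 / γ) * Θ ^ (χ / γ) * ((2 : ℝ) ^ (j + 1))⁻¹) ^ (-γ) =
        M⁻¹ * Θ ^ (-χ) * 2 ^ ((j + 1) * γ) := by
      rw [Real.mul_rpow (by positivity) (by positivity), Real.mul_rpow (by positivity)
        (by positivity), ← Real.rpow_mul hM0.le, ← Real.rpow_mul hΘ0.le, ← Real.rpow_natCast,
        ← Real.rpow_neg (by norm_num), ← Real.rpow_mul (by norm_num)]
      have e3 : 1 / γ * -γ = -1 := by field_simp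
      have e4 : χ / γ * -γ = -χ := by field_simp
      rw [e3, e4, Real.rpow_neg_one]
      congr 2
      push_cast
      ring
    have e3 : y j ^ χ ≤ C₀ ^ χ * Θ ^ χ * 2 ^ (-(m * j * χ)) := by
      refine (Real.rpow_le_rpow (hy j) ihj (by linarith)).trans (le_of_eq ?_)
      rw [Real.mul_rpow (by positivity) (by positivity), Real.mul_rpow hC₀.le hΘ0.le,
        ← Real.rpow_natCast, ← Real.rpow_neg (by norm_num), ← Real.rpow_mul (by norm_num)]
      congr 2
      push_cast
      ring
    have e4 : C₀ ^ χ = C₀ * C₀ ^ (χ - 1) := by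
      nth_rewrite 2 [← Real.rpow_one C₀]
      rw [← Real.rpow_add hC₀]
      ring_nf
    have e5 : Θ ^ (-χ) * Θ ^ χ = 1 := by
      rw [← Real.rpow_add hΘ0, neg_add_cancel, Real.rpow_zero]
    have e6 : (2 : ℝ) ^ ((j + 2) * b) * 2 ^ ((j + 1) * γ) * 2 ^ (-(m * j * χ)) ≤
        2 ^ (2 * b + γ + m) * ((2 : ℝ) ^ (m * (j + 1)))⁻¹ := by
      rw [← Real.rpow_natCast 2 (m * (j + 1)), ← Real.rpow_neg (by norm_num),
        ← Real.rpow_add (by norm_num), ← Real.rpow_add (by norm_num),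
        ← Real.rpow_add (by norm_num)]
      refine Real.rpow_le_rpow_of_exponent_le (by norm_num) ?_
      push_cast
      have := mul_le_mul_of_nonneg_left hm (Nat.cast_nonneg (α := ℝ) j)
      linarith
    rw [e1, e2]
    calc C * Θ * 2 ^ ((j + 2) * b) * (M⁻¹ * Θ ^ (-χ) * 2 ^ ((j + 1) * γ)) * y j ^ χ
        ≤ C * Θ * 2 ^ ((j + 2) * b) * (M⁻¹ * Θ ^ (-χ) * 2 ^ ((j + 1) * γ)) *
          (C₀ ^ χ * Θ ^ χ * 2 ^ (-(m * j * χ))) :=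
          mul_le_mul_of_nonneg_left e3 (by positivity)
      _ = C * Θ * M⁻¹ * (C₀ * C₀ ^ (χ - 1)) * (Θ ^ (-χ) * Θ ^ χ) *
          ((2 : ℝ) ^ ((j + 2) * b) * 2 ^ ((j + 1) * γ) * 2 ^ (-(m * j * χ))) := by
          rw [e4]
          ring
      _ ≤ (C + 1) * Θ * M⁻¹ * (C₀ * C₀ ^ (χ - 1)) * 1 *
          (2 ^ (2 * b + γ + m) * ((2 : ℝ) ^ (m * (j + 1)))⁻¹) := by
          rw [e5]
          gcongr
          linarith
      _ = _ := by
          rw [hM]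
          field_simp

theorem sobolevPow_mono {d : ℕ} {s N : ℝ} (hN : 0 ≤ N) {R S : ℤ} (hRS : R ≤ S)
    (f : (Fin d → ℤ) → ℝ) : sobolevPow s N R f ≤ sobolevPow s N S f := by
  have h1 : ∑ x ∈ box d R, |f x| ^ s ≤ ∑ x ∈ box d S, |f x| ^ s :=
    Finset.sum_le_sum_of_subset_of_nonneg (box_mono hRS) fun _ _ _ => by positivity
  have h2 : ∀ i, dirPow s i R f ≤ dirPow s i S f := by
    intro i
    refine le_trans (Finset.sum_le_sum fun x _ => ?_)
      (Finset.sum_le_sum_of_subset_of_nonneg (box_mono hRS) fun x _ _ => by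
        split_ifs <;> positivity)
    split_ifs
    · exact le_rfl
    · omega
    · positivity
    · exact le_rfl
  rw [sobolevPow, sobolevPow]
  gcongr with i _
  exact h2 i

/-- The interior lower bound for positive solutions that exceed `1 / 2` on half of a box, in terms
of the moments of order `p` of the conductances and of order `q` of their inverses. -/
def LogBound (d : ℕ) (p q : ℝ) : Prop :=
  ∃ C e : ℝ, 0 ≤ C ∧ 0 ≤ e ∧ ∀ (N : ℕ), 1 ≤ N → ∀ a : Fin d → (Fin d → ℤ) → ℝ,
    (∀ i x, 0 < a i x) → ∀ A B : ℝ, 0 ≤ A → 0 ≤ B → 1 ≤ A * B → moment N p a ≤ A ^ p →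
    moment N q (fun i x => (a i x)⁻¹) ≤ B ^ q →
    ∀ u : (Fin d → ℤ) → ℝ, (∀ x ∈ box d (3 * N + 1), 0 < u x) →
    (∀ x ∈ box d (3 * N - 1), lap a u x = 0) →
    (box d (2 * N)).card ≤ 2 * ((box d (2 * N)).filter fun x => 1 / 2 ≤ u x).card →
    ∀ x ∈ box d N, -Real.log (2 * u x) ≤ C * (A * B) ^ e

theorem lap_neg_log_nonneg_on_box {d N : ℕ} (hN : 1 ≤ N) {a : Fin d → (Fin d → ℤ) → ℝ}
    (ha : ∀ i x, 0 < a i x) {u : (Fin d → ℤ) → ℝ} (hu : ∀ x ∈ box d (3 * N + 1), 0 < u x)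
    (hsol : ∀ x ∈ box d (3 * N - 1), lap a u x = 0) :
    ∀ x ∈ box d (2 * N), 0 ≤ lap a (fun x => -Real.log (2 * u x)) x := fun x hx =>
  lap_neg_log_nonneg (fun i x => (ha i x).le) (hu x (box_mono (by omega) hx))
    (fun i => hu _ (box_mono (by omega) (add_single_mem_box hx i)))
    (fun i => hu _ (sub_single_mem_box (box_mono (by omega) hx) i))
    (hsol x (box_mono (by omega) hx))

/-- The radii shrink dyadically from at most 2N to N + 1 while the levels rise to κ. Lattice radii
allow only about log₂ N steps, so the limit of vanishing norm is not available; the decay is instead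
made fast enough for a single term of the last sum to be bounded. -/
theorem logBound_of_two_le {D : ℕ} (hD : 2 ≤ D) {p s t : ℝ} (hp : 1 < p) (ht : 2 < t)
    (hst : 1 / s = 1 / t + 1 / D) (hs : 1 ≤ s) (hs2 : s < 2) (hχ : 1 < t * (1 - 1 / p) / 2) :
    LogBound (D + 1) p (s / (2 - s)) := by
  set χ : ℝ := t * (1 - 1 / p) / 2 with hχdef
  obtain ⟨C, b, hC, hb, hstep⟩ := exists_deGiorgi_step hD hp ht hst hs hs2 hχdef hχ
  obtain ⟨C₁, hC₁, hstart⟩ := exists_log_sobolevPow_le (d := D + 1) (by omega) hp.le hs hs2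
  have hs0 : 0 < s := by linarith
  set γ : ℝ := s * (χ - 1) with hγdef
  have hγ : 0 < γ := mul_pos hs0 (by linarith)
  obtain ⟨m₀, hm₀⟩ := exists_nat_ge ((b + γ) / (χ - 1))
  -- The rate must close the iteration and also beat the volume N^(D+1) at the end.
  set m := max m₀ (D + 1) with hm
  have hm1 : b + γ ≤ m * (χ - 1) := by
    rw [div_le_iff₀ (by linarith)] at hm₀
    refine hm₀.trans (mul_le_mul_of_nonneg_right ?_ (by linarith))
    exact_mod_cast le_max_left _ _
  set C₀ := C₁ + 1 with hC₀
  have hC₀0 : 0 < C₀ := by linarith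
  obtain ⟨K, hK, hiter⟩ := exists_iteration hC hC₀0 hγ hχ hm1
  refine ⟨K + (2 ^ (D + 1) * C₀) ^ (1 / s), s / 2 * (χ / γ + 1 / s), by positivity,
    by positivity, fun N hN a ha A B hA hB hAB hmA hmB u hu hsol hhalf => ?_⟩
  have hN1 : (1 : ℝ) ≤ N := by exact_mod_cast hN
  set Θ : ℝ := (A * B) ^ (s / 2) with hΘ
  have hΘ1 : 1 ≤ Θ := Real.one_le_rpow hAB (by linarith)
  have hΘ0 : 0 < Θ := by linarith
  set v : (Fin (D + 1) → ℤ) → ℝ := fun x => -Real.log (2 * u x) with hv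
  have hvsub : ∀ x ∈ box (D + 1) (2 * N), 0 ≤ lap a v x :=
    lap_neg_log_nonneg_on_box hN ha hu hsol
  set J := Nat.log 2 N with hJ
  have hJ1 : 2 ^ J ≤ N := Nat.pow_log_le_self 2 (by omega)
  have hJ2 : N < 2 ^ (J + 1) := Nat.lt_pow_succ_log_self (by norm_num) N
  have hJ2' : (N : ℝ) ≤ 2 ^ (J + 1) := by exact_mod_cast hJ2.le
  set κ : ℝ := K * Θ ^ (χ / γ) with hκ
  have hκ0 : 0 < κ := by positivity
  set y : ℕ → ℝ := fun j => sobolevPow s N ((N + 2 ^ (J - j) : ℕ) : ℤ)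
    (fun x => max (v x - κ * (1 - ((2 : ℝ) ^ j)⁻¹)) 0) with hy
  have hmain := hiter Θ hΘ1 J y (fun j => sobolevPow_nonneg s (by positivity) _ _) (by
    have h1 := hstart N hN a ha A B hA hB hmA hmB u hu hsol hhalf
    simp only [hy, pow_zero, inv_one, sub_self, mul_zero, sub_zero]
    refine (sobolevPow_mono (by positivity) ?_ _).trans (h1.trans ?_)
    · have : N + 2 ^ J ≤ 2 * N := by omega
      rw [Nat.sub_zero]
      exact_mod_cast this
    · gcongr
      linarith) (by
    intro j hj
    have hpow : 2 ^ (J - j) = 2 * 2 ^ (J - (j + 1)) := by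
      rw [← pow_succ']
      congr 1
      omega
    have hpow1 : 2 ^ (J - j) ≤ 2 ^ J := Nat.pow_le_pow_right (by norm_num) (by omega)
    have hpos : 0 < 2 ^ (J - (j + 1)) := by positivity
    have h1 := hstep N hN a ha A B hA hB hmA hmB v hvsub (N + 2 ^ (J - (j + 1)))
      (N + 2 ^ (J - j)) (by omega) (by omega) (by omega) (κ * (1 - ((2 : ℝ) ^ j)⁻¹))
      (κ * ((2 : ℝ) ^ (j + 1))⁻¹) (by positivity)
    have e1 : κ * (1 - ((2 : ℝ) ^ j)⁻¹) + κ * ((2 : ℝ) ^ (j + 1))⁻¹ =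
        κ * (1 - ((2 : ℝ) ^ (j + 1))⁻¹) := by
      rw [pow_succ]
      field_simp
      ring
    rw [e1] at h1
    refine h1.trans ?_
    have hy0 : 0 ≤ y j := sobolevPow_nonneg s (by positivity) _ _
    refine mul_le_mul_of_nonneg_right (mul_le_mul_of_nonneg_right (mul_le_mul_of_nonneg_left
      (Real.rpow_le_rpow ?_ ?_ hb) (by positivity)) (by positivity)) (Real.rpow_nonneg hy0 _)
    · refine div_nonneg (by positivity) ?_
      rw [hpow]
      push_cast
      have : (0 : ℝ) < 2 ^ (J - (j + 1)) := by positivity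
      linarith
    -- The gap between consecutive radii is 2^(J-j-1) and N ≤ 2^(J+1), hence the ratio is at most
    -- 2^(j+2).
    · have e2 : (((N + 2 ^ (J - j) : ℕ) : ℝ) - (N + 2 ^ (J - (j + 1)) : ℕ)) =
          2 ^ (J - (j + 1)) := by
        rw [hpow]
        push_cast
        ring
      rw [e2, div_le_iff₀ (by positivity), ← pow_add]
      refine hJ2'.trans (le_of_eq ?_)
      congr 1
      omega)
  have hend := hmain J le_rfl
  intro x hx
  have hpt : max (v x - κ * (1 - ((2 : ℝ) ^ J)⁻¹)) 0 ^ s ≤ 2 ^ (D + 1) * C₀ * Θ := by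
    have h1 : max (v x - κ * (1 - ((2 : ℝ) ^ J)⁻¹)) 0 ^ s ≤ (N : ℝ) ^ (D + 1) * y J := by
      simp only [hy, sobolevPow]
      rw [mul_inv_cancel_left₀ (by positivity)]
      have h2 : 0 ≤ ∑ i, dirPow s i ((N + 2 ^ (J - J) : ℕ) : ℤ)
          (fun x => max (v x - κ * (1 - ((2 : ℝ) ^ J)⁻¹)) 0) :=
        Finset.sum_nonneg fun i _ => dirPow_nonneg _ _ _ _
      refine le_trans ?_ (le_add_of_nonneg_right (by positivity))
      have h3 := Finset.single_le_sum (f := fun x =>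
        |max (v x - κ * (1 - ((2 : ℝ) ^ J)⁻¹)) 0| ^ s) (fun _ _ => by positivity)
        (box_mono (d := D + 1) (R := N) (S := ((N + 2 ^ (J - J) : ℕ) : ℤ)) (by push_cast; simp) hx)
      rwa [abs_of_nonneg (le_max_right _ _)] at h3
    -- Since N^(D+1) ≤ 2^((J+1)(D+1)), only the factor 2^(D+1) survives.
    have h4 : ((2 : ℝ) ^ (m * J))⁻¹ ≤ ((2 : ℝ) ^ ((D + 1) * J))⁻¹ := by
      refine inv_anti₀ (by positivity) (pow_le_pow_right₀ (by norm_num) ?_)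
      exact Nat.mul_le_mul_right _ (le_max_right _ _)
    calc _ ≤ (N : ℝ) ^ (D + 1) * y J := h1
      _ ≤ (2 ^ (J + 1)) ^ (D + 1) * (C₀ * Θ * ((2 : ℝ) ^ ((D + 1) * J))⁻¹) := by
        have hy0 : 0 ≤ y J := sobolevPow_nonneg s (by positivity) _ _
        refine mul_le_mul (pow_le_pow_left₀ (by positivity) hJ2' _) (hend.trans ?_) hy0
          (by positivity)
        gcongr
      _ = _ := by
        rw [← pow_mul, show (J + 1) * (D + 1) = (D + 1) * J + (D + 1) by ring, pow_add]
        field_simp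
  have hroot : max (v x - κ * (1 - ((2 : ℝ) ^ J)⁻¹)) 0 ≤
      (2 ^ (D + 1) * C₀) ^ (1 / s) * Θ ^ (1 / s) := by
    have := Real.rpow_le_rpow (Real.rpow_nonneg (le_max_right _ _) _) hpt (z := 1 / s)
      (by positivity)
    rwa [← Real.rpow_mul (le_max_right _ _), mul_one_div_cancel hs0.ne', Real.rpow_one,
      Real.mul_rpow (by positivity) hΘ0.le] at this
  have hvx : v x ≤ κ + (2 ^ (D + 1) * C₀) ^ (1 / s) * Θ ^ (1 / s) := by
    have h1 := (le_max_left _ _).trans hroot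
    have h2 : 0 ≤ κ * ((2 : ℝ) ^ J)⁻¹ := by positivity
    linarith
  have hexp : (A * B) ^ (s / 2 * (χ / γ + 1 / s)) = Θ ^ (χ / γ + 1 / s) := by
    rw [hΘ, ← Real.rpow_mul (by linarith)]
  rw [hexp]
  have h1 : Θ ^ (χ / γ) ≤ Θ ^ (χ / γ + 1 / s) :=
    Real.rpow_le_rpow_of_exponent_le hΘ1 (le_add_of_nonneg_right (by positivity))
  have h2 : Θ ^ (1 / s) ≤ Θ ^ (χ / γ + 1 / s) :=
    Real.rpow_le_rpow_of_exponent_le hΘ1 (le_add_of_nonneg_left (by positivity))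
  calc v x ≤ K * Θ ^ (χ / γ) + (2 ^ (D + 1) * C₀) ^ (1 / s) * Θ ^ (1 / s) := hvx
    _ ≤ K * Θ ^ (χ / γ + 1 / s) + (2 ^ (D + 1) * C₀) ^ (1 / s) * Θ ^ (χ / γ + 1 / s) := by gcongr
    _ = _ := by ring

/-! ### The maximum principle and the bound for d = 2 -/

/-- The Caccioppoli inequality with the indicator of the box as cutoff: its error lives on bonds
leaving the box, whose inner endpoint is a boundary point where w = 0. Hence the cut-off function
has zero gradient and vanishes. -/
theorem maximum_principle {d : ℕ} (hd : 1 ≤ d) {a : Fin d → (Fin d → ℤ) → ℝ}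
    (ha : ∀ i x, 0 < a i x) {w : (Fin d → ℤ) → ℝ} (hw : ∀ x, 0 ≤ w x) {r : ℤ} (hr : 0 ≤ r)
    (hsub : ∀ x ∈ box d r, w x ≠ 0 → 0 ≤ lap a w x)
    (hbdry : ∀ x ∈ box d r, ∀ i, |x i| = r → w x = 0) : ∀ x ∈ box d r, w x = 0 := by
  classical
  set η : (Fin d → ℤ) → ℝ := fun x => if x ∈ box d r then 1 else 0 with hη
  have hηmem : ∀ x, η x ≠ 0 → x ∈ box d r := fun x hx => by
    by_contra h
    exact hx (if_neg h)
  have hcac := caccioppoli a w η (r + 1) (fun x hx => by simpa using hηmem x hx) hw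
    fun x hx => hsub x (hηmem x hx)
  have hzero : ∀ i, ∀ x, w x * w (x + Pi.single i 1) * fdiff i η x ^ 2 = 0 := by
    intro i x
    by_cases h1 : x ∈ box d r <;> by_cases h2 : x + Pi.single i 1 ∈ box d r
    · simp [fdiff, hη, h1, h2]
    · have h3 : x i = r := by
        have h4 := (mem_box.1 h1 i).2
        rcases h4.eq_or_lt with h5 | h5
        · exact h5
        · exact absurd (mem_box_add_single h1 h5) h2
      rw [hbdry x h1 i (by rw [h3, abs_of_nonneg hr])]
      simp
    · have h3 : x i + 1 = -r := by
        by_contra h4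
        refine h1 (mem_box.2 fun j => ?_)
        have h5 := mem_box.1 h2 j
        by_cases hj : j = i
        · subst hj
          simp only [Pi.add_apply, Pi.single_eq_same] at h5
          omega
        · simpa [hj] using h5
      rw [hbdry _ h2 i (by simp [h3, abs_of_nonneg hr])]
      simp
    · simp [fdiff, hη, h1, h2]
  simp only [hzero, mul_zero, Finset.sum_const_zero] at hcac
  have hnn : ∀ i, ∀ x, 0 ≤ a i x * fdiff i (fun x => η x * w x) x ^ 2 := fun i x =>
    mul_nonneg (ha i x).le (sq_nonneg _)
  have hgrad : ∀ i, ∀ x ∈ box d (r + 1), fdiff i (fun x => η x * w x) x = 0 := by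
    intro i x hx
    have h1 := (Finset.single_le_sum (f := fun x => a i x * fdiff i (fun x => η x * w x) x ^ 2)
      (fun x _ => hnn i x) hx).trans ((Finset.single_le_sum (f := fun i =>
        ∑ x ∈ box d (r + 1), a i x * fdiff i (fun x => η x * w x) x ^ 2)
        (fun i _ => Finset.sum_nonneg fun x _ => hnn i x) (Finset.mem_univ i)).trans hcac)
    have h2 := le_antisymm h1 (hnn i x)
    rcases mul_eq_zero.1 h2 with h3 | h3
    · exact absurd h3 (ha i x).ne'
    · exact pow_eq_zero_iff two_ne_zero |>.1 h3
  have hsum := sum_rpow_le_dirPow_of_zero le_rfl ⟨0, hd⟩ (R := r + 1) (by omega)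
    (fun x => η x * w x) (by
      intro x hx
      have : x ∉ box d r := fun h => by
        have := (mem_box.1 h ⟨0, hd⟩).1
        omega
      simp [hη, this])
  have hdir : dirPow 1 ⟨0, hd⟩ (r + 1) (fun x => η x * w x) = 0 := by
    refine Finset.sum_eq_zero fun x hx => ?_
    rw [hgrad _ x hx]
    simp
  rw [hdir, mul_zero] at hsum
  intro x hx
  have h1 := (Finset.single_le_sum (f := fun x => |η x * w x| ^ (1 : ℝ))
    (fun _ _ => by positivity) (box_mono (by omega) hx)).trans hsum
  simp only [Real.rpow_one] at h1
  have h2 := abs_nonpos_iff.1 h1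
  simpa [hη, hx] using h2

/-- On a segment, a value is at most the mean of |g| plus the total variation. -/
theorem abs_le_sobolevPow_one {N : ℝ} {R : ℤ} (hN : 0 < N) (hR : N ≤ R) (g : (Fin 1 → ℤ) → ℝ)
    {y : Fin 1 → ℤ} (hy : y ∈ box 1 R) : |g y| ≤ sobolevPow 1 N R g := by
  have hR0 : 0 ≤ R := by
    have : (0 : ℝ) ≤ R := by linarith
    exact_mod_cast this
  have hL : (0 : ℝ) < 2 * R + 1 := by linarith
  have hupd : ∀ z : Fin 1 → ℤ, Function.update y 0 (z 0) = z := fun z => by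
    funext j
    rw [Subsingleton.elim j 0]
    simp
  have hvar : lineVar 0 R g y = dirPow 1 0 R g := by
    have h1 := sum_box_succ (D := 0) 0 R (fun x => if x 0 < R then |fdiff 0 g x| ^ (1 : ℝ) else 0)
    rw [dirPow, h1, lineVar]
    refine Finset.sum_congr rfl fun t _ => ?_
    have h2 : box 0 R = {default} := by
      ext z
      simp [mem_box, Subsingleton.elim z default]
    rw [h2, Finset.sum_singleton, ins_same, Real.rpow_one,
      ← hupd (ins 0 t default), ins_same]
  have h1 : ∀ z ∈ box 1 R, |g y| ≤ |g z| + dirPow 1 0 R g := by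
    intro z hz
    have h2 := abs_sub_update_le_lineVar 0 g hy (Finset.mem_Icc.2 (mem_box.1 hz 0))
    rw [hupd, hvar] at h2
    have h3 := abs_sub_abs_le_abs_sub (g y) (g z)
    linarith
  have h2 := Finset.sum_le_sum h1
  rw [Finset.sum_const, nsmul_eq_mul, card_box 1 hR0, pow_one, Finset.sum_add_distrib,
    Finset.sum_const, nsmul_eq_mul, card_box 1 hR0, pow_one] at h2
  have h3 : 0 ≤ ∑ x ∈ box 1 R, |g x| := Finset.sum_nonneg fun _ _ => abs_nonneg _
  have h4 : |g y| ≤ (∑ x ∈ box 1 R, |g x|) / N + dirPow 1 0 R g := by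
    have h5 : |g y| ≤ (∑ x ∈ box 1 R, |g x|) / (2 * R + 1) + dirPow 1 0 R g := by
      rw [← mul_le_mul_iff_right₀ hL]
      refine h2.trans_eq ?_
      field_simp
    refine h5.trans (add_le_add_left ?_ _)
    exact div_le_div_of_nonneg_left h3 hN (by linarith)
  refine h4.trans (le_of_eq ?_)
  simp only [sobolevPow, Real.rpow_one, pow_one, Finset.univ_unique,
    Fin.default_eq_zero, Finset.sum_singleton]
  field_simp

theorem logBound_two : LogBound 2 1 1 := by
  obtain ⟨C, hC, hstart⟩ := exists_log_sobolevPow_le (d := 2) (by norm_num) (p := 1) (s := 1)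
    le_rfl le_rfl (by norm_num)
  have hone : (1 : ℝ) / (2 - 1) = 1 := by norm_num
  rw [hone] at hstart
  refine ⟨2 * C, 1 / 2, by positivity, by norm_num,
    fun N hN a ha A B hA hB hAB hmA hmB u hu hsol hhalf => ?_⟩
  have hN1 : (1 : ℝ) ≤ N := by exact_mod_cast hN
  have hN0 : (0 : ℝ) < N := by linarith
  set v : (Fin 2 → ℤ) → ℝ := fun x => -Real.log (2 * u x) with hv
  have hvsub : ∀ x ∈ box 2 (2 * N), 0 ≤ lap a v x := lap_neg_log_nonneg_on_box hN ha hu hsol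
  set f : (Fin 2 → ℤ) → ℝ := fun x => max (v x) 0 with hf
  set G : ℝ := sobolevPow 1 N (2 * N) f with hG
  have hG0 : 0 ≤ G := sobolevPow_nonneg _ hN0.le _ _
  have hGle : G ≤ C * (A * B) ^ (1 / 2 : ℝ) := hstart N hN a ha A B hA hB hmA hmB u hu hsol hhalf
  set Y : Fin 2 → ℤ → ℝ := fun i t => sobolevPow (d := 1) 1 N (2 * N) (fun y => f (ins i t y))
    with hY
  have hY0 : ∀ i t, 0 ≤ Y i t := fun i t => sobolevPow_nonneg _ hN0.le _ _
  set S : Finset ℤ := Finset.Icc (-(2 * N : ℤ)) (2 * N) with hS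
  have hsum : ∑ r ∈ Finset.Ico N (2 * N), ∑ i, ∑ t ∈ S with t.natAbs = r, Y i t ≤ N * (2 * G) := by
    rw [Finset.sum_comm]
    have h1 : ∀ i ∈ (Finset.univ : Finset (Fin 2)),
        ∑ r ∈ Finset.Ico N (2 * N), ∑ t ∈ S with t.natAbs = r, Y i t ≤ N * G := by
      intro i _
      refine le_trans ?_ (sum_sobolevPow_slice_le (s := 1) hN0 i (2 * N) f)
      rw [← Finset.sum_biUnion]
      · exact Finset.sum_le_sum_of_subset_of_nonneg
          (Finset.biUnion_subset.2 fun r _ => Finset.filter_subset _ _) fun t _ _ => hY0 i t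
      · intro r _ r' _ hrr
        refine Finset.disjoint_filter.2 fun t _ h1 h2 => hrr (h1.symm.trans h2)
    refine (Finset.sum_le_sum h1).trans (le_of_eq ?_)
    simp
    ring
  -- Pigeonhole over the N radii in [N, 2N): some square has Sobolev powers on its sides with sum at
  -- most 2G.
  obtain ⟨r, hr, hrle⟩ : ∃ r ∈ Finset.Ico N (2 * N),
      ∑ i, ∑ t ∈ S with t.natAbs = r, Y i t ≤ 2 * G := by
    refine Finset.exists_le_of_sum_le (Finset.nonempty_Ico.2 (by omega)) (hsum.trans_eq ?_)
    rw [Finset.sum_const, nsmul_eq_mul, Nat.card_Ico, Nat.cast_sub (by omega)]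
    push_cast
    ring
  rw [Finset.mem_Ico] at hr
  have hbdry : ∀ x ∈ box 2 (r : ℤ), ∀ i, |x i| = r → max (v x - 2 * G) 0 = 0 := by
    intro x hx i hxi
    have hxS : x i ∈ S.filter fun t => t.natAbs = r := by
      have := mem_box.1 hx i
      rw [Int.abs_eq_natAbs] at hxi
      rw [Finset.mem_filter, hS, Finset.mem_Icc]
      omega
    have h1 : Y i (x i) ≤ 2 * G := by
      refine le_trans ?_ hrle
      refine le_trans (Finset.single_le_sum (f := fun t => Y i t) (fun t _ => hY0 i t) hxS) ?_
      exact Finset.single_le_sum (f := fun i => ∑ t ∈ S with t.natAbs = r, Y i t)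
        (fun i _ => Finset.sum_nonneg fun t _ => hY0 i t) (Finset.mem_univ i)
    have hxins : ins i (x i) (fun j => x (i.succAbove j)) = x := by
      funext k
      induction k using Fin.succAboveCases i with
      | x => simp
      | p j => simp
    have hmem : (fun j => x (i.succAbove j)) ∈ box 1 (2 * N : ℤ) := by
      refine mem_box.2 fun j => ?_
      have := mem_box.1 hx (i.succAbove j)
      omega
    have h2 := abs_le_sobolevPow_one hN0 (R := 2 * N) (by push_cast; linarith)
      (fun y => f (ins i (x i) y)) hmem
    rw [hxins, abs_of_nonneg (le_max_right _ _)] at h2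
    have h3 := (le_max_left _ _).trans (h2.trans h1)
    exact max_eq_right (by linarith)
  have hmax := maximum_principle (d := 2) (by norm_num) ha (w := fun x => max (v x - 2 * G) 0)
    (fun x => le_max_right _ _) (Int.natCast_nonneg r)
    (fun x hx hwx => lap_max_sub_nonneg (fun i x => (ha i x).le) hwx
      (hvsub x (box_mono (by omega) hx))) hbdry
  intro x hx
  have h1 := hmax x (box_mono (by omega) hx)
  have h2 := le_max_left (v x - 2 * G) 0
  have h3 : v x ≤ 2 * G := by linarith
  exact h3.trans (by linarith)

/-! ### From bonds to conductances indexed by directions -/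

/-- The bond `{x, x + eᵢ}`. -/
def bond {d : ℕ} (x : Fin d → ℤ) (i : Fin d) : Bond d :=
  ⟨s(x, x + Pi.single i 1), by
    rw [SimpleGraph.mem_edgeSet]
    change ∑ j, (x j - (x + Pi.single i 1 : Fin d → ℤ) j) ^ 2 = 1
    simp [Pi.single_apply]⟩

theorem eq_add_or_sub_single_of_adj {d : ℕ} {x y : Fin d → ℤ} (h : (latticeGraph d).Adj x y) :
    ∃ i, y = x + Pi.single i 1 ∨ y = x - Pi.single i 1 := by
  have h1 : ∑ i, (x i - y i) ^ 2 = 1 := h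
  obtain ⟨i, hi⟩ : ∃ i, x i - y i ≠ 0 := by
    by_contra! h0
    simp [h0] at h1
  have h2 := Finset.add_sum_erase Finset.univ (fun i => (x i - y i) ^ 2) (Finset.mem_univ i)
  rw [h1] at h2
  have h3 : 0 ≤ ∑ j ∈ Finset.univ.erase i, (x j - y j) ^ 2 :=
    Finset.sum_nonneg fun j _ => sq_nonneg _
  have h4 : 0 < (x i - y i) ^ 2 := by positivity
  have h5 : (x i - y i) ^ 2 = 1 := by
    omega
  have h6 : ∑ j ∈ Finset.univ.erase i, (x j - y j) ^ 2 = 0 := by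
    omega
  have h7 : ∀ j, j ≠ i → x j - y j = 0 := fun j hj => by
    have := (Finset.sum_eq_zero_iff_of_nonneg fun j _ => sq_nonneg _).1 h6 j
      (Finset.mem_erase.2 ⟨hj, Finset.mem_univ j⟩)
    exact pow_eq_zero_iff two_ne_zero |>.1 this
  refine ⟨i, ?_⟩
  have h8 : (x i - y i - 1) * (x i - y i + 1) = 0 := by linear_combination h5
  rcases mul_eq_zero.1 h8 with h9 | h9
  · right
    funext j
    by_cases hj : j = i
    · subst hj
      simp only [Pi.sub_apply, Pi.single_eq_same]
      omega
    · have := h7 j hj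
      simp only [Pi.sub_apply, Pi.single_eq_of_ne hj]
      omega
  · left
    funext j
    by_cases hj : j = i
    · subst hj
      simp only [Pi.add_apply, Pi.single_eq_same]
      omega
    · have := h7 j hj
      simp only [Pi.add_apply, Pi.single_eq_of_ne hj]
      omega

theorem conductance_add_single {d : ℕ} (ω : Bond d → ℝ) (x : Fin d → ℤ) (i : Fin d) :
    conductance ω x (x + Pi.single i 1) = ω (bond x i) := by
  have h : s(x, x + Pi.single i 1) ∈ (latticeGraph d).edgeSet := (bond x i).2
  rw [conductance, dif_pos h]
  rfl

theorem conductance_sub_single {d : ℕ} (ω : Bond d → ℝ) (x : Fin d → ℤ) (i : Fin d) :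
    conductance ω x (x - Pi.single i 1) = ω (bond (x - Pi.single i 1) i) := by
  have h : s(x, x - Pi.single i 1) = (bond (x - Pi.single i 1) i).1 := by
    simp [bond, Sym2.eq_swap]
  rw [conductance, dif_pos (h ▸ (bond (x - Pi.single i 1) i).2)]
  congr 1
  exact Subtype.ext h

/-- The 2d points x ± eᵢ are distinct and are the only neighbours of x. -/
theorem generator_eq_lap {d : ℕ} (ω : Bond d → ℝ) (u : (Fin d → ℤ) → ℝ) (x : Fin d → ℤ) :
    generator ω u x = lap (fun i y => ω (bond y i)) u x := by
  classical
  set f : Fin d ⊕ Fin d → (Fin d → ℤ) :=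
    Sum.elim (fun i => x + Pi.single i 1) (fun i => x - Pi.single i 1) with hf
  have hinj : Function.Injective f := by
    rintro (i | i) (j | j) h
    · have h1 := congrFun h i
      by_cases hij : i = j
      · rw [hij]
      · simp [hf, hij] at h1
    · have h1 := congrFun h i
      simp [hf, Pi.single_apply] at h1
      split_ifs at h1 <;> omega
    · have h1 := congrFun h i
      simp [hf, Pi.single_apply] at h1
      split_ifs at h1 <;> omega
    · have h1 := congrFun h i
      by_cases hij : i = j
      · rw [hij]
      · simp [hf, hij] at h1
  rw [generator, finsum_eq_sum_of_support_subset (s := Finset.univ.image f)]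
  · rw [Finset.sum_image fun _ _ _ _ h => hinj h, Fintype.sum_sum_type, lap,
      ← Finset.sum_add_distrib]
    refine Finset.sum_congr rfl fun i _ => ?_
    simp only [hf, Sum.elim_inl, Sum.elim_inr, conductance_add_single, conductance_sub_single]
  · intro y hy
    have hadj : (latticeGraph d).Adj x y := by
      by_contra h
      apply hy
      simp [conductance, SimpleGraph.mem_edgeSet, h]
    obtain ⟨i, h | h⟩ := eq_add_or_sub_single_of_adj hadj
    · simpa using Or.inl ⟨i, h.symm⟩
    · simpa using Or.inr ⟨i, h.symm⟩

theorem bond_injective {d : ℕ} {x y : Fin d → ℤ} {i j : Fin d} (h : bond x i = bond y j) :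
    x = y ∧ i = j := by
  have h1 : s(x, x + Pi.single i 1) = s(y, y + Pi.single j 1) := congrArg Subtype.val h
  rw [Sym2.eq_iff] at h1
  rcases h1 with ⟨rfl, h2⟩ | ⟨h2, h3⟩
  · refine ⟨rfl, ?_⟩
    by_contra hij
    have := congrFun h2 i
    simp [hij] at this
  · have h4 := congrFun h2 i
    have h5 := congrFun h3 i
    simp only [Pi.add_apply, Pi.single_eq_same, Pi.single_apply] at h4 h5
    split_ifs at h4 <;> omega

theorem mem_latticeBall_iff_box {d : ℕ} {x y : Fin d → ℤ} {r : ℝ} :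
    y ∈ latticeBall x r ↔ y - x ∈ box d ⌊r⌋ := by
  simp only [latticeBall, Finset.mem_Icc, Pi.le_def, mem_box, Pi.sub_apply, ← forall_and]
  refine forall_congr' fun i => ?_
  constructor <;> rintro ⟨h1, h2⟩ <;> constructor <;> linarith

theorem card_latticeBall {d : ℕ} (x : Fin d → ℤ) (r : ℝ) :
    (latticeBall x r).card = (box d ⌊r⌋).card := by
  refine Finset.card_bij' (fun y _ => y - x) (fun y _ => y + x) ?_ ?_ ?_ ?_
  · intro y hy
    exact mem_latticeBall_iff_box.1 hy
  · intro y hy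
    rw [mem_latticeBall_iff_box]
    simpa using hy
  · intro y _
    simp
  · intro y _
    simp

/-- Each bond is determined by its direction and its lower endpoint, which lies in S. -/
theorem card_bondsIn_le {d : ℕ} (S : Finset (Fin d → ℤ)) : (bondsIn S).card ≤ d * S.card := by
  classical
  have h : bondsIn S ⊆ (Finset.univ ×ˢ S).image fun z : Fin d × (Fin d → ℤ) => bond z.2 z.1 := by
    rintro ⟨e, he⟩ hS
    rw [mem_bondsIn] at hS
    induction e using Sym2.ind with
    | _ x y =>
      have hx : x ∈ S := hS x (by simp)
      have hy : y ∈ S := hS y (by simp)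
      obtain ⟨i, h | h⟩ := eq_add_or_sub_single_of_adj ((SimpleGraph.mem_edgeSet _).1 he)
      · refine Finset.mem_image.2 ⟨(i, x), by simp [hx], Subtype.ext ?_⟩
        simp [bond, h]
      · refine Finset.mem_image.2 ⟨(i, y), by simp [hy], Subtype.ext ?_⟩
        simp [bond, h, Sym2.eq_swap]
  refine (Finset.card_le_card h).trans (Finset.card_image_le.trans ?_)
  simp

theorem sum_box_bond_le {d : ℕ} {R : ℤ} {r : ℝ} (hR : R + 1 ≤ ⌊r⌋) (x₀ : Fin d → ℤ)
    {F : Bond d → ℝ} (hF : ∀ e, 0 ≤ F e) :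
    ∑ i, ∑ x ∈ box d R, F (bond (x₀ + x) i) ≤ ∑ e ∈ bondsIn (latticeBall x₀ r), F e := by
  classical
  rw [← Finset.sum_product' (f := fun i x => F (bond (x₀ + x) i))]
  refine le_trans (le_of_eq (Finset.sum_image
    (g := fun z : Fin d × (Fin d → ℤ) => bond (x₀ + z.2) z.1) (f := F) ?_).symm) ?_
  · rintro ⟨i, x⟩ _ ⟨j, y⟩ _ h
    obtain ⟨h1, h2⟩ := bond_injective h
    exact Prod.ext h2 (add_left_cancel h1)
  · refine Finset.sum_le_sum_of_subset_of_nonneg ?_ fun e _ _ => hF e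
    intro e he
    obtain ⟨⟨i, x⟩, hz, rfl⟩ := Finset.mem_image.1 he
    have hx : x ∈ box d R := (Finset.mem_product.1 hz).2
    rw [mem_bondsIn]
    intro y hy
    have hy' : y = x₀ + x ∨ y = x₀ + x + Pi.single i 1 := by simpa [bond] using hy
    rw [mem_latticeBall_iff_box]
    rcases hy' with rfl | rfl
    · rw [add_sub_cancel_left]
      exact box_mono (by omega) hx
    · rw [add_assoc, add_sub_cancel_left]
      exact box_mono hR (add_single_mem_box hx i)

/-! ### Averaged norms, oscillation and moments -/

theorem avgNorm_ofReal {d : ℕ} {p : ℝ} (hp : 0 < p) (S : Finset (Fin d → ℤ)) (F : Bond d → ℝ) :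
    avgNorm (ENNReal.ofReal p) S F =
      (((bondsIn S).card : ℝ)⁻¹ * ∑ e ∈ bondsIn S, |F e| ^ p) ^ (1 / p) := by
  rw [avgNorm, if_neg ENNReal.ofReal_ne_top, ENNReal.toReal_ofReal hp.le]

theorem avgNorm_nonneg {d : ℕ} (p : ℝ≥0∞) (S : Finset (Fin d → ℤ)) (F : Bond d → ℝ) :
    0 ≤ avgNorm p S F := by
  rw [avgNorm]
  split_ifs
  · refine Real.sSup_nonneg ?_
    rintro _ ⟨e, _, rfl⟩
    exact abs_nonneg _
  · have : 0 ≤ ∑ e ∈ bondsIn S, |F e| ^ p.toReal := Finset.sum_nonneg fun _ _ => by positivity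
    positivity

/-- Jensen's inequality for the uniform measure on bonds; for p = ∞ each term is bounded by the
supremum. -/
theorem avgNorm_mono {d : ℕ} {r : ℝ} {p : ℝ≥0∞} (hr : 0 < r) (hrp : ENNReal.ofReal r ≤ p)
    {S : Finset (Fin d → ℤ)} (hS : (bondsIn S).Nonempty) (F : Bond d → ℝ) :
    avgNorm (ENNReal.ofReal r) S F ≤ avgNorm p S F := by
  have hcard : (0 : ℝ) < (bondsIn S).card := by exact_mod_cast Finset.card_pos.2 hS
  rw [avgNorm_ofReal hr]
  have h0 : 0 ≤ ((bondsIn S).card : ℝ)⁻¹ * ∑ e ∈ bondsIn S, |F e| ^ r :=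
    mul_nonneg (by positivity) (Finset.sum_nonneg fun _ _ => by positivity)
  by_cases hp : p = ∞
  · rw [avgNorm, if_pos hp]
    set M := sSup ((fun e => |F e|) '' (bondsIn S : Set (Bond d))) with hM
    have hle : ∀ e ∈ bondsIn S, |F e| ≤ M := fun e he =>
      le_csSup (((bondsIn S).finite_toSet.image _).bddAbove) ⟨e, he, rfl⟩
    have hM0 : 0 ≤ M := by
      obtain ⟨e, he⟩ := hS
      exact (abs_nonneg _).trans (hle e he)
    have h1 : ((bondsIn S).card : ℝ)⁻¹ * ∑ e ∈ bondsIn S, |F e| ^ r ≤ M ^ r := by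
      rw [inv_mul_le_iff₀ hcard, ← nsmul_eq_mul, ← Finset.sum_const]
      exact Finset.sum_le_sum fun e he => Real.rpow_le_rpow (abs_nonneg _) (hle e he) hr.le
    refine (Real.rpow_le_rpow h0 h1 (by positivity)).trans (le_of_eq ?_)
    rw [← Real.rpow_mul hM0, mul_one_div_cancel hr.ne', Real.rpow_one]
  · rw [avgNorm, if_neg hp]
    set P := p.toReal with hP
    have hrP : r ≤ P := by
      rw [hP]
      exact (ENNReal.ofReal_le_iff_le_toReal hp).1 hrp
    have hP0 : 0 < P := hr.trans_le hrP
    have h1 := Real.rpow_arith_mean_le_arith_mean_rpow (bondsIn S)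
      (fun _ => ((bondsIn S).card : ℝ)⁻¹) (fun e => |F e| ^ r) (fun _ _ => by positivity)
      (by rw [Finset.sum_const, nsmul_eq_mul, mul_inv_cancel₀ hcard.ne'])
      (fun _ _ => by positivity) (p := P / r) (by rwa [le_div_iff₀ hr, one_mul])
    rw [← Finset.mul_sum, ← Finset.mul_sum] at h1
    have h2 : ∀ e, (|F e| ^ r) ^ (P / r) = |F e| ^ P := fun e => by
      rw [← Real.rpow_mul (abs_nonneg _), mul_div_cancel₀ _ hr.ne']
    simp only [h2] at h1
    have h3 := Real.rpow_le_rpow (Real.rpow_nonneg h0 _) h1 (z := 1 / P) (by positivity)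
    rw [← Real.rpow_mul h0] at h3
    rwa [show P / r * (1 / P) = 1 / r by field_simp] at h3

/-- Cauchy–Schwarz for p = q = 1, then monotonicity in the exponents. -/
theorem one_le_avgNorm_mul {d : ℕ} {ω : Bond d → ℝ} (hω : ∀ e, 0 < ω e) {p q : ℝ≥0∞} (hp : 1 ≤ p)
    (hq : 1 ≤ q) {S : Finset (Fin d → ℤ)} (hS : (bondsIn S).Nonempty) :
    1 ≤ avgNorm p S ω * avgNorm q S (fun e => (ω e)⁻¹) := by
  have hcard : (0 : ℝ) < (bondsIn S).card := by exact_mod_cast Finset.card_pos.2 hS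
  have h1 := avgNorm_mono one_pos (p := p) (by rwa [ENNReal.ofReal_one]) hS ω
  have h2 := avgNorm_mono one_pos (p := q) (by rwa [ENNReal.ofReal_one]) hS (fun e => (ω e)⁻¹)
  refine le_trans ?_ (mul_le_mul h1 h2 (avgNorm_nonneg _ _ _) (avgNorm_nonneg _ _ _))
  rw [avgNorm_ofReal one_pos, avgNorm_ofReal one_pos]
  simp only [div_one, Real.rpow_one, abs_of_pos (hω _), abs_of_pos (inv_pos.2 (hω _))]
  have hsum : 0 < ∑ e ∈ bondsIn S, ω e := Finset.sum_pos (fun e _ => hω e) hS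
  have h3 := Finset.sq_sum_div_le_sum_sq_div (bondsIn S) (fun _ => (1 : ℝ)) (g := ω)
    (fun e _ => hω e)
  rw [Finset.sum_const, nsmul_eq_mul, mul_one, div_le_iff₀ hsum] at h3
  simp only [one_pow, one_div] at h3
  calc (1 : ℝ) = (((bondsIn S).card : ℝ)⁻¹) ^ 2 * ((bondsIn S).card : ℝ) ^ 2 := by
        field_simp
    _ ≤ (((bondsIn S).card : ℝ)⁻¹) ^ 2 * ((∑ e ∈ bondsIn S, (ω e)⁻¹) * ∑ e ∈ bondsIn S, ω e) :=
        mul_le_mul_of_nonneg_left h3 (by positivity)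
    _ = _ := by ring

theorem osc_le {d : ℕ} {u : (Fin d → ℤ) → ℝ} {S : Finset (Fin d → ℤ)} (hS : S.Nonempty) {l h : ℝ}
    (hl : ∀ x ∈ S, l ≤ u x) (hh : ∀ x ∈ S, u x ≤ h) : osc u S ≤ h - l := by
  have hne : (u '' (S : Set (Fin d → ℤ))).Nonempty := by
    obtain ⟨x, hx⟩ := hS
    exact ⟨u x, x, hx, rfl⟩
  refine sub_le_sub (csSup_le hne ?_) (le_csInf hne ?_)
  · rintro _ ⟨x, hx, rfl⟩
    exact hh x hx
  · rintro _ ⟨x, hx, rfl⟩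
    exact hl x hx

theorem le_sSup_image {d : ℕ} (u : (Fin d → ℤ) → ℝ) {S : Finset (Fin d → ℤ)} {x : Fin d → ℤ}
    (hx : x ∈ S) : u x ≤ sSup (u '' (S : Set (Fin d → ℤ))) :=
  le_csSup (S.finite_toSet.image u).bddAbove ⟨x, hx, rfl⟩

theorem sInf_image_le {d : ℕ} (u : (Fin d → ℤ) → ℝ) {S : Finset (Fin d → ℤ)} {x : Fin d → ℤ}
    (hx : x ∈ S) : sInf (u '' (S : Set (Fin d → ℤ))) ≤ u x :=
  csInf_le (S.finite_toSet.image u).bddBelow ⟨x, hx, rfl⟩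

theorem osc_nonneg {d : ℕ} (u : (Fin d → ℤ) → ℝ) {S : Finset (Fin d → ℤ)} (hS : S.Nonempty) :
    0 ≤ osc u S := by
  obtain ⟨x, hx⟩ := hS
  exact sub_nonneg.2 ((sInf_image_le u hx).trans (le_sSup_image u hx))

theorem moment_bond_le {d N : ℕ} (hd : 1 ≤ d) (hN : 1 ≤ N) {r : ℝ} (hr : 3 * (N : ℤ) + 1 ≤ ⌊r⌋)
    (hr' : ⌊r⌋ ≤ 7 * (N : ℤ)) (x₀ : Fin d → ℤ) {p : ℝ} (hp : 1 ≤ p) {F : Bond d → ℝ}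
    (hF : ∀ e, 0 ≤ F e) :
    moment N p (fun i x => F (bond (x₀ + x) i)) ≤
      (d * 15 ^ d * avgNorm (ENNReal.ofReal p) (latticeBall x₀ r) F) ^ p := by
  have hN1 : (1 : ℝ) ≤ N := by exact_mod_cast hN
  have hp0 : 0 < p := by linarith
  have hFp : ∀ e, 0 ≤ F e ^ p := fun e => Real.rpow_nonneg (hF e) _
  set S := latticeBall x₀ r with hS
  have h1 := sum_box_bond_le hr x₀ hFp
  rw [← hS] at h1
  set avg := avgNorm (ENNReal.ofReal p) S F with havg
  have havg0 : 0 ≤ avg := avgNorm_nonneg _ _ _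
  -- The side length is at most 2·7N + 1 ≤ 15N.
  have hcard : ((bondsIn S).card : ℝ) ≤ d * (15 * N) ^ d := by
    have h2 : ((bondsIn S).card : ℝ) ≤ d * S.card := by exact_mod_cast card_bondsIn_le S
    refine h2.trans (mul_le_mul_of_nonneg_left ?_ (Nat.cast_nonneg _))
    rw [hS, card_latticeBall, card_box d (by omega)]
    have h3 : ((⌊r⌋ : ℤ) : ℝ) ≤ 7 * N := by exact_mod_cast hr'
    have h4 : (0 : ℝ) ≤ (⌊r⌋ : ℤ) := by
      have : (0 : ℤ) ≤ ⌊r⌋ := by omega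
      exact_mod_cast this
    exact pow_le_pow_left₀ (by linarith) (by linarith) d
  have hsum : ∑ e ∈ bondsIn S, F e ^ p = (bondsIn S).card * avg ^ p := by
    have hnn : 0 ≤ ((bondsIn S).card : ℝ)⁻¹ * ∑ e ∈ bondsIn S, |F e| ^ p :=
      mul_nonneg (by positivity) (Finset.sum_nonneg fun _ _ => by positivity)
    rw [havg, avgNorm_ofReal hp0, ← Real.rpow_mul hnn, one_div_mul_cancel hp0.ne', Real.rpow_one]
    simp only [abs_of_nonneg (hF _)]
    rcases Finset.eq_empty_or_nonempty (bondsIn S) with h | h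
    · simp [h]
    · have : ((bondsIn S).card : ℝ) ≠ 0 := by
        exact_mod_cast (Finset.card_pos.2 h).ne'
      field_simp
  have hK : (1 : ℝ) ≤ d * 15 ^ d := by
    have h2 : (1 : ℝ) ≤ d := by exact_mod_cast hd
    have h3 : (1 : ℝ) ≤ 15 ^ d := one_le_pow₀ (by norm_num)
    nlinarith
  rw [moment, inv_mul_le_iff₀ (by positivity)]
  calc _ ≤ ∑ e ∈ bondsIn S, F e ^ p := h1
    _ = (bondsIn S).card * avg ^ p := hsum
    _ ≤ d * (15 * N) ^ d * avg ^ p := by gcongr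
    _ = (N : ℝ) ^ d * (d * 15 ^ d * avg ^ p) := by
      rw [mul_pow]
      ring
    _ ≤ (N : ℝ) ^ d * ((d * 15 ^ d) ^ p * avg ^ p) := by
      gcongr
      exact Real.self_le_rpow_of_one_le hK hp
    _ = _ := by rw [Real.mul_rpow (by positivity) havg0]

/-! ### From the lower bound to oscillation decay -/

theorem lap_bond_affine {d : ℕ} (ω : Bond d → ℝ) (u : (Fin d → ℤ) → ℝ) (x₀ x : Fin d → ℤ)
    (c b : ℝ) : lap (fun i x => ω (bond (x₀ + x) i)) (fun x => c * u (x₀ + x) + b) x =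
      c * generator ω u (x₀ + x) := by
  rw [generator_eq_lap, lap, lap, Finset.mul_sum]
  refine Finset.sum_congr rfl fun i _ => ?_
  simp only [add_assoc, add_sub_assoc]
  ring

theorem four_mul_le_floor {n : ℝ} {N : ℕ} (hN : ⌊n⌋ = N) : 4 * (N : ℤ) ≤ ⌊4 * n⌋ := by
  rw [Int.le_floor]
  have := Int.floor_le n
  rw [hN] at this
  push_cast at this ⊢
  linarith

theorem floor_four_mul_le {n : ℝ} {N : ℕ} (hN : ⌊n⌋ = N) (hN1 : 1 ≤ N) :
    ⌊4 * n⌋ ≤ 7 * (N : ℤ) := by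
  -- Then ⌊4n⌋ ≤ 4N + 3 ≤ 7N because N ≥ 1.
  have h1 : ⌊4 * n⌋ < 4 * (N : ℤ) + 4 := by
    rw [Int.floor_lt]
    have := Int.lt_floor_add_one n
    rw [hN] at this
    push_cast at this ⊢
    linarith
  omega

theorem exists_lower_bound_of_logBound {d : ℕ} (hd : 1 ≤ d) {p q : ℝ} (hp : 1 ≤ p) (hq : 1 ≤ q)
    (h : LogBound d p q) :
    ∃ C e : ℝ, 0 ≤ C ∧ 0 ≤ e ∧ ∀ ω : Bond d → ℝ, (∀ b, 0 < ω b) →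
      ∀ (x₀ : Fin d → ℤ) (n : ℝ) (N : ℕ), 1 ≤ N → ⌊n⌋ = N → ∀ Λ : ℝ,
      Λ = avgNorm (ENNReal.ofReal p) (latticeBall x₀ (4 * n)) ω *
        avgNorm (ENNReal.ofReal q) (latticeBall x₀ (4 * n)) (fun b => (ω b)⁻¹) → 1 ≤ Λ →
      ∀ z : (Fin d → ℤ) → ℝ, (∀ x ∈ box d (3 * N + 1), 0 < z x) →
      (∀ x ∈ box d (3 * N - 1), lap (fun i x => ω (bond (x₀ + x) i)) z x = 0) →
      (box d (2 * N)).card ≤ 2 * ((box d (2 * N)).filter fun x => 1 / 2 ≤ z x).card →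
      ∀ x ∈ box d N, Real.exp (-(C * Λ ^ e)) / 2 ≤ z x := by
  obtain ⟨C, e, hC, he, hlog⟩ := h
  set K : ℝ := d * 15 ^ d with hK
  have hK1 : (1 : ℝ) ≤ K := by
    have h2 : (1 : ℝ) ≤ d := by exact_mod_cast hd
    have h3 : (1 : ℝ) ≤ 15 ^ d := one_le_pow₀ (by norm_num)
    nlinarith
  refine ⟨C * (K * K) ^ e, e, by positivity, he,
    fun ω hω x₀ n N hN hNn Λ hΛ hΛ1 z hz hlap hhalf x hx => ?_⟩
  have hM1 := four_mul_le_floor hNn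
  have hM2 := floor_four_mul_le hNn hN
  have hA0 := avgNorm_nonneg (ENNReal.ofReal p) (latticeBall x₀ (4 * n)) ω
  have hB0 := avgNorm_nonneg (ENNReal.ofReal q) (latticeBall x₀ (4 * n)) (fun b => (ω b)⁻¹)
  have hmA := moment_bond_le hd hN (by omega) hM2 x₀ hp fun b => (hω b).le
  have hmB := moment_bond_le hd hN (by omega) hM2 x₀ hq fun b => (inv_pos.2 (hω b)).le
  rw [← hK] at hmA hmB
  generalize avgNorm (ENNReal.ofReal p) (latticeBall x₀ (4 * n)) ω = A at *
  generalize avgNorm (ENNReal.ofReal q) (latticeBall x₀ (4 * n)) (fun b => (ω b)⁻¹) = B at *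
  have hKK : K * A * (K * B) = K * K * Λ := by
    rw [hΛ]
    ring
  have hKΛ : 1 ≤ K * A * (K * B) := by
    rw [hKK]
    exact one_le_mul_of_one_le_of_one_le (one_le_mul_of_one_le_of_one_le hK1 hK1) hΛ1
  have h1 := hlog N hN (fun i x => ω (bond (x₀ + x) i)) (fun _ _ => hω _) (K * A) (K * B)
    (mul_nonneg (by linarith) hA0) (mul_nonneg (by linarith) hB0) hKΛ hmA hmB z hz hlap hhalf x hx
  have hzx := hz x (box_mono (by omega) hx)
  rw [hKK, Real.mul_rpow (by positivity) (by linarith), ← mul_assoc] at h1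
  have h2 := Real.exp_le_exp.2 (neg_le_neg h1)
  rw [neg_neg, Real.exp_log (by linarith)] at h2
  linarith

theorem osc_le_of_lower_bound {d : ℕ} {ω : Bond d → ℝ} {u : (Fin d → ℤ) → ℝ} {x₀ : Fin d → ℤ}
    {n : ℝ} {N : ℕ} (hN : 1 ≤ N) (hNn : ⌊n⌋ = N)
    (hsol : ∀ x ∈ latticeBall x₀ (4 * n), generator ω u x = 0) {δ : ℝ} (hδ0 : 0 ≤ δ)
    (hlower : ∀ z : (Fin d → ℤ) → ℝ, (∀ x ∈ box d (3 * N + 1), 0 < z x) →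
      (∀ x ∈ box d (3 * N - 1), lap (fun i x => ω (bond (x₀ + x) i)) z x = 0) →
      (box d (2 * N)).card ≤ 2 * ((box d (2 * N)).filter fun x => 1 / 2 ≤ z x).card →
      ∀ x ∈ box d N, δ ≤ z x) :
    osc u (latticeBall x₀ n) ≤ (1 - δ) * osc u (latticeBall x₀ (4 * n)) := by
  have hM1 := four_mul_le_floor hNn
  set S := latticeBall x₀ (4 * n) with hS
  have hmemS : ∀ x ∈ box d (3 * (N : ℤ) + 1), x₀ + x ∈ S := fun x hx => by
    rw [hS, mem_latticeBall_iff_box, add_sub_cancel_left]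
    exact box_mono (by omega) hx
  have hne : (latticeBall x₀ n).Nonempty := ⟨x₀, by
    rw [mem_latticeBall_iff_box, sub_self]
    exact zero_mem_box (by omega)⟩
  -- The range of u is widened by ε on both sides, so that the normalised functions are strictly
  -- positive and W > 0 even for constant u.
  refine le_of_forall_pos_le_add fun η hη => ?_
  set m := sInf (u '' (S : Set (Fin d → ℤ))) with hm
  set M := sSup (u '' (S : Set (Fin d → ℤ))) with hM
  have hosc : osc u S = M - m := rfl
  have hmM : 0 ≤ M - m := osc_nonneg u ⟨x₀, by simpa using hmemS 0 (zero_mem_box (by omega))⟩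
  set ε := η / 2 with hε
  have hε0 : 0 < ε := by positivity
  set W := M - m + 2 * ε with hW
  have hW0 : 0 < W := by positivity
  suffices h1 : osc u (latticeBall x₀ n) ≤ (1 - δ) * W by
    rw [hosc]
    refine h1.trans ?_
    rw [hW]
    nlinarith
  set z : (Fin d → ℤ) → ℝ := fun x => W⁻¹ * u (x₀ + x) + -(W⁻¹ * (m - ε)) with hz
  have hz1 : ∀ x, z x = (u (x₀ + x) - (m - ε)) / W := fun x => by
    simp only [hz]
    ring
  set z' : (Fin d → ℤ) → ℝ := fun x => -W⁻¹ * u (x₀ + x) + W⁻¹ * (M + ε) with hz'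
  have hz1' : ∀ x, z' x = (M + ε - u (x₀ + x)) / W := fun x => by
    simp only [hz']
    ring
  have hzpos : ∀ x ∈ box d (3 * (N : ℤ) + 1), 0 < z x := by
    intro x hx
    rw [hz1]
    have := sInf_image_le u (hmemS x hx)
    exact div_pos (by linarith) hW0
  have hzpos' : ∀ x ∈ box d (3 * (N : ℤ) + 1), 0 < z' x := by
    intro x hx
    rw [hz1']
    have := le_sSup_image u (hmemS x hx)
    exact div_pos (by linarith) hW0
  have hharm : ∀ x ∈ box d (3 * (N : ℤ) - 1), generator ω u (x₀ + x) = 0 := fun x hx =>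
    hsol _ (hmemS x (box_mono (by omega) hx))
  have hzlap : ∀ x ∈ box d (3 * (N : ℤ) - 1), lap (fun i x => ω (bond (x₀ + x) i)) z x = 0 := fun x hx => by
    rw [hz, lap_bond_affine, hharm x hx, mul_zero]
  have hzlap' : ∀ x ∈ box d (3 * (N : ℤ) - 1), lap (fun i x => ω (bond (x₀ + x) i)) z' x = 0 := fun x hx => by
    rw [hz', lap_bond_affine, hharm x hx, mul_zero]
  have hball : ∀ x ∈ latticeBall x₀ n, ∃ y ∈ box d (N : ℤ), x = x₀ + y := fun x hx => by
    rw [mem_latticeBall_iff_box, hNn] at hx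
    exact ⟨x - x₀, hx, by simp⟩
  have hsum : ∀ x, z x + z' x = 1 := fun x => by
    rw [hz1, hz1', ← add_div, div_eq_one_iff_eq hW0.ne', hW]
    ring
  -- As z + z' = 1, at every point one of the two is at least 1/2.
  have hdich : (box d (2 * N)).card ≤ 2 * ((box d (2 * N)).filter fun x => 1 / 2 ≤ z x).card ∨
      (box d (2 * N)).card ≤ 2 * ((box d (2 * N)).filter fun x => 1 / 2 ≤ z' x).card := by
    have h1 := Finset.card_filter_add_card_filter_not (s := box d (2 * N)) (fun x => 1 / 2 ≤ z x)
    have h2 : ((box d (2 * N)).filter fun x => ¬ 1 / 2 ≤ z x).card ≤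
        ((box d (2 * N)).filter fun x => 1 / 2 ≤ z' x).card := by
      refine Finset.card_le_card fun x hx => ?_
      rw [Finset.mem_filter] at hx ⊢
      exact ⟨hx.1, by linarith [hsum x, not_le.1 hx.2]⟩
    omega
  rcases hdich with hhalf | hhalf
  · have h2 := hlower z hzpos hzlap hhalf
    refine (osc_le hne (l := m - ε + δ * W) (h := M + ε) (fun x hx => ?_) fun x hx => ?_).trans
      (le_of_eq ?_)
    · obtain ⟨y, hy, rfl⟩ := hball x hx
      have h3 := h2 y hy
      rw [hz1, le_div_iff₀ hW0] at h3
      linarith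
    · obtain ⟨y, hy, rfl⟩ := hball x hx
      linarith [le_sSup_image u (hmemS y (box_mono (by omega) hy))]
    · rw [hW]
      ring
  · have h2 := hlower z' hzpos' hzlap' hhalf
    refine (osc_le hne (l := m - ε) (h := M + ε - δ * W) (fun x hx => ?_) fun x hx => ?_).trans
      (le_of_eq ?_)
    · obtain ⟨y, hy, rfl⟩ := hball x hx
      linarith [sInf_image_le u (hmemS y (box_mono (by omega) hy))]
    · obtain ⟨y, hy, rfl⟩ := hball x hx
      have h3 := h2 y hy
      rw [hz1', le_div_iff₀ hW0] at h3
      linarith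
    · rw [hW]
      ring

/-! ### Choice of exponents and conclusion -/

theorem ofReal_one_div_le {α : ℝ} {p : ℝ≥0∞} (hα : 0 < α) (hp : p⁻¹ ≠ ∞) (h : p⁻¹.toReal ≤ α) :
    ENNReal.ofReal (1 / α) ≤ p := by
  rw [one_div, ENNReal.ofReal_inv_of_pos hα, ENNReal.inv_le_iff_inv_le]
  exact (ENNReal.le_ofReal_iff_toReal_le hp hα.le).2 h

/-- The strict inequality for d ≥ 3 leaves room to lower both exponents slightly. This makes them
finite, so p = ∞ and q = ∞ need no separate proof, and it forces s < 2. -/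
theorem exists_logBound {d : ℕ} (hd : 2 ≤ d) {p q : ℝ≥0∞} (hpq₂ : d = 2 → p = 1 ∧ q = 1)
    (hpq₃ : 3 ≤ d → 1 < p ∧ 1 < q ∧ 1 / p + 1 / q < 2 / ((d : ℝ≥0∞) - 1)) :
    ∃ p' q' : ℝ, 1 ≤ p' ∧ 1 ≤ q' ∧ ENNReal.ofReal p' ≤ p ∧ ENNReal.ofReal q' ≤ q ∧
      LogBound d p' q' := by
  rcases hd.eq_or_lt with rfl | hd3
  · obtain ⟨rfl, rfl⟩ := hpq₂ rfl
    exact ⟨1, 1, le_rfl, le_rfl, by simp, by simp, logBound_two⟩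
  obtain ⟨hp, hq, hpq⟩ := hpq₃ hd3
  obtain ⟨D, rfl⟩ : ∃ D, d = D + 1 := ⟨d - 1, by omega⟩
  have hD : 2 ≤ D := by omega
  have hD2 : (2 : ℝ) ≤ D := by exact_mod_cast hD
  have hp' : p⁻¹ ≠ ∞ := ENNReal.inv_ne_top.2 (by rintro rfl; simp at hp)
  have hq' : q⁻¹ ≠ ∞ := ENNReal.inv_ne_top.2 (by rintro rfl; simp at hq)
  set α := p⁻¹.toReal with hα
  set β := q⁻¹.toReal with hβ
  have hα0 : 0 ≤ α := ENNReal.toReal_nonneg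
  have hβ0 : 0 ≤ β := ENNReal.toReal_nonneg
  have hαβ : α + β < 2 / D := by
    have h1 : ((D + 1 : ℕ) : ℝ≥0∞) - 1 = D := by
      push_cast
      exact ENNReal.add_sub_cancel_right ENNReal.one_ne_top
    rw [h1, one_div, one_div] at hpq
    have h2 := (ENNReal.toReal_lt_toReal (ENNReal.add_ne_top.2 ⟨hp', hq'⟩)
      (ENNReal.div_ne_top (by simp) (by simp; omega))).2 hpq
    rw [ENNReal.toReal_add hp' hq', ENNReal.toReal_div] at h2
    rw [hα, hβ]
    simpa using h2
  have hD1 : 2 / (D : ℝ) ≤ 1 := by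
    rw [div_le_one (by linarith)]
    exact hD2
  set ε := (2 / D - α - β) / 3 with hε
  have hε0 : 0 < ε := by
    rw [hε]
    linarith
  have hsum : (α + ε) + (β + ε) < 2 / D := by
    rw [hε]
    linarith
  -- With 1/s = (1+β+ε)/2 and 1/t = y/2 one has 1/s = 1/t + 1/D, and χ > 1 reads 1 - (α+ε) > y,
  -- which is `hsum`.
  set y : ℝ := 1 - 2 / D + (β + ε) with hy
  have hy0 : 0 < y := by linarith
  have hs0 : 0 < 2 / (1 + (β + ε)) := by positivity
  have key := logBound_of_two_le hD (p := 1 / (α + ε)) (s := 2 / (1 + (β + ε))) (t := 2 / y)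
    (by
      rw [lt_div_iff₀ (by linarith)]
      linarith)
    (by
      rw [lt_div_iff₀ hy0]
      linarith)
    (by
      rw [one_div_div, one_div_div, hy]
      ring)
    (by
      rw [le_div_iff₀ (by linarith)]
      linarith)
    (by
      rw [div_lt_iff₀ (by linarith)]
      linarith)
    (by
      rw [one_div_one_div, div_mul_eq_mul_div, div_div, lt_div_iff₀ (by positivity)]
      linarith)
  have hqq : 2 / (1 + (β + ε)) / (2 - 2 / (1 + (β + ε))) = 1 / (β + ε) := by
    have h1 : 1 + (β + ε) ≠ 0 := by positivity
    have h2 : β + ε ≠ 0 := by positivity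
    have h3 : 2 - 2 / (1 + (β + ε)) = 2 * (β + ε) / (1 + (β + ε)) := by
      field_simp
      ring
    rw [h3]
    field_simp
  rw [hqq] at key
  refine ⟨1 / (α + ε), 1 / (β + ε), ?_, ?_, ofReal_one_div_le (by linarith) hp' (by linarith),
    ofReal_one_div_le (by linarith) hq' (by linarith), key⟩
  · rw [le_div_iff₀ (by linarith)]
    linarith
  · rw [le_div_iff₀ (by linarith)]
    linarith

theorem bondsIn_latticeBall_nonempty {d : ℕ} (hd : 1 ≤ d) (x₀ : Fin d → ℤ) {r : ℝ} (hr : 1 ≤ r) :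
    (bondsIn (latticeBall x₀ r)).Nonempty := by
  have h1 : (1 : ℤ) ≤ ⌊r⌋ := Int.le_floor.2 (by simpa using hr)
  refine ⟨bond x₀ ⟨0, hd⟩, mem_bondsIn.2 fun y hy => ?_⟩
  have hy' : y = x₀ ∨ y = x₀ + Pi.single ⟨0, hd⟩ 1 := by simpa [bond] using hy
  rw [mem_latticeBall_iff_box]
  rcases hy' with rfl | rfl
  · rw [sub_self]
    exact zero_mem_box (by omega)
  · rw [add_sub_cancel_left]
    have := add_single_mem_box (zero_mem_box (d := d) (le_refl (0 : ℤ))) ⟨0, hd⟩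
    exact box_mono (by omega) (by simpa using this)

/-- The contraction factor `1 - exp (-C Λ ^ e) / 2`, as a function `[1, ∞) → (0, 1)`. -/
noncomputable def contractionFactor (C e : ℝ) (Λ : Set.Ici (1 : ℝ)) : Set.Ioo (0 : ℝ) 1 :=
  -- The absolute value keeps the factor in (0,1) for every real C.
  ⟨1 - Real.exp (-(|C| * (Λ : ℝ) ^ e)) / 2, by
    have h0 : (0 : ℝ) ≤ Λ := zero_le_one.trans Λ.2
    have h1 : Real.exp (-(|C| * (Λ : ℝ) ^ e)) ≤ 1 :=
      Real.exp_le_one_iff.2 (neg_nonpos.2 (by positivity))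
    have h2 := Real.exp_pos (-(|C| * (Λ : ℝ) ^ e))
    constructor <;> linarith⟩

theorem continuous_contractionFactor {C e : ℝ} (he : 0 ≤ e) :
    Continuous (contractionFactor C e) := by
  refine Continuous.subtype_mk ?_ _
  have : Continuous fun Λ : Set.Ici (1 : ℝ) => (Λ : ℝ) ^ e :=
    continuous_subtype_val.rpow_const fun _ => Or.inr he
  fun_prop

theorem monotone_contractionFactor {C e : ℝ} (he : 0 ≤ e) : Monotone (contractionFactor C e) := by
  intro Λ Λ' h
  rw [← Subtype.coe_le_coe]
  have h0 : (0 : ℝ) ≤ Λ := zero_le_one.trans Λ.2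
  have h1 : (Λ : ℝ) ≤ Λ' := h
  have h2 : |C| * (Λ : ℝ) ^ e ≤ |C| * (Λ' : ℝ) ^ e := by gcongr
  have h3 := Real.exp_le_exp.2 (neg_le_neg h2)
  simp only [contractionFactor]
  linarith

end RandomConductance

open RandomConductance

theorem theorem2 (d : ℕ) (hd : 2 ≤ d) (p q : ℝ≥0∞)
    (hpq₂ : d = 2 → p = 1 ∧ q = 1)
    (hpq₃ : 3 ≤ d → 1 < p ∧ 1 < q ∧ 1 / p + 1 / q < 2 / ((d : ℝ≥0∞) - 1)) :
    ∃ θ : Set.Ici (1 : ℝ) → Set.Ioo (0 : ℝ) 1, Continuous θ ∧ Monotone θ ∧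
      ∀ ω : Bond d → ℝ, (∀ e, 0 < ω e) →
      ∀ (u : (Fin d → ℤ) → ℝ) (x₀ : Fin d → ℤ) (n : ℝ), 1 ≤ 4 * n →
      (∀ x ∈ latticeBall x₀ (4 * n), generator ω u x = 0) →
      ∃ hΛ : 1 ≤ avgNorm p (latticeBall x₀ (4 * n)) ω *
          avgNorm q (latticeBall x₀ (4 * n)) (fun e => (ω e)⁻¹),
        osc u (latticeBall x₀ n) ≤
          (θ ⟨avgNorm p (latticeBall x₀ (4 * n)) ω *
            avgNorm q (latticeBall x₀ (4 * n)) (fun e => (ω e)⁻¹), hΛ⟩ : ℝ) *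
          osc u (latticeBall x₀ (4 * n)) := by
  obtain ⟨p', q', hp', hq', hpp, hqq, hlog⟩ := exists_logBound hd hpq₂ hpq₃
  obtain ⟨C, e, hC, he, hlower⟩ := exists_lower_bound_of_logBound (by omega) hp' hq' hlog
  refine ⟨contractionFactor C e, continuous_contractionFactor he, monotone_contractionFactor he,
    fun ω hω u x₀ n hn hsol => ?_⟩
  have hB := bondsIn_latticeBall_nonempty (by omega : 1 ≤ d) x₀ hn
  have one_le : ∀ {r : ℝ} {s : ℝ≥0∞}, 1 ≤ r → ENNReal.ofReal r ≤ s → 1 ≤ s := fun h1 h2 =>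
    le_trans (by simpa using ENNReal.ofReal_le_ofReal h1) h2
  have hΛ := one_le_avgNorm_mul hω (one_le hp' hpp) (one_le hq' hqq) hB
  refine ⟨hΛ, ?_⟩
  have hne : ∀ r : ℝ, 0 ≤ r → (latticeBall x₀ r).Nonempty := fun r hr => ⟨x₀, by
    rw [mem_latticeBall_iff_box, sub_self]
    exact zero_mem_box (Int.floor_nonneg.2 hr)⟩
  have hosc0 := osc_nonneg u (hne (4 * n) (by linarith))
  -- For n < 1 the small box is a single point and its oscillation vanishes.
  rcases lt_or_ge n 1 with hn1 | hn1
  · have h0 : ⌊n⌋ = 0 := Int.floor_eq_zero_iff.2 ⟨by linarith, hn1⟩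
    have hx : ∀ x ∈ latticeBall x₀ n, x = x₀ := fun x hx => by
      rw [mem_latticeBall_iff_box, h0, mem_box] at hx
      funext i
      have := hx i
      simp only [Pi.sub_apply] at this
      omega
    have h1 : osc u (latticeBall x₀ n) ≤ u x₀ - u x₀ :=
      osc_le (hne n (by linarith)) (fun x h => by rw [hx x h]) fun x h => by rw [hx x h]
    rw [sub_self] at h1
    exact h1.trans (mul_nonneg (contractionFactor C e _).2.1.le hosc0)
  · have hΛ' : 1 ≤ avgNorm (ENNReal.ofReal p') (latticeBall x₀ (4 * n)) ω *
        avgNorm (ENNReal.ofReal q') (latticeBall x₀ (4 * n)) (fun e => (ω e)⁻¹) :=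
      one_le_avgNorm_mul hω (one_le hp' le_rfl) (one_le hq' le_rfl) hB
    have hle : avgNorm (ENNReal.ofReal p') (latticeBall x₀ (4 * n)) ω *
        avgNorm (ENNReal.ofReal q') (latticeBall x₀ (4 * n)) (fun e => (ω e)⁻¹) ≤
        avgNorm p (latticeBall x₀ (4 * n)) ω *
        avgNorm q (latticeBall x₀ (4 * n)) (fun e => (ω e)⁻¹) :=
      mul_le_mul (avgNorm_mono (by linarith) hpp hB ω) (avgNorm_mono (by linarith) hqq hB _)
        (avgNorm_nonneg _ _ _) (avgNorm_nonneg _ _ _)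
    obtain ⟨N, hNn⟩ : ∃ N : ℕ, ⌊n⌋ = N := Int.eq_ofNat_of_zero_le (Int.floor_nonneg.2 (by linarith))
    have hN : 1 ≤ N := by
      have : (1 : ℤ) ≤ ⌊n⌋ := Int.le_floor.2 (by simpa using hn1)
      omega
    have h1 := osc_le_of_lower_bound hN hNn hsol (by positivity)
      (hlower ω hω x₀ n N hN hNn _ rfl hΛ')
    refine h1.trans (mul_le_mul_of_nonneg_right ?_ hosc0)
    -- The contraction was obtained for the lowered exponents; their Λ is at most the given one, and
    -- the factor is monotone.
    have h2 := monotone_contractionFactor (C := C) he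
      (show (⟨_, hΛ'⟩ : Set.Ici (1 : ℝ)) ≤ ⟨_, hΛ⟩ from hle)
    rw [← Subtype.coe_le_coe] at h2
    simpa only [contractionFactor, abs_of_nonneg hC] using h2
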